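/- Let $F$ be a non-archimedean local field of residue characteristic $p\neq 2$ with normalized absolute value $|\cdot|$, $\lambda$ a non-trivial continuous unitary character of $F^+$, $\mathbb Q(\lambda)$ the field generated by its values, $E=\mathbb Q(\lambda)(\sqrt{-1})\subset\mathbb C$, and $\mathfrak H=\mathrm{Gal}(E/\mathbb Q(\sqrt p,\sqrt{-p}))$. Let $V=X\oplus Y$ be a finite-dimensional symplectic $F$-space decomposed into totally isotropic subspaces, with a basis $x_1,\dots,x_n$ of $X$ and the dual basis $y_1,\dots,y_n$ of $Y$ ($\langle x_i,y_j\rangle=\delta_{ij}$), and let $\mathcal S(X,E)$ be the space of locally constant compactly supported functions $X\to E$. Let $\mathrm{Gal}(E/\mathbb Q)$ act on $\mathcal S(X,E)$ by $(\sigma\phi)(x)=\sigma(\phi(x))$ and on operators by ${}^\sigma T=\sigma\circ T\circ\sigma^{-1}$. For $g=\begin{pmatrix}a&b\\c&d\end{pmatrix}\in \mathrm{Sp}(V)$ (acting on row vectors $x+y$ from the right) let $Y_g=Y/\ker c$ and let $W_\lambda(g)$ be the operator on $\mathcal S(X,E)$ $$[W_\lambda(g)\phi](x)=\int_{Y_g}\lambda\!\left(\tfrac12\big(\langle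 xa,xb\rangle-2\langle xb,yc\rangle+\langle yc,yd\rangle\big)\right)\phi(xa+yc)\,d\mu_{\lambda,g}y ,$$ where $\mu_{\lambda,g}=|\det(p_1p_2|_Y)|^{-1/2}\,\overline{p_1}\cdot\prod_{k\le i}d_\lambda y_k$ for any factorization $g=p_1\tau_ip_2$. Here $i=\dim Y_g$; $p_1,p_2$ lie in the stabilizer $P$ of $Y$ in $\mathrm{Sp}(V)$; $\tau_i$ sends $x_j\mapsto -y_j$, $y_j\mapsto x_j$ for $j\le i$ and fixes the other basis vectors; $d_\lambda$ is the Haar measure on $F$ self-dual for $\lambda$; and $\overline{p_1}\cdot$ denotes pullback along the isomorphism $Y_g\to Y_{\tau_i}=Fy_1+\dots+Fy_i$ induced by $p_1$. For $t\in F^*$ let $g_t\in\mathrm{Sp}(V)$ be $(x+y)g_t=t^{-1}x+ty$, and let $\iota=g_{-1}$. Let $\mathcal P$ be the closure of the prime ring of $F$ and $U_1=\{s\in\mathcal P: s\equiv 1 \bmod p\mathcal P\}$. For $s\in\mathcal P^*$ let $\sigma_s\in\mathrm{Gal}(\mathbb Q(\lambda)/\mathbb Q)$ be the automorphism $\zeta\mapsto\zeta^s$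 on the values $\zeta$ of $\lambda$. Let $\epsilon\in\mathcal P$ be a primitive $(p-1)$-th root of unity, $\eta\in\mathfrak H$ the element with $\eta|_{\mathbb Q(\lambda)}=\sigma_{\epsilon^2}$, and $u\in\mathbb Q(\nu_p,\sqrt{-1})$, where $\nu_p$ is the group of complex $p$-th roots of unity, an element with $N(u)=-1$ for the norm $N:\mathbb Q(\nu_p,\sqrt{-1})\to\mathbb Q(\sqrt p,\sqrt{-p})$. Each $\sigma\in\mathfrak H$ satisfies $\sigma|_{\mathbb Q(\lambda)}=\sigma_{\epsilon^{2i}s^2}$ for unique $1\le i\le (p-1)/2$ and $s\in U_1$; put $$A(\sigma)=\tfrac12(I+W_\lambda(\iota))+\Big(\prod_{l=0}^{i-1}\eta^l(u)\Big)\tfrac12(I-W_\lambda(\iota)),\qquad D(\sigma)=W_\lambda(g_{\epsilon^is}),\qquad \delta(\sigma)=A(\sigma)D(\sigma).$$ Then $\delta$ is a 1-cocycle $\mathfrak H\to\mathrm{GL}(\mathcal S(X,E))$, that is, $\delta(\sigma\tau)=\delta(\sigma)\,{}^\sigma\delta(\tau)$ for all $\sigma,\tau\in\mathfrak H$; it satisfies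 ${}^\sigma W_\lambda(g)=\delta(\sigma)^{-1}W_\lambda(g)\delta(\sigma)$ for all $\sigma\in\mathfrak H$ and $g\in \mathrm{Sp}(V)$; and it is trivial: there is $\alpha\in\mathrm{GL}(\mathcal S(X,E))$ with $$\delta(\sigma)=\alpha^{-1}\,{}^\sigma\alpha\qquad\text{for all }\sigma\in\mathfrak H .$$ -/

import Mathlib

open MeasureTheory ValuativeRel

/-! ### Local fields, characters and measures -/

/-- The space of locally constant functions of compact support on `M` with values in `L`. -/
def schwartz (M : Type*) [TopologicalSpace M] (L : Type*) [Field L] : Submodule L (M → L) where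
  carrier := {φ | IsLocallyConstant φ ∧ HasCompactSupport φ}
  add_mem' := fun hf hg => ⟨hf.1.add hg.1, hf.2.add hg.2⟩
  zero_mem' := ⟨IsLocallyConstant.const 0, HasCompactSupport.zero⟩
  smul_mem' := fun c _ hf => ⟨hf.1.comp (fun z => c * z), hf.2.smul_left (f := fun _ => c)⟩

section LocalField

variable {F : Type*} [Field F] [ValuativeRel F] [TopologicalSpace F] [IsNonarchimedeanLocalField F]

/-- The normalized absolute value `|s| = q ^ (-v(s))` of a local field (`valueGroupWithZeroIsoInt`
is the unique order isomorphism from the value group onto `ℤ`, a uniformizer having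
image `-1`). -/
noncomputable def normAbs (s : F) : ℝ :=
  open Classical in
  if s = 0 then 0 else
    (Nat.card 𝓀[F] : ℝ) ^
      (WithZero.log (IsNonarchimedeanLocalField.valueGroupWithZeroIsoInt F (valuation F s)))

/-- `μ` is a Haar measure on `F` which is self-dual for `lam`: the Fourier transform
`(ℱ φ)(s) = ∫ lam (s t) φ(t) dμ t` satisfies `ℱ (ℱ φ) t = φ (-t)`. -/
def IsSelfDual [MeasurableSpace F] (lam : AddChar F Circle) (μ : Measure F) : Prop :=
  μ.IsAddHaarMeasure ∧
    ∀ φ ∈ schwartz F ℂ, ∀ t : F,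
      (∫ s, (lam (t * s) : ℂ) * (∫ r, (lam (s * r) : ℂ) * φ r ∂μ) ∂μ) = φ (-t)

/-- The self-dual Haar measure of `lam` (it exists and is unique when `lam` is continuous and
nontrivial). -/
noncomputable def selfDualMeasure [MeasurableSpace F] (lam : AddChar F Circle) : Measure F :=
  open Classical in
  if h : ∃ μ : Measure F, IsSelfDual lam μ then h.choose else 0

variable (F) in
/-- The topological closure `𝒫` of the prime ring of `F`. -/
def primeClosure : Set F := closure (Set.range ((↑) : ℤ → F))

variable (F) in
/-- The group `U₁` of elements of `𝒫` congruent to `1` modulo `p 𝒫`; it is `{1}`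
when `F` has characteristic `p`. -/
def principalUnits (p : ℕ) : Set F :=
  {s | s ∈ primeClosure F ∧ ∃ z ∈ primeClosure F, s - 1 = (p : F) * z}

/-! ### The fields -/

/-- The field `E = ℚ(lam)(√-1)`. -/
noncomputable def charField (lam : AddChar F Circle) : IntermediateField ℚ ℂ :=
  IntermediateField.adjoin ℚ (Set.range (fun t => (lam t : ℂ)) ∪ {Complex.I})

/-- The field `ℚ(√p, √-p)`. -/
noncomputable def sqrtField (p : ℕ) : IntermediateField ℚ ℂ :=
  IntermediateField.adjoin ℚ {((Real.sqrt p : ℝ) : ℂ), Complex.I * ((Real.sqrt p : ℝ) : ℂ)}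

/-- The field generated over `ℚ(√p, √-p)` by the `p`-th roots of unity and `√-1`. For odd `p`
it is `ℚ(ν_p, √-1)`, which contains `√p` and `√-p`. -/
noncomputable def rootField (p : ℕ) : IntermediateField (sqrtField p) ℂ :=
  IntermediateField.adjoin (sqrtField p) ({z : ℂ | z ^ p = 1} ∪ {Complex.I})

/-- The group `ℌ = Gal(E / ℚ(√p, √-p))`, as a subgroup of `Gal(E / ℚ)`. -/
noncomputable def galH (p : ℕ) (lam : AddChar F Circle) :
    Subgroup (charField lam ≃ₐ[ℚ] charField lam) :=
  ((sqrtField p).comap (charField lam).val).fixingSubgroup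

/-- `σ` restricts on `ℚ(lam)` to `σ_s`, where `s ∈ 𝒫ˣ`: each value `ζ` of `lam` is sent
to `ζ ^ s`, which means `ζ ^ r` for any integer `r ≡ s` modulo `p ^ n 𝒫`,
if `ζ ^ (p ^ n) = 1`. -/
def RestrictsTo (p : ℕ) (lam : AddChar F Circle) (σ : charField lam ≃ₐ[ℚ] charField lam)
    (s : F) : Prop :=
  ∀ ζ : charField lam, (∃ t : F, (ζ : ℂ) = (lam t : ℂ)) →
    ∀ (n : ℕ) (r : ℤ), ζ ^ (p ^ n) = 1 →
      (∃ z ∈ primeClosure F, s - (r : F) = (p : F) ^ n * z) → σ ζ = ζ ^ r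

end LocalField

/-! ### Symplectic spaces -/

/-- A symplectic space `V` of dimension `2 n` with a decomposition `V = X + Y` into (maximal)
totally isotropic subspaces, a basis of `X` and the dual basis of `Y`. -/
structure PolarizedSpace (F V : Type*) [Field F] [AddCommGroup V] [Module F V] (n : ℕ) where
  form : LinearMap.BilinForm F V
  isAlt : form.IsAlt
  nondegenerate : form.Nondegenerate
  X : Submodule F V
  Y : Submodule F V
  isCompl : IsCompl X Y
  isotropic_X : ∀ v ∈ X, ∀ w ∈ X, form v w = 0
  isotropic_Y : ∀ v ∈ Y, ∀ w ∈ Y, form v w = 0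
  basisX : Module.Basis (Fin n) F X
  basisY : Module.Basis (Fin n) F Y
  dual : ∀ i j, form (basisX i : V) (basisY j : V) = if i = j then 1 else 0

namespace PolarizedSpace

section Algebra

variable {F V : Type*} [Field F] [AddCommGroup V] [Module F V] {n : ℕ} (S : PolarizedSpace F V n)

/-- Projection of `V` onto `X` along `Y`. -/
noncomputable def prX : V →ₗ[F] S.X := S.X.projectionOnto S.Y S.isCompl

/-- Projection of `V` onto `Y` along `X`. -/
noncomputable def prY : V →ₗ[F] S.Y := S.Y.projectionOnto S.X S.isCompl.symm

/-! The blocks of `g = (a b; c d)`. Elements of `V` are row vectors on which `g` acts on the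
right: `v g` is `g v` in Lean, and the product `g h` is the composite `h ∘ g`. -/

/-- The block `a : X → X`. -/
noncomputable def blockA (g : V →ₗ[F] V) : S.X →ₗ[F] S.X := S.prX ∘ₗ g ∘ₗ S.X.subtype
/-- The block `b : X → Y`. -/
noncomputable def blockB (g : V →ₗ[F] V) : S.X →ₗ[F] S.Y := S.prY ∘ₗ g ∘ₗ S.X.subtype
/-- The block `c : Y → X`. -/
noncomputable def blockC (g : V →ₗ[F] V) : S.Y →ₗ[F] S.X := S.prX ∘ₗ g ∘ₗ S.Y.subtype
/-- The block `d : Y → Y`. -/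
noncomputable def blockD (g : V →ₗ[F] V) : S.Y →ₗ[F] S.Y := S.prY ∘ₗ g ∘ₗ S.Y.subtype

/-- `g` belongs to `Sp(V)`. -/
def IsSymplectic (g : V ≃ₗ[F] V) : Prop := ∀ v w, S.form (g v) (g w) = S.form v w

/-- `g` belongs to the parabolic subgroup `P` of `Sp(V)`, the stabilizer of `Y`. -/
def IsParabolic (g : V ≃ₗ[F] V) : Prop := S.IsSymplectic g ∧ S.Y.map (g : V →ₗ[F] V) = S.Y

/-- The basis `x_1, …, x_n, y_1, …, y_n` of `V`. -/
noncomputable def basisV : Module.Basis (Fin n ⊕ Fin n) F V :=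
  (S.basisX.prod S.basisY).map (S.X.prodEquivOfIsCompl S.Y S.isCompl)

/-- The element `τ_i`: it sends `x_j` to `-y_j` and `y_j` to `x_j` for the first `i`
indices `j`, and fixes the other basis vectors. -/
noncomputable def tau (i : ℕ) : V →ₗ[F] V :=
  S.basisV.constr F (Sum.elim
    (fun j => if (j : ℕ) < i then -(S.basisY j : V) else (S.basisX j : V))
    (fun j => if (j : ℕ) < i then (S.basisX j : V) else (S.basisY j : V)))

/-- The map `g_t`, given by `(x + y) g_t = t⁻¹ x + t y`. -/
noncomputable def gMap (t : F) : V →ₗ[F] V :=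
  t⁻¹ • (S.X.subtype ∘ₗ S.prX) + t • (S.Y.subtype ∘ₗ S.prY)

/-- The space `Y_g = Y / ker c`. -/
noncomputable abbrev quotY (g : V →ₗ[F] V) : Type _ := S.Y ⧸ LinearMap.ker (S.blockC g)

/-- The vector of `Y` with the given first `i` coordinates, the others being zero. -/
noncomputable def partialY (i : ℕ) (z : {j : Fin n // (j : ℕ) < i} → F) : S.Y :=
  ∑ j, z j • S.basisY (j : Fin n)

end Algebra

section Weil

variable {F : Type*} [Field F] [ValuativeRel F] [TopologicalSpace F] [IsNonarchimedeanLocalField F]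
  {V : Type*} [AddCommGroup V] [Module F V] {n : ℕ} (S : PolarizedSpace F V n)

/-- The Bruhat-Schwartz space `𝒮(X, L)`, for the canonical topology of the finite-dimensional
`F`-space `X`. -/
abbrev schwartzX (L : Type*) [Field L] : Submodule L (S.X → L) :=
  @schwartz S.X (moduleTopology F S.X) L _

/-- The Borel sets of `Y_g` for its canonical topology. -/
noncomputable instance quotYMeasurableSpace (g : V →ₗ[F] V) : MeasurableSpace (S.quotY g) :=
  @borel (S.quotY g) (moduleTopology F (S.quotY g))

variable [MeasurableSpace F]

/-- The Haar measure `μ_{lam, g}` on `Y_g`. Write `g = p₁ τ_i p₂` with `p₁, p₂ ∈ P` and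
`i = dim Y_g` (always possible for `g ∈ Sp(V)`, and the choice does not matter). Then `μ_{lam, g}`
is `|det (p₁ p₂ | Y)| ^ (-1/2)` times the pullback along `p̄₁ : Y_g ≅ Y_{τ_i} = F y_1 + ⋯ + F y_i`
of the product of the self-dual measures, i.e. times its image under the inverse of `p̄₁`,
which takes `y` to the class of `y p₁⁻¹`. -/
noncomputable def weilMeasure (lam : AddChar F Circle) (g : V →ₗ[F] V) : Measure (S.quotY g) :=
  open Classical in
  if h : ∃ q : (V ≃ₗ[F] V) × (V ≃ₗ[F] V), S.IsParabolic q.1 ∧ S.IsParabolic q.2 ∧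
      g = (q.2 : V →ₗ[F] V) ∘ₗ S.tau (Module.finrank F (S.quotY g)) ∘ₗ (q.1 : V →ₗ[F] V) then
    ENNReal.ofReal (normAbs (LinearMap.det
        (S.blockD ((h.choose.1 ≪≫ₗ h.choose.2 : V ≃ₗ[F] V) : V →ₗ[F] V))) ^ (-(1 / 2) : ℝ)) •
      Measure.map
        (fun z => Submodule.Quotient.mk (S.prY (h.choose.1.symm (S.partialY _ z : V))))
        (Measure.pi (fun _ : {j : Fin n // (j : ℕ) < Module.finrank F (S.quotY g)} =>
          selfDualMeasure lam))
  else 0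

/-- The integrand
`lam ((⟨xa, xb⟩ - 2 ⟨xb, yc⟩ + ⟨yc, yd⟩) / 2) φ(xa + yc)` of the Weil operator of `g`. -/
noncomputable def weilIntegrand (lam : AddChar F Circle) (g : V →ₗ[F] V) (φ : S.X → ℂ)
    (x : S.X) (y : S.Y) : ℂ :=
  (lam ((S.form (S.blockA g x : V) (S.blockB g x : V)
      - 2 * S.form (S.blockB g x : V) (S.blockC g y : V)
      + S.form (S.blockC g y : V) (S.blockD g y : V)) / 2) : ℂ)
    * φ (S.blockA g x + S.blockC g y)

/-- The integral over `Y_g` that defines the Weil operator. For `g ∈ Sp(V)` the integrand is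
constant on the cosets of `ker c`, so the representative of the coset does not matter. -/
noncomputable def weilIntegral (lam : AddChar F Circle) (g : V →ₗ[F] V) (φ : S.X → ℂ)
    (x : S.X) : ℂ :=
  ∫ y : S.quotY g, S.weilIntegrand lam g φ x (Quotient.out y) ∂(S.weilMeasure lam g)

/-- The Weil operator `W_lam(g)` on `𝒮(X, E)`: the restriction to `𝒮(X, E)` of the integral
operator (which leaves `𝒮(X, E)` invariant for `g ∈ Sp(V)`). -/
noncomputable def weil (lam : AddChar F Circle) (g : V →ₗ[F] V) :
    Module.End (charField lam) (S.schwartzX (charField lam)) :=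
  open Classical in
  if h : ∃ T : Module.End (charField lam) (S.schwartzX (charField lam)),
      ∀ (φ : S.schwartzX (charField lam)) (x : S.X),
        (((T φ).1 x : charField lam) : ℂ) =
          S.weilIntegral lam g (fun x' => ((φ.1 x' : charField lam) : ℂ)) x
  then h.choose else 0

end Weil

/-! ### The Galois action and the cocycle -/

section Cocycle

variable {F : Type*} [Field F] [ValuativeRel F] [TopologicalSpace F] [IsNonarchimedeanLocalField F]
  {V : Type*} [AddCommGroup V] [Module F V] {n : ℕ} (S : PolarizedSpace F V n)

/-- The action `(σ φ)(x) = σ (φ x)` of `Gal(E / ℚ)` on `𝒮(X, E)`. -/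
def galAct {E : Type*} [Field E] [Algebra ℚ E] (σ : E ≃ₐ[ℚ] E) (φ : S.schwartzX E) :
    S.schwartzX E :=
  ⟨fun x => σ (φ.1 x),
    @IsLocallyConstant.comp _ _ _ (moduleTopology F S.X) _ φ.2.1 σ,
    @HasCompactSupport.comp_left _ _ _ (moduleTopology F S.X) _ _ _ _ φ.2.2 (map_zero σ)⟩

/-- The action `(^σ T)(φ) = σ (T (σ⁻¹ φ))` of `Gal(E / ℚ)` on `End 𝒮(X, E)`. -/
def galConj {E : Type*} [Field E] [Algebra ℚ E] (σ : E ≃ₐ[ℚ] E)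
    (T : Module.End E (S.schwartzX E)) : Module.End E (S.schwartzX E) where
  toFun φ := S.galAct σ (T (S.galAct σ⁻¹ φ))
  map_add' φ ψ := by
    have h : S.galAct σ⁻¹ (φ + ψ) = S.galAct σ⁻¹ φ + S.galAct σ⁻¹ ψ := by
      ext x; simp [galAct]
    rw [h, map_add]
    ext x; simp [galAct]
  map_smul' c φ := by
    have h : S.galAct σ⁻¹ (c • φ) = (σ⁻¹ c) • S.galAct σ⁻¹ φ := by
      ext x; simp [galAct]
    rw [h, map_smul]
    ext x
    have h2 : σ (σ⁻¹ c) = c := σ.apply_symm_apply c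
    change σ (σ⁻¹ c * _) = c * σ _
    rw [map_mul, h2]

/-- For an involution `w`, the operator `ρ_e + c ρ_o` formed with the idempotents
`ρ_e = (I + w) / 2` and `ρ_o = (I - w) / 2`. -/
def evenOdd {E M : Type*} [Field E] [AddCommGroup M] [Module E M] (w : Module.End E M) (c : E) :
    Module.End E M :=
  (1 / 2 : E) • (1 + w) + c • ((1 / 2 : E) • (1 - w))

variable [MeasurableSpace F]

/-- The operator `ρ_e + (∏_{l=0}^{i-1} η^l(u)) ρ_o`, where `ρ_e` and `ρ_o` are the
idempotents `(I ± W_lam(ι)) / 2` and `ι = g_{-1}` is the central involution of `Sp(V)`. -/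
noncomputable def correction {lam : AddChar F Circle} (η : charField lam ≃ₐ[ℚ] charField lam)
    (u : charField lam) (i : ℕ) : Module.End (charField lam) (S.schwartzX (charField lam)) :=
  evenOdd (S.weil lam (S.gMap (-1))) (∏ l ∈ Finset.range i, (η ^ l) u)

/-- The map `δ(σ) = A(σ) D(σ)`: if `σ` restricts to `σ_{ε^{2i} s²}` on `ℚ(lam)` with
`1 ≤ i ≤ (p - 1) / 2` and `s ∈ U₁` (for `σ ∈ ℌ` there is exactly one such pair), then
`A(σ) = ρ_e + (∏_{l=0}^{i-1} η^l(u)) ρ_o` and `D(σ) = W_lam(g_{ε^i s})`. -/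
noncomputable def delta (p : ℕ) {lam : AddChar F Circle} (ε : F)
    (η : charField lam ≃ₐ[ℚ] charField lam) (u : charField lam)
    (σ : charField lam ≃ₐ[ℚ] charField lam) :
    Module.End (charField lam) (S.schwartzX (charField lam)) :=
  open Classical in
  if h : ∃ k : ℕ × F, 1 ≤ k.1 ∧ k.1 ≤ (p - 1) / 2 ∧ k.2 ∈ principalUnits F p ∧
      RestrictsTo p lam σ (ε ^ (2 * k.1) * k.2 ^ 2) then
    S.correction η u h.choose.1 * S.weil lam (S.gMap (ε ^ h.choose.1 * h.choose.2))
  else 1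

end Cocycle

end PolarizedSpace

/-! On a diagonal element `g_t` with `|t| = 1` the space `Y_g` is a point and the measure has mass
one, so the Weil operator is the dilation `φ ↦ φ(t⁻¹ ·)` (`weil_gMap`). Hence `δ(σ)` is explicit:
the dilation by `ε^i s` followed by multiplication of the odd functions by `∏_{l<i} η^l(u)`
(`cocycleOperator`).

Conjugation. If `σ` sends `λ` to `λ(t² ·)`, then applying `σ` inside the integral for `W(g)`
multiplies the phase by `t²`. The phase is a quadratic form in `(x, y)`, so this factor is removed
by the substitution `(x, y) ↦ (tx, ty)`, that is, by conjugation with a dilation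
(`dil_mul_galConj_weil`). This is legitimate because the integrals are finite sums, and the volumes
and the factors `|det|^{-1/2}` that occur lie in `ℚ(√p, √-p)`, which `σ` fixes. The case `σ = 1`, `t
= -1` shows that every `W(g)` preserves parity, so the correction on odd functions does no harm.

Cocycle. The dilations are fixed by the Galois action, and the parameters `(i, s)` multiply, but `i`
matters only modulo `N = (p-1)/2`, while `ε^N = -1`. Without correction, passing from `i` to `i + N`
would change the operator by the sign `-1` on odd functions. The correction contributes the product
of `η^l(u)` over a full period, which is the norm of `u`, that is `-1` (`prod_conjugates_eq_norm`),
and the two signs cancel (`cocycleOperator_add`).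

Triviality. This is Hilbert 90 in infinite dimension. The twisted action `φ ↦ δ(σ)(σφ)` is
semilinear, and each vector is fixed by all `σ` that fix some finite subset of `E`. For such an
action, independence of characters shows that the fixed vectors span
(`IsSmoothSemilinear.span_fixed`). Matching a basis of fixed vectors of the twisted action with one
of the plain action gives `α`.

Existence of self-dual measures, of the factorization of `g` and of the operator `W(g)` for general
`g` is not needed: the default values in the definitions are zero and satisfy the same identities.
-/

namespace WeilDescent

open Filter Topology

/-! ### Topology of the local field -/

section Integers

variable {F : Type*} [Field F] [ValuativeRel F]

variable (F) in
/-- The ring of integers as an additive subgroup. -/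
noncomputable def integerAddSubgroup : AddSubgroup F := (𝒪[F] : Subring F).toAddSubgroup

@[simp] theorem mem_integerAddSubgroup {x : F} :
    x ∈ integerAddSubgroup F ↔ valuation F x ≤ 1 := Iff.rfl

end Integers

section LocalField

variable {F : Type*} [Field F] [ValuativeRel F] [TopologicalSpace F] [IsNonarchimedeanLocalField F]

variable (F) in
theorem t2Space_of_localField : T2Space F := by
  refine IsTopologicalAddGroup.t2Space_of_zero_sep fun x hx => ?_
  refine ⟨{y | valuation F y < valuation F x}, ?_, by simp⟩
  exact (IsValuativeTopology.hasBasis_nhds_zero' F).mem_of_mem (by simpa using hx)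

variable (F) in
-- A rank-one norm makes `F` a proper space. Second countability identifies the Borel sets of a
-- power of `F` with the product σ-algebra that carries `Measure.pi`.
theorem secondCountable_of_localField : SecondCountableTopology F := by
  let := IsTopologicalAddGroup.rightUniformSpace F
  have := isUniformAddGroup_of_addCommGroup (G := F)
  let : (Valued.v (R := F)).RankOne :=
  { hom' := IsRankLeOne.nonempty.some.emb (R := F).comp MonoidWithZeroHom.ValueGroup₀.embedding
    strictMono' := IsRankLeOne.nonempty.some.strictMono.comp
        MonoidWithZeroHom.ValueGroup₀.embedding_strictMono }
  open scoped Valued in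
  have h : ProperSpace F := .of_nontriviallyNormedField_of_weaklyLocallyCompactSpace F
  open scoped Valued in
  exact @secondCountable_of_proper F _ h

variable (F) in
theorem isCompact_integer : IsCompact (integerAddSubgroup F : Set F) :=
  IsNonarchimedeanLocalField.isCompact_closedBall F 1

variable (F) in
theorem isOpen_integer : IsOpen (integerAddSubgroup F : Set F) := by
  refine AddSubgroup.isOpen_of_mem_nhds _ (g := 0) ?_
  refine mem_of_superset ((IsValuativeTopology.hasBasis_nhds_zero' F).mem_of_mem
    (i := 1) one_ne_zero) fun x hx => ?_
  exact le_of_lt (show valuation F x < 1 from hx)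

/-- Every neighbourhood of zero contains an open additive subgroup stable under the integers. -/
theorem exists_openAddSubgroup {U : Set F} (hU : U ∈ 𝓝 (0 : F)) :
    ∃ K : AddSubgroup F, IsOpen (K : Set F) ∧ (K : Set F) ⊆ U ∧
      ∀ x ∈ K, ∀ a : F, valuation F a ≤ 1 → a * x ∈ K := by
  obtain ⟨γ, hγ, h⟩ := (IsValuativeTopology.hasBasis_nhds_zero' F).mem_iff.mp hU
  let K : AddSubgroup F :=
    { carrier := {x | valuation F x < γ}
      add_mem' := fun {a b} ha hb => (valuation F).map_add_lt ha hb
      zero_mem' := by simpa [zero_lt_iff] using hγ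
      neg_mem' := fun {a} ha => by simpa using ha }
  refine ⟨K, AddSubgroup.isOpen_of_mem_nhds _ (g := 0) ?_, h, fun x hx a ha => ?_⟩
  · exact (IsValuativeTopology.hasBasis_nhds_zero' F).mem_of_mem hγ
  · change valuation F (a * x) < γ
    rw [map_mul]
    exact lt_of_le_of_lt (mul_le_of_le_one_left' ha) hx

variable (F) in
theorem prime_residueChar (p : ℕ) [CharP 𝓀[F] p] : p.Prime := CharP.char_is_prime 𝓀[F] p

variable (p : ℕ) [CharP 𝓀[F] p]

variable (F) in
theorem valuation_residueChar_lt_one : valuation F (p : F) < 1 := by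
  have h : IsLocalRing.residue 𝒪[F] (p : 𝒪[F]) = 0 := by
    rw [map_natCast]; exact CharP.cast_eq_zero _ _
  rw [IsLocalRing.residue_eq_zero_iff] at h
  have := (Valuation.mem_maximalIdeal_iff (v := valuation F)).mp h
  simpa using this

/-- As `|p| < 1`, powers of `p` contract the integers uniformly to zero. This covers both
characteristics; `p = 0` in `F` is allowed. -/
theorem exists_pow_mul_mem {U : Set F} (hU : U ∈ 𝓝 (0 : F)) :
    ∃ N : ℕ, ∀ n ≥ N, ∀ x : F, valuation F x ≤ 1 → (p : F) ^ n * x ∈ U := by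
  obtain ⟨γ, hγ, h⟩ := (IsValuativeTopology.hasBasis_nhds_zero' F).mem_iff.mp hU
  obtain ⟨N, hN⟩ := exists_pow_lt₀ (valuation_residueChar_lt_one F p) (Units.mk0 γ hγ)
  refine ⟨N, fun n hn x hx => h ?_⟩
  change valuation F _ < γ
  rw [map_mul, map_pow]
  calc _ ≤ valuation F (p : F) ^ n := mul_le_of_le_one_right' hx
    _ ≤ valuation F (p : F) ^ N :=
      pow_le_pow_right_of_le_one' (valuation_residueChar_lt_one F p).le hn
    _ < γ := hN

end LocalField
end WeilDescent

/-! ### The closure of the prime ring and its principal units -/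

namespace WeilDescent

open Filter Topology

section PrimeRing

variable {F : Type*} [Field F] [ValuativeRel F] [TopologicalSpace F] [IsNonarchimedeanLocalField F]

variable (F) in
/-- The closure of the prime ring as a subring. -/
def primeSubring : Subring F := (Int.castRingHom F).range.topologicalClosure

theorem mem_primeSubring {x : F} : x ∈ primeSubring F ↔ x ∈ primeClosure F := Iff.rfl

variable (F) in
theorem isClosed_primeSubring : IsClosed (primeSubring F : Set F) := isClosed_closure

theorem valuation_le_one_of_mem {x : F} (hx : x ∈ primeSubring F) : valuation F x ≤ 1 := by
  have := t2Space_of_localField F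
  have h : closure (Set.range ((↑) : ℤ → F)) ⊆ (integerAddSubgroup F : Set F) := by
    refine closure_minimal ?_ (isCompact_integer F).isClosed
    rintro _ ⟨k, rfl⟩
    exact intCast_mem (𝒪[F] : Subring F) k
  exact h hx

variable (F) in
theorem isCompact_primeSubring : IsCompact (primeSubring F : Set F) :=
  (isCompact_integer F).of_isClosed_subset (isClosed_primeSubring F)
    fun _ hx => valuation_le_one_of_mem hx

/-- The elements of `𝒫` congruent to `1` modulo `p ^ k`. -/
def higherUnits (F : Type*) [Field F] [ValuativeRel F] [TopologicalSpace F]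
    [IsNonarchimedeanLocalField F] (p k : ℕ) : Set F :=
  {s | ∃ z ∈ primeSubring F, s = 1 + (p : F) ^ k * z}

variable {p : ℕ}

theorem mem_principalUnits_iff {s : F} : s ∈ principalUnits F p ↔ s ∈ higherUnits F p 1 := by
  constructor
  · rintro ⟨_, z, hz, h⟩
    exact ⟨z, hz, by rw [pow_one, ← h]; ring⟩
  · rintro ⟨z, hz, rfl⟩
    refine ⟨?_, z, hz, by ring⟩
    exact add_mem (one_mem (primeSubring F)) (mul_mem (pow_mem (natCast_mem _ _) _) hz)

theorem higherUnits_subset {k : ℕ} {s : F} (hs : s ∈ higherUnits F p k) :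
    s ∈ primeSubring F := by
  obtain ⟨z, hz, rfl⟩ := hs
  exact add_mem (one_mem (primeSubring F)) (mul_mem (pow_mem (natCast_mem _ _) _) hz)

variable (F p) in
theorem isCompact_higherUnits (k : ℕ) : IsCompact (higherUnits F p k) := by
  have : higherUnits F p k = (fun z => 1 + (p : F) ^ k * z) '' (primeSubring F : Set F) := by
    ext s; constructor
    · rintro ⟨z, hz, rfl⟩; exact ⟨z, hz, rfl⟩
    · rintro ⟨z, hz, rfl⟩; exact ⟨z, hz, rfl⟩
  rw [this]
  exact (isCompact_primeSubring F).image (by fun_prop)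

theorem one_mem_higherUnits (k : ℕ) : (1 : F) ∈ higherUnits F p k :=
  ⟨0, zero_mem _, by simp⟩

theorem mul_mem_higherUnits {k : ℕ} {s t : F} (hs : s ∈ higherUnits F p k)
    (ht : t ∈ higherUnits F p k) : s * t ∈ higherUnits F p k := by
  obtain ⟨z, hz, rfl⟩ := hs
  obtain ⟨w, hw, rfl⟩ := ht
  refine ⟨z + w + p ^ k * z * w, ?_, by ring⟩
  exact add_mem (add_mem hz hw) (mul_mem (mul_mem (pow_mem (natCast_mem _ _) _) hz) hw)

theorem pow_mem_higherUnits {k : ℕ} {s : F} (hs : s ∈ higherUnits F p k) (n : ℕ) :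
    s ^ n ∈ higherUnits F p k := by
  induction n with
  | zero => simpa using one_mem_higherUnits k
  | succ n ih => rw [pow_succ]; exact mul_mem_higherUnits ih hs

variable [CharP 𝓀[F] p]

variable (p) in
-- The finitely many sets `r + p^n 𝒫` with `0 ≤ r < p^n` are compact, so their union is closed; by
-- division with remainder it contains every integer, hence the closure of the integers.
theorem exists_int_approx (n : ℕ) {s : F} (hs : s ∈ primeSubring F) :
    ∃ r : ℤ, ∃ z ∈ primeSubring F, s = r + (p : F) ^ n * z := by
  have := t2Space_of_localField F
  have hp := prime_residueChar F p
  let C : Set F := ⋃ r ∈ Set.Ico (0 : ℤ) (p ^ n),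
    (fun z => (r : F) + (p : F) ^ n * z) '' (primeSubring F : Set F)
  have hC : IsClosed C := by
    refine Set.Finite.isClosed_biUnion (Set.finite_Ico _ _) fun r _ => ?_
    exact ((isCompact_primeSubring F).image (by fun_prop)).isClosed
  have h : primeClosure F ⊆ C := by
    refine closure_minimal ?_ hC
    rintro _ ⟨k, rfl⟩
    have hpn : (0 : ℤ) < p ^ n := by have := hp.pos; positivity
    refine Set.mem_biUnion (x := k % (p ^ n : ℤ))
      ⟨Int.emod_nonneg _ hpn.ne', Int.emod_lt_of_pos _ hpn⟩ ⟨(k / (p ^ n : ℤ) : ℤ), ?_, ?_⟩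
    · exact intCast_mem _ _
    · have := Int.emod_add_mul_ediv k (p ^ n : ℤ)
      conv_rhs => rw [← this]
      push_cast
      ring
  have := h hs
  simp only [C, Set.mem_iUnion] at this
  obtain ⟨r, _, z, hz, h⟩ := this
  exact ⟨r, z, hz, h.symm⟩

/-- With `y = p^k z`, the binomial expansion is `(1 + y)^p = 1 + p y + y² r`, and `2k ≥ k + 1`
because `k ≥ 1`; the factor `p^(k-1)` in the witness is what remains of `p^(2k)`. -/
theorem pow_char_mem_higherUnits {k : ℕ} (hk : 1 ≤ k) {s : F} (hs : s ∈ higherUnits F p k) :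
    s ^ p ∈ higherUnits F p (k + 1) := by
  obtain ⟨z, hz, rfl⟩ := hs
  have hp := prime_residueChar F p
  obtain ⟨r, hr, h⟩ : ∃ r ∈ primeSubring F,
      ((p : F) ^ k * z + 1) ^ p = ((p : F) ^ k * z) ^ 2 * r + (p : F) ^ k * z * p + 1 := by
    have h2 := (Polynomial.powAddExpansion (1 : primeSubring F)
      (((p : primeSubring F) ^ k * ⟨z, hz⟩)) p)
    obtain ⟨r, hr⟩ := h2
    refine ⟨r, r.2, ?_⟩
    have := congrArg (Subtype.val) hr
    push_cast at this
    simp only [one_pow, mul_one] at this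
    rw [add_comm, this]
    ring
  refine ⟨(p : F) ^ (k - 1) * z ^ 2 * r + z, ?_, ?_⟩
  · exact add_mem (mul_mem (mul_mem (pow_mem (natCast_mem _ _) _) (pow_mem hz _)) hr) hz
  · rw [add_comm, h]
    obtain ⟨j, rfl⟩ := Nat.exists_eq_add_of_le hk
    simp only [Nat.add_sub_cancel_left]
    ring

theorem pow_char_pow_mem_higherUnits {s : F} (hs : s ∈ higherUnits F p 1) (n : ℕ) :
    s ^ p ^ n ∈ higherUnits F p (n + 1) := by
  induction n with
  | zero => simpa using hs
  | succ n ih => rw [pow_succ, pow_mul]; exact pow_char_mem_higherUnits (by omega) ih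

variable (p) in
theorem exists_higherUnits_subset {U : Set F} (hU : U ∈ 𝓝 (1 : F)) :
    ∃ N : ℕ, ∀ n ≥ N, higherUnits F p n ⊆ U := by
  have h0 : (fun x => 1 + x) ⁻¹' U ∈ 𝓝 (0 : F) := by
    refine (continuous_const.add continuous_id).continuousAt.preimage_mem_nhds ?_
    simpa using hU
  obtain ⟨N, hN⟩ := exists_pow_mul_mem p h0
  refine ⟨N, fun n hn s => ?_⟩
  rintro ⟨z, hz, rfl⟩
  exact hN n hn z (valuation_le_one_of_mem hz)

theorem tendsto_pow_char_pow {s : F} (hs : s ∈ higherUnits F p 1) :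
    Tendsto (fun n => s ^ p ^ n) atTop (𝓝 1) := by
  intro U hU
  obtain ⟨N, hN⟩ := exists_higherUnits_subset p hU
  rw [mem_map]
  filter_upwards [eventually_ge_atTop N] with n hn
  exact hN (n + 1) (by omega) (pow_char_pow_mem_higherUnits hs n)

theorem valuation_eq_one_of_mem_higherUnits {s : F} (hs : s ∈ higherUnits F p 1) :
    valuation F s = 1 := by
  obtain ⟨z, hz, rfl⟩ := hs
  rw [Valuation.map_add_eq_of_lt_left, map_one]
  rw [pow_one, map_mul, map_one]
  calc _ ≤ valuation F (p : F) := mul_le_of_le_one_right' (valuation_le_one_of_mem hz)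
    _ < 1 := valuation_residueChar_lt_one F p

theorem ne_zero_of_mem_higherUnits {s : F} (hs : s ∈ higherUnits F p 1) : s ≠ 0 := by
  rintro rfl
  simpa using valuation_eq_one_of_mem_higherUnits hs

/-- The powers `s^(p^n - 1)` tend to `s⁻¹`, since `s^(p^n)` tends to `1`, and `U₁` is compact. -/
theorem inv_mem_higherUnits {s : F} (hs : s ∈ higherUnits F p 1) : s⁻¹ ∈ higherUnits F p 1 := by
  have := t2Space_of_localField F
  have hp := prime_residueChar F p
  have h0 := ne_zero_of_mem_higherUnits hs
  have h : Tendsto (fun n => s ^ (p ^ n - 1)) atTop (𝓝 s⁻¹) := by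
    have := (tendsto_pow_char_pow hs).mul_const s⁻¹
    rw [one_mul] at this
    refine this.congr fun n => ?_
    rw [pow_sub₀ _ h0 (Nat.one_le_pow _ _ hp.pos), pow_one]
  exact (isCompact_higherUnits F p 1).isClosed.mem_of_tendsto h
    (Eventually.of_forall fun n => pow_mem_higherUnits hs _)

/-- By compactness the powers `s^((p^n + 1)/2)` have a cluster point; its square is a cluster point
of `s^(p^n) s`, which converges to `s`. Oddness of `p` makes the exponents exact. -/
theorem exists_sq_eq_of_mem_higherUnits (hp2 : p ≠ 2) {s : F} (hs : s ∈ higherUnits F p 1) :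
    ∃ t ∈ higherUnits F p 1, t ^ 2 = s := by
  have := t2Space_of_localField F
  have hp := prime_residueChar F p
  obtain ⟨t, ht, hcl⟩ := (isCompact_higherUnits F p 1).exists_mapClusterPt
    (f := atTop) (u := fun n : ℕ => s ^ ((p ^ n + 1) / 2))
    (by rw [le_principal_iff, mem_map]; exact Eventually.of_forall fun n => pow_mem_higherUnits hs _)
  refine ⟨t, ht, ?_⟩
  have h1 : MapClusterPt (t ^ 2) atTop (fun n : ℕ => s ^ p ^ n * s) := by
    have := hcl.continuousAt_comp (f := fun x : F => x ^ 2) (by fun_prop)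
    refine (EventuallyEq.mapClusterPt_iff (Eventually.of_forall fun n => ?_)).mp this
    have hodd : (p ^ n + 1) / 2 * 2 = p ^ n + 1 := by
      have : Odd (p ^ n) := (hp.odd_of_ne_two hp2).pow
      exact Nat.div_mul_cancel (even_iff_two_dvd.mp this.add_one)
    simp only [Function.comp]
    rw [← pow_mul, hodd, pow_succ]
  have h2 : Tendsto (fun n : ℕ => s ^ p ^ n * s) atTop (𝓝 s) := by
    simpa using (tendsto_pow_char_pow hs).mul_const s
  exact eq_of_nhds_neBot (h1.clusterPt.neBot.mono (inf_le_inf_left _ h2))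

/-- Here `s^p = s`, so the sequence `s^(p^n)`, which tends to `1`, is constant. This separates roots
of unity of order dividing `p - 1` from principal units. -/
theorem eq_one_of_pow_eq_one {s : F} (hs : s ∈ higherUnits F p 1) (h : s ^ (p - 1) = 1) :
    s = 1 := by
  have := t2Space_of_localField F
  have hp := prime_residueChar F p
  have h1 : ∀ n, s ^ p ^ n = s := by
    intro n
    induction n with
    | zero => simp
    | succ n ih =>
      rw [pow_succ, pow_mul, ih]
      calc s ^ p = s ^ (p - 1 + 1) := by rw [Nat.sub_add_cancel hp.one_le]
        _ = s := by rw [pow_succ, h, one_mul]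
  have := tendsto_pow_char_pow hs
  simp only [h1] at this
  exact tendsto_nhds_unique tendsto_const_nhds this

end PrimeRing
end WeilDescent

/-! ### Values of the character and the Galois action on them -/

namespace WeilDescent

open Filter Topology

/-- No small subgroups: as long as the powers stay within `1/2` of `1`, each squaring expands the
distance to `1` by at least `3/2`, since `w² - 1 = (w - 1)(w + 1)`. -/
theorem Circle.eq_one_of_forall_norm_pow_sub_one_le {z : ℂ}
    (h : ∀ n : ℕ, ‖z ^ n - 1‖ ≤ 1 / 2) : z = 1 := by
  by_contra hz
  have hpos : 0 < ‖z - 1‖ := norm_pos_iff.mpr (sub_ne_zero.mpr hz)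
  have key : ∀ n : ℕ, (3 / 2 : ℝ) ^ n * ‖z - 1‖ ≤ ‖z ^ (2 ^ n) - 1‖ := by
    intro n
    induction n with
    | zero => simp
    | succ n ih =>
      have h1 : z ^ (2 ^ (n + 1)) - 1 = (z ^ (2 ^ n) - 1) * (2 + (z ^ (2 ^ n) - 1)) := by
        rw [pow_succ, pow_mul]; ring
      have h2 : (3 / 2 : ℝ) ≤ ‖2 + (z ^ (2 ^ n) - 1)‖ := by
        have := norm_sub_norm_le (2 : ℂ) (-(z ^ (2 ^ n) - 1))
        rw [sub_neg_eq_add, norm_neg, Complex.norm_ofNat] at this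
        linarith [h (2 ^ n)]
      rw [h1, norm_mul, pow_succ]
      calc (3 / 2 : ℝ) ^ n * (3 / 2) * ‖z - 1‖ = ((3 / 2 : ℝ) ^ n * ‖z - 1‖) * (3 / 2) := by ring
        _ ≤ _ := mul_le_mul ih h2 (by norm_num) (norm_nonneg _)
  obtain ⟨n, hn⟩ := pow_unbounded_of_one_lt (1 / ‖z - 1‖) (by norm_num : (1 : ℝ) < 3 / 2)
  rw [div_lt_iff₀ hpos] at hn
  linarith [key n, h (2 ^ n)]

section CharacterValues

variable {F : Type*} [Field F] {lam : AddChar F Circle}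

/-- A value of `lam`, as an element of `E`. -/
noncomputable def lamE (lam : AddChar F Circle) (t : F) : charField lam :=
  ⟨(lam t : ℂ), IntermediateField.subset_adjoin _ _ (Or.inl ⟨t, rfl⟩)⟩

@[simp] theorem coe_lamE (t : F) : (lamE lam t : ℂ) = lam t := rfl

theorem lamE_add (s t : F) : lamE lam (s + t) = lamE lam s * lamE lam t := by
  ext; simp [AddChar.map_add_eq_mul]

theorem lamE_intCast_mul (r : ℤ) (t : F) : lamE lam (r * t) = lamE lam t ^ r := by
  apply Subtype.ext
  change (lam (r * t) : ℂ) = algebraMap (charField lam) ℂ (lamE lam t ^ r)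
  rw [map_zpow₀, ← zsmul_eq_mul, AddChar.map_zsmul_eq_zpow, Circle.coe_zpow]
  rfl

theorem lamE_inj {s t : F} : lamE lam s = lamE lam t ↔ lam s = lam t := by
  rw [← Circle.coe_inj]; exact Subtype.ext_iff

/-- `σ` acts on the values of `lam` through multiplication of the argument by `s`. -/
def Acts (lam : AddChar F Circle) (σ : charField lam ≃ₐ[ℚ] charField lam) (s : F) : Prop :=
  ∀ t : F, σ (lamE lam t) = lamE lam (s * t)

theorem Acts.mul {σ τ : charField lam ≃ₐ[ℚ] charField lam} {s t : F} (hσ : Acts lam σ s)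
    (hτ : Acts lam τ t) : Acts lam (σ * τ) (s * t) := by
  intro x
  change σ (τ _) = _
  rw [hτ, hσ, mul_assoc]

theorem acts_one : Acts lam 1 1 := fun t => by simp

theorem Acts.pow {σ : charField lam ≃ₐ[ℚ] charField lam} {s : F} (hσ : Acts lam σ s) (n : ℕ) :
    Acts lam (σ ^ n) (s ^ n) := by
  induction n with
  | zero => simpa using acts_one
  | succ n ih => rw [pow_succ, pow_succ]; exact ih.mul hσ

theorem exists_lam_ne_one (hlam' : lam ≠ 1) : ∃ t, lam t ≠ 1 := by
  by_contra! h
  exact hlam' (by ext t; simp [h t])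

/-- If `s ≠ t`, then `(s - t) x` runs through all of `F`, so `λ` would be trivial. This is what
makes the parameter of an automorphism unique. -/
theorem eq_of_forall_lam_eq (hlam' : lam ≠ 1) {s t : F} (h : ∀ x, lam (s * x) = lam (t * x)) :
    s = t := by
  by_contra hne
  obtain ⟨c, hc⟩ := exists_lam_ne_one hlam'
  have h0 : s - t ≠ 0 := sub_ne_zero.mpr hne
  apply hc
  have h1 : lam ((s - t) * ((s - t)⁻¹ * c)) = 1 := by
    rw [sub_mul, AddChar.map_sub_eq_div, h, div_self']
  rwa [mul_inv_cancel_left₀ h0] at h1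

theorem Acts.unique (hlam' : lam ≠ 1) {σ : charField lam ≃ₐ[ℚ] charField lam} {s t : F}
    (hs : Acts lam σ s) (ht : Acts lam σ t) : s = t :=
  eq_of_forall_lam_eq hlam' fun x => lamE_inj.mp ((hs x).symm.trans (ht x))

end CharacterValues

section Character

variable {F : Type*} [Field F] [ValuativeRel F] [TopologicalSpace F] [IsNonarchimedeanLocalField F]
  {lam : AddChar F Circle}

theorem exists_openAddSubgroup_trivial (hlam : Continuous lam) :
    ∃ K : AddSubgroup F, IsOpen (K : Set F) ∧ (∀ x ∈ K, lam x = 1) ∧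
      ∀ x ∈ K, ∀ a : F, valuation F a ≤ 1 → a * x ∈ K := by
  have hU : {x : F | ‖(lam x : ℂ) - 1‖ < 1 / 2} ∈ 𝓝 (0 : F) := by
    refine IsOpen.mem_nhds (isOpen_lt (by fun_prop) continuous_const) ?_
    simp
  obtain ⟨K, hK, hKU, hKO⟩ := exists_openAddSubgroup hU
  refine ⟨K, hK, fun x hx => ?_, hKO⟩
  rw [← Circle.coe_inj, Circle.coe_one]
  refine Circle.eq_one_of_forall_norm_pow_sub_one_le fun n => ?_
  have := hKU (K.nsmul_mem hx n)
  simp only [Set.mem_ofPred_eq, AddChar.map_nsmul_eq_pow, Circle.coe_pow] at this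
  exact this.le

theorem lam_mul_eq_one_of_mem (hlam : Continuous lam) {t : F} (ht : lam t = 1) {z : F}
    (hz : z ∈ primeSubring F) : lam (z * t) = 1 := by
  have h : primeClosure F ⊆ {z : F | lam (z * t) = 1} := by
    refine closure_minimal ?_ (isClosed_eq (by fun_prop) continuous_const)
    rintro _ ⟨k, rfl⟩
    change lam _ = 1
    rw [← zsmul_eq_mul, AddChar.map_zsmul_eq_zpow, ht, one_zpow]
  exact h hz

theorem exists_pow_eq_one (p : ℕ) [CharP 𝓀[F] p] (hlam : Continuous lam) (t : F) :
    ∃ n : ℕ, lam t ^ p ^ n = 1 := by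
  obtain ⟨K, hK, h1, -⟩ := exists_openAddSubgroup_trivial hlam
  have hU : (fun x => x * t) ⁻¹' (K : Set F) ∈ 𝓝 (0 : F) :=
    (hK.preimage (continuous_mul_const t)).mem_nhds (by simp)
  obtain ⟨N, hN⟩ := exists_pow_mul_mem p hU
  refine ⟨N, ?_⟩
  have := h1 _ (hN N le_rfl 1 (by simp))
  rw [mul_one, ← Nat.cast_pow] at this
  rwa [← AddChar.map_nsmul_eq_pow, nsmul_eq_mul]

/-- If `s = r + p^n z` and `λ(t)` has order dividing `p^n`, then `λ` is trivial on `z p^n t`, so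
`λ(st) = λ(t)^r`. The exponent condition thus becomes multiplication of the argument, which composes
well. -/
theorem acts_iff_restrictsTo (p : ℕ) [CharP 𝓀[F] p] (hlam : Continuous lam)
    {σ : charField lam ≃ₐ[ℚ] charField lam} {s : F} (hs : s ∈ primeSubring F) :
    Acts lam σ s ↔ RestrictsTo p lam σ s := by
  have key : ∀ (t z : F) (n : ℕ) (r : ℤ), lamE lam t ^ p ^ n = 1 → z ∈ primeSubring F →
      s = r + (p : F) ^ n * z → lamE lam (s * t) = lamE lam t ^ r := by
    intro t z n r h1 hz h
    have h2 : lam (z * ((p ^ n : ℕ) * t)) = 1 := by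
      refine lam_mul_eq_one_of_mem hlam ?_ hz
      rw [← nsmul_eq_mul, AddChar.map_nsmul_eq_pow, ← Circle.coe_inj]
      simpa using congrArg (Subtype.val) h1
    have h3 : s * t = r * t + z * ((p ^ n : ℕ) * t) := by rw [h]; push_cast; ring
    rw [h3, lamE_add, lamE_intCast_mul]
    have : lamE lam (z * ((p ^ n : ℕ) * t)) = 1 :=
      Subtype.ext (by rw [coe_lamE, h2]; simp)
    rw [this, mul_one]
  constructor
  · rintro h ζ ⟨t, ht⟩ n r h1 ⟨z, hz, hsr⟩
    obtain rfl : ζ = lamE lam t := Subtype.ext ht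
    rw [h t]
    exact key t z n r h1 hz (by rw [← hsr]; ring)
  · intro h t
    obtain ⟨n, hn⟩ := exists_pow_eq_one p hlam t
    have hn' : lamE lam t ^ p ^ n = 1 := by
      apply Subtype.ext
      rw [← Circle.coe_inj] at hn
      simpa using hn
    obtain ⟨r, z, hz, hr⟩ := exists_int_approx p n hs
    rw [key t z n r hn' hz hr]
    exact h (lamE lam t) ⟨t, rfl⟩ n r hn' ⟨z, hz, by rw [hr]; ring⟩

/-- Compactness of `𝒫`: each `t` imposes a closed condition on `s`, and finitely many values lie in
one group of `p^M`-th roots of unity, on which `σ` is an integral power map. -/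
theorem exists_acts (p : ℕ) [CharP 𝓀[F] p] (hlam : Continuous lam)
    (σ : charField lam ≃ₐ[ℚ] charField lam) : ∃ s ∈ primeSubring F, Acts lam σ s := by
  have hp := prime_residueChar F p
  let C : F → Set F := fun t => {s | ((σ (lamE lam t) : charField lam) : ℂ) = lam (s * t)}
  have hC : ∀ t, IsClosed (C t) := fun t => isClosed_eq continuous_const (by fun_prop)
  obtain ⟨s, hs, h⟩ := (isCompact_primeSubring F).inter_iInter_nonempty C hC (by
    intro u
    choose N hN using fun t : F => exists_pow_eq_one p hlam t
    let M := u.sup N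
    have hM : ∀ t ∈ u, lamE lam t ^ p ^ M = 1 := by
      intro t ht
      have h1 := hN t
      rw [← Circle.coe_inj] at h1
      obtain ⟨k, hk⟩ := Nat.exists_eq_add_of_le (Finset.le_sup ht : N t ≤ M)
      rw [show M = N t + k from hk, pow_add, pow_mul]
      have : lamE lam t ^ p ^ N t = 1 := Subtype.ext (by simpa using h1)
      rw [this, one_pow]
    have : NeZero (p ^ M) := ⟨(pow_pos hp.pos _).ne'⟩
    obtain ⟨r, hr⟩ := rootsOfUnity.integer_power_of_ringEquiv (p ^ M) σ.toRingEquiv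
    refine ⟨(r : F), intCast_mem _ _, Set.mem_iInter₂.mpr fun t ht => ?_⟩
    have h0 : lamE lam t ≠ 0 := by
      intro h0; have := hM t ht; rw [h0, zero_pow NeZero.out] at this; exact zero_ne_one this
    have := hr ⟨Units.mk0 _ h0, by ext; simp [hM t ht]⟩
    change ((σ (lamE lam t) : charField lam) : ℂ) = (lamE lam (r * t) : ℂ)
    rw [lamE_intCast_mul]
    have h2 := congrArg Subtype.val this
    simpa using h2)
  exact ⟨s, hs, fun t => Subtype.ext (Set.mem_iInter.mp h t)⟩

end Character
end WeilDescent

/-! ### Teichmüller representatives -/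

namespace WeilDescent

open Filter Topology

section Teichmuller

variable {F : Type*} [Field F] [ValuativeRel F] [TopologicalSpace F] [IsNonarchimedeanLocalField F]
  {p : ℕ} [CharP 𝓀[F] p]

variable (F) in
theorem not_residueChar_dvd_one : ¬ (p : primeSubring F) ∣ 1 := by
  rintro ⟨z, hz⟩
  have h1 : (1 : F) = p * z := by simpa using congrArg Subtype.val hz
  have h2 := congrArg (valuation F) h1
  rw [map_one, map_mul] at h2
  have h3 : valuation F (p : F) * valuation F (z : F) ≤ valuation F (p : F) :=
    mul_le_of_le_one_right' (valuation_le_one_of_mem z.2)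
  exact absurd (h2.le.trans h3) (not_le.mpr (valuation_residueChar_lt_one F p))

variable (F) in
theorem intCast_dvd_iff (k : ℤ) : (p : primeSubring F) ∣ (k : primeSubring F) ↔ (p : ℤ) ∣ k := by
  have hp := prime_residueChar F p
  constructor
  · intro h
    by_contra hk
    have hc : IsCoprime (p : ℤ) k :=
      (Nat.prime_iff_prime_int.mp hp).coprime_iff_not_dvd.mpr hk
    obtain ⟨a, b, hab⟩ := hc
    apply not_residueChar_dvd_one F (p := p)
    have : (1 : primeSubring F) = a * p + b * k := by
      have := congrArg (Int.cast : ℤ → primeSubring F) hab.symm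
      push_cast at this
      exact this
    rw [this]
    exact dvd_add (dvd_mul_left _ _) (dvd_mul_of_dvd_right h _)
  · rintro ⟨c, rfl⟩
    exact ⟨c, by push_cast; rfl⟩

theorem mem_higherUnits_one_iff {s : primeSubring F} :
    (s : F) ∈ higherUnits F p 1 ↔ (p : primeSubring F) ∣ s - 1 := by
  constructor
  · rintro ⟨z, hz, h⟩
    refine ⟨⟨z, hz⟩, Subtype.ext ?_⟩
    simp [h]
  · rintro ⟨z, h⟩
    refine ⟨z, z.2, ?_⟩
    have : (s : F) - 1 = p * z := by simpa using congrArg Subtype.val h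
    rw [pow_one, eq_comm, ← sub_eq_iff_eq_add'.mp this]

theorem exists_int_congr (s : primeSubring F) : ∃ r : ℤ, (p : primeSubring F) ∣ s - r := by
  obtain ⟨r, z, hz, h⟩ := exists_int_approx p 1 s.2
  refine ⟨r, ⟨z, hz⟩, Subtype.ext ?_⟩
  simp [h]

variable (hp2 : p ≠ 2) {ε : F} (hε : ε ∈ primeClosure F) (hε' : IsPrimitiveRoot ε (p - 1))

theorem two_mul_half_residueChar (F : Type*) [Field F] [ValuativeRel F] [TopologicalSpace F]
    [IsNonarchimedeanLocalField F] {p : ℕ} [CharP 𝓀[F] p] (hp2 : p ≠ 2) :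
    2 * ((p - 1) / 2) = p - 1 := by
  have hp := prime_residueChar F p
  obtain ⟨k, hk⟩ := hp.odd_of_ne_two hp2
  omega

theorem half_residueChar_pos (F : Type*) [Field F] [ValuativeRel F] [TopologicalSpace F]
    [IsNonarchimedeanLocalField F] {p : ℕ} [CharP 𝓀[F] p] (hp2 : p ≠ 2) :
    0 < (p - 1) / 2 := by
  have hp := prime_residueChar F p
  have := hp.two_le
  omega

include hp2 hε' in
theorem root_pow_half : ε ^ ((p - 1) / 2) = -1 := by
  have h2 := two_mul_half_residueChar F hp2
  have h3 := half_residueChar_pos F hp2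
  have h1 : ε ^ ((p - 1) / 2) * ε ^ ((p - 1) / 2) = 1 := by
    rw [← pow_add, ← two_mul, h2, hε'.pow_eq_one]
  rcases mul_self_eq_one_iff.mp h1 with h | h
  · have := Nat.le_of_dvd h3 (hε'.dvd_of_pow_eq_one _ h)
    omega
  · exact h

include hε hε' in
-- The reduction `e` of `ε` generates `(ℤ/p)ˣ`: if `e^d = 1`, then `ε^d` is a principal unit killed
-- by `p - 1`, hence `1`, so `p - 1` divides `d`.
theorem exists_pow_congr {r : ℤ} (hr : ¬ (p : ℤ) ∣ r) :
    ∃ j : ℕ, (p : primeSubring F) ∣ ⟨ε, hε⟩ ^ j - (r : primeSubring F) := by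
  have hp := prime_residueChar F p
  have : Fact p.Prime := ⟨hp⟩
  obtain ⟨e, he⟩ := exists_int_congr (p := p) (⟨ε, hε⟩ : primeSubring F)
  have hpow : ∀ d : ℕ, (p : primeSubring F) ∣ ⟨ε, hε⟩ ^ d - ((e ^ d : ℤ) : primeSubring F) := by
    intro d
    push_cast
    exact he.trans (sub_dvd_pow_sub_pow _ _ d)
  have he0 : (e : ZMod p) ≠ 0 := by
    intro h
    rw [ZMod.intCast_zmod_eq_zero_iff_dvd] at h
    have h1 : (p : primeSubring F) ∣ ⟨ε, hε⟩ := by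
      have := dvd_add he ((intCast_dvd_iff F e).mpr h)
      simpa using this
    have h2 : (p : primeSubring F) ∣ ⟨ε, hε⟩ ^ (p - 1) :=
      h1.trans (dvd_pow_self _ (by have := hp.two_le; omega))
    apply not_residueChar_dvd_one F (p := p)
    convert h2
    exact Subtype.ext hε'.pow_eq_one.symm
  have hord : orderOf (Units.mk0 _ he0) = Nat.card (ZMod p)ˣ := by
    rw [Nat.card_eq_fintype_card, ZMod.card_units]
    refine Nat.dvd_antisymm (orderOf_dvd_of_pow_eq_one ?_) ?_
    · exact ZMod.units_pow_card_sub_one_eq_one p _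
    · have h1 : (e : ZMod p) ^ orderOf (Units.mk0 _ he0) = 1 := by
        have := pow_orderOf_eq_one (Units.mk0 _ he0)
        have := congrArg Units.val this
        rwa [Units.val_pow_eq_pow_val, Units.val_mk0, Units.val_one] at this
      generalize orderOf (Units.mk0 _ he0) = d at h1
      have h2 : (p : ℤ) ∣ e ^ d - 1 := by
        rw [← ZMod.intCast_zmod_eq_zero_iff_dvd]; push_cast; rw [h1, sub_self]
      have h3 := (intCast_dvd_iff F _).mpr h2
      have h4 : (ε ^ d) ∈ higherUnits F p 1 := by
        have : (p : primeSubring F) ∣ ⟨ε, hε⟩ ^ d - 1 := by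
          have := dvd_add (hpow d) h3
          push_cast at this
          simpa using this
        exact mem_higherUnits_one_iff.mpr this
      refine hε'.dvd_of_pow_eq_one _ (eq_one_of_pow_eq_one h4 ?_)
      rw [← pow_mul, mul_comm, pow_mul, hε'.pow_eq_one, one_pow]
  have hr0 : (r : ZMod p) ≠ 0 := by rwa [Ne, ZMod.intCast_zmod_eq_zero_iff_dvd]
  obtain ⟨j, hj⟩ : ∃ j : ℕ, (Units.mk0 _ he0) ^ j = Units.mk0 _ hr0 := by
    have : Units.mk0 _ hr0 ∈ Subgroup.zpowers (Units.mk0 _ he0) := by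
      rw [Subgroup.eq_top_of_card_eq (Subgroup.zpowers (Units.mk0 _ he0))
        (by rw [Nat.card_zpowers, hord])]
      trivial
    exact mem_powers_iff_mem_zpowers.mpr this
  refine ⟨j, ?_⟩
  have h5 : (e : ZMod p) ^ j = r := by simpa using congrArg Units.val hj
  have h6 : (p : ℤ) ∣ e ^ j - r := by
    rw [← ZMod.intCast_zmod_eq_zero_iff_dvd]; push_cast; rw [h5, sub_self]
  have h7 := dvd_add (hpow j) ((intCast_dvd_iff F _).mpr h6)
  push_cast at h7
  simpa using h7

include hp2 hε' in
theorem root_ne_zero : ε ≠ 0 := by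
  rintro rfl
  have h := half_residueChar_pos F hp2
  have := hε'.pow_eq_one
  rw [zero_pow (by omega)] at this
  exact zero_ne_one this

include hp2 hε' in
-- Taking square roots leaves a sign, which is absorbed by `ε^((p-1)/2) = -1`; this is why the
-- exponent is determined only modulo `(p-1)/2`. The quotient `t s⁻¹` is then both a principal unit
-- and a power of `ε`, hence `1`.
theorem pow_eq_of_mul_sq_eq {i j : ℕ} {s t : F} (hs : s ∈ higherUnits F p 1)
    (ht : t ∈ higherUnits F p 1) (h : ε ^ (2 * i) * s ^ 2 = ε ^ (2 * j) * t ^ 2) :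
    s = t ∧ i ≡ j [MOD (p - 1) / 2] := by
  have h2 := two_mul_half_residueChar F hp2
  have h0 := root_ne_zero hp2 hε'
  obtain ⟨k, hk, hkj⟩ : ∃ k, ε ^ i * s = ε ^ k * t ∧ k ≡ j [MOD (p - 1) / 2] := by
    have h1 : (ε ^ i * s) ^ 2 = (ε ^ j * t) ^ 2 := by
      rw [mul_pow, mul_pow, ← pow_mul, ← pow_mul, mul_comm i, mul_comm j, h]
    rcases sq_eq_sq_iff_eq_or_eq_neg.mp h1 with h1 | h1
    · exact ⟨j, h1, rfl⟩
    · refine ⟨j + (p - 1) / 2, ?_, by simp [Nat.ModEq]⟩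
      rw [h1, pow_add, root_pow_half hp2 hε']; ring
  have hs0 := ne_zero_of_mem_higherUnits hs
  have hq : t * s⁻¹ = ε ^ i * (ε ^ k)⁻¹ := by
    field_simp
    rw [mul_comm t, ← hk]; ring
  have h1 : t * s⁻¹ = 1 := by
    refine eq_one_of_pow_eq_one (mul_mem_higherUnits ht (inv_mem_higherUnits hs)) ?_
    rw [hq, mul_pow, inv_pow, ← pow_mul, ← pow_mul, mul_comm i, mul_comm k, pow_mul, pow_mul,
      hε'.pow_eq_one, one_pow, one_pow, inv_one, mul_one]
  have hst : s = t := (mul_inv_eq_one₀ hs0).mp h1 |>.symm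
  refine ⟨hst, Nat.ModEq.trans ?_ hkj⟩
  rw [hq, mul_inv_eq_one₀ (pow_ne_zero _ h0)] at h1
  have h3 : i ≡ k [MOD (p - 1)] := by
    have h4 : Units.mk0 ε h0 ^ i = Units.mk0 ε h0 ^ k := Units.ext (by simpa using h1)
    have := pow_eq_pow_iff_modEq.mp h4
    rwa [← orderOf_units, Units.val_mk0, ← hε'.eq_orderOf] at this
  exact h3.of_dvd ⟨2, by omega⟩

end Teichmuller
end WeilDescent

/-! ### Quadratic Gauss sums -/

namespace WeilDescent

open Filter Topology

/-- The quadratic Gauss sum formed with a primitive `p`-th root of unity. -/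
noncomputable def quadraticGaussSum {L : Type*} [Field L] {p : ℕ} [Fact p.Prime] {ζ : L}
    (hζ : IsPrimitiveRoot ζ p) : L :=
  gaussSum ((quadraticChar (ZMod p)).ringHomComp (Int.castRingHom L))
    (AddChar.zmodChar p hζ.pow_eq_one)

theorem quadraticGaussSum_sq {L : Type*} [Field L] [CharZero L] {p : ℕ}
    [hp : Fact p.Prime] (hp2 : p ≠ 2) {ζ : L} (hζ : IsPrimitiveRoot ζ p) :
    quadraticGaussSum hζ ^ 2 = p ∨ quadraticGaussSum hζ ^ 2 = -p := by
  have h2 : ringChar (ZMod p) ≠ 2 := by rwa [ZMod.ringChar_zmod_n]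
  have hχ1 : (quadraticChar (ZMod p)).ringHomComp (Int.castRingHom L) ≠ 1 := by
    rw [Ne, ← MulChar.ringHomComp_one (Int.castRingHom L)]
    exact fun h => quadraticChar_ne_one h2
      (MulChar.injective_ringHomComp (RingHom.injective_int _) h)
  have hχ2 : ((quadraticChar (ZMod p)).ringHomComp (Int.castRingHom L)).IsQuadratic :=
    (quadraticChar_isQuadratic (ZMod p)).comp _
  have hsq := gaussSum_sq hχ1 hχ2 (AddChar.zmodChar_primitive_of_primitive_root p hζ)
  rw [ZMod.card] at hsq
  rw [quadraticGaussSum]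
  rcases hχ2 (-1) with h | h | h
  · exact absurd h ((IsUnit.neg isUnit_one).map _ |>.ne_zero)
  · left; rw [hsq, h, one_mul]
  · right; rw [hsq, h, neg_one_mul]

/-- A Galois conjugation raising the `p`-th roots of unity to the power `r` and fixing the square
roots of `± p` exists only if `r` is a square modulo `p`. -/
theorem isSquare_of_fixes_sqrt {L L' : Type*} [Field L] [Field L'] [CharZero L] {p : ℕ}
    [hp : Fact p.Prime] (hp2 : p ≠ 2) {ζ : L} (hζ : IsPrimitiveRoot ζ p) (f ι : L →+* L') (r : ℕ)
    (hr : ¬ p ∣ r) (hf : f ζ = ι ζ ^ r)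
    (hfix : ∀ x : L, x ^ 2 = p ∨ x ^ 2 = -p → f x = ι x) : IsSquare (r : ZMod p) := by
  have hr0 : (r : ZMod p) ≠ 0 := by rwa [Ne, ZMod.natCast_eq_zero_iff]
  have hcases := quadraticGaussSum_sq hp2 hζ
  have hp0 : (p : L) ≠ 0 := Nat.cast_ne_zero.mpr hp.out.ne_zero
  have hne : quadraticGaussSum hζ ≠ 0 := by
    rintro h
    rw [h] at hcases
    simp [hp0, eq_comm] at hcases
  have hfg := hfix _ hcases
  rw [quadraticGaussSum] at hfg hne
  set χ : MulChar (ZMod p) L := (quadraticChar (ZMod p)).ringHomComp (Int.castRingHom L) with hχ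
  set ψ : AddChar (ZMod p) L := AddChar.zmodChar p hζ.pow_eq_one with hψ
  -- The Gauss sum is a square root of `± p`, hence fixed; but raising the roots of unity to the
  -- power `r` multiplies it by `χ(r)⁻¹`. So `χ(r) = 1`.
  have hf2 : f (gaussSum χ ψ) = ι (gaussSum χ (ψ.mulShift r)) := by
    simp only [gaussSum, map_sum, map_mul]
    refine Finset.sum_congr rfl fun x _ => ?_
    congr 1
    · simp [χ]
    · rw [AddChar.mulShift_apply]
      simp only [ψ]
      rw [← nsmul_eq_mul, AddChar.map_nsmul_eq_pow, AddChar.zmodChar_apply, map_pow, map_pow,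
        map_pow, hf, ← pow_mul, ← pow_mul, mul_comm]
  have h3 := gaussSum_mulShift χ ψ (Units.mk0 _ hr0)
  rw [Units.val_mk0] at h3
  have h4 : gaussSum χ (ψ.mulShift r) = gaussSum χ ψ := ι.injective (hf2.symm.trans hfg)
  rw [h4] at h3
  have h5 : χ r = 1 := mul_right_cancel₀ hne (h3.trans (one_mul _).symm)
  have h6 : quadraticChar (ZMod p) r = 1 := by
    simp only [χ, MulChar.ringHomComp_apply, eq_intCast] at h5
    exact_mod_cast h5
  exact (quadraticChar_one_iff_isSquare hr0).mp h6

end WeilDescent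

/-! ### The parameters `(i, s)` of a Galois element -/

namespace WeilDescent

open Filter Topology

section SqrtField

variable (p : ℕ)

theorem sqrt_mem_sqrtField : ((Real.sqrt p : ℝ) : ℂ) ∈ sqrtField p :=
  IntermediateField.subset_adjoin _ _ (by simp)

theorem sqrt_sq_complex : ((Real.sqrt p : ℝ) : ℂ) ^ 2 = p := by
  rw [← Complex.ofReal_pow, Real.sq_sqrt (Nat.cast_nonneg p), Complex.ofReal_natCast]

theorem I_mem_sqrtField [hp : Fact p.Prime] : Complex.I ∈ sqrtField p := by
  have h0 : ((Real.sqrt p : ℝ) : ℂ) ≠ 0 := by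
    have : 0 < Real.sqrt p := Real.sqrt_pos.mpr (Nat.cast_pos.mpr hp.out.pos)
    exact_mod_cast this.ne'
  have h1 : Complex.I * ((Real.sqrt p : ℝ) : ℂ) ∈ sqrtField p :=
    IntermediateField.subset_adjoin _ _ (by simp)
  have := div_mem h1 (sqrt_mem_sqrtField p)
  rwa [mul_div_cancel_right₀ _ h0] at this

theorem mem_sqrtField_of_sq [Fact p.Prime] {x : ℂ} (h : x ^ 2 = p ∨ x ^ 2 = -p) :
    x ∈ sqrtField p := by
  have hs := sqrt_mem_sqrtField p
  rcases h with h | h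
  · rw [← sqrt_sq_complex, sq_eq_sq_iff_eq_or_eq_neg] at h
    rcases h with rfl | rfl
    · exact hs
    · exact neg_mem hs
  · have hI := I_mem_sqrtField p
    have : x ^ 2 = (Complex.I * ((Real.sqrt p : ℝ) : ℂ)) ^ 2 := by
      rw [mul_pow, sqrt_sq_complex, Complex.I_sq, h, neg_one_mul]
    rcases sq_eq_sq_iff_eq_or_eq_neg.mp this with rfl | rfl
    · exact mul_mem hI hs
    · exact neg_mem (mul_mem hI hs)

variable {p} {F : Type*} [Field F] {lam : AddChar F Circle}

theorem mem_galH {σ : charField lam ≃ₐ[ℚ] charField lam} :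
    σ ∈ galH p lam ↔ ∀ x : charField lam, (x : ℂ) ∈ sqrtField p → σ x = x :=
  IntermediateField.mem_fixingSubgroup_iff ((sqrtField p).comap (charField lam).val) σ

end SqrtField

section GaloisH

variable {F : Type*} [Field F] [ValuativeRel F] [TopologicalSpace F] [IsNonarchimedeanLocalField F]
  {p : ℕ} [CharP 𝓀[F] p] {lam : AddChar F Circle}

variable (p) in
-- All values of `λ` have `p`-power order; a suitable power of a nontrivial one has order exactly
-- `p`. It supplies the `p`-th roots of unity inside `E`.
theorem exists_lam_pow_char_eq_one (hlam : Continuous lam) (hlam' : lam ≠ 1) :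
    ∃ t, lam t ≠ 1 ∧ lam t ^ p = 1 := by
  obtain ⟨t, ht⟩ := exists_lam_ne_one hlam'
  have hex := exists_pow_eq_one p hlam t
  classical
  set n := Nat.find hex with hn
  have h1 : lam t ^ p ^ n = 1 := Nat.find_spec hex
  have hn0 : n ≠ 0 := by
    intro h; rw [h] at h1; simp [ht] at h1
  refine ⟨(p ^ (n - 1) : ℕ) * t, ?_, ?_⟩
  · rw [← nsmul_eq_mul, AddChar.map_nsmul_eq_pow]
    exact Nat.find_min hex (by omega)
  · rw [← nsmul_eq_mul, AddChar.map_nsmul_eq_pow, ← pow_mul, ← pow_succ,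
      Nat.sub_add_cancel (Nat.pos_of_ne_zero hn0), h1]

variable {t₀ : F} (ht : lam t₀ ≠ 1) (htp : lam t₀ ^ p = 1)

include ht htp in
theorem isPrimitiveRoot_lam : IsPrimitiveRoot (lam t₀ : ℂ) p := by
  have := Fact.mk (prime_residueChar F p)
  rw [← Circle.coe_inj] at htp
  have h1 : (lam t₀ : ℂ) ^ p = 1 := by simpa using htp
  have h2 := orderOf_eq_prime h1 (by rwa [Ne, Circle.coe_eq_one])
  rw [← h2]
  exact IsPrimitiveRoot.orderOf _

include ht htp in
theorem isPrimitiveRoot_lamE : IsPrimitiveRoot (lamE lam t₀) p :=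
  IsPrimitiveRoot.of_map_of_injective (f := (charField lam).val) (isPrimitiveRoot_lam ht htp)
    Subtype.val_injective

include htp in
theorem lam_mul_congr (hlam : Continuous lam) {a b : primeSubring F}
    (h : (p : primeSubring F) ∣ a - b) : lam (a * t₀) = lam (b * t₀) := by
  obtain ⟨z, hz⟩ := h
  have hz' : (a : F) - b = p * z := by simpa using congrArg Subtype.val hz
  have h1 : lam (z * (p * t₀)) = 1 :=
    lam_mul_eq_one_of_mem hlam (by rw [← nsmul_eq_mul, AddChar.map_nsmul_eq_pow, htp]) z.2
  have h2 : (a : F) * t₀ = b * t₀ + z * (p * t₀) := by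
    rw [sub_eq_iff_eq_add'.mp hz']; ring
  rw [h2, AddChar.map_add_eq_mul, h1, mul_one]

include ht htp in
theorem dvd_sub_of_lam_mul_eq (hlam : Continuous lam) {a b : primeSubring F}
    (h : lam (a * t₀) = lam (b * t₀)) : (p : primeSubring F) ∣ a - b := by
  obtain ⟨r, hr⟩ := exists_int_congr (p := p) (a - b)
  have h1 : lam ((a - b : primeSubring F) * t₀) = 1 := by
    rw [AddSubgroupClass.coe_sub, sub_mul, AddChar.map_sub_eq_div, h, div_self']
  rw [lam_mul_congr htp hlam hr] at h1
  have h2 : lam t₀ ^ r = 1 := by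
    rw [← AddChar.map_zsmul_eq_zpow, zsmul_eq_mul]; simpa using h1
  have h3 : (p : ℤ) ∣ r := by
    rw [← (isPrimitiveRoot_lam ht htp).zpow_eq_one_iff_dvd, ← Circle.coe_zpow, h2, Circle.coe_one]
  have := dvd_add hr ((intCast_dvd_iff F r).mpr h3)
  simpa using this

include ht htp in
-- The general field `L` with two homomorphisms serves both the automorphisms of `E` in `ℌ` and the
-- embeddings of `ℚ(ν_p, √-1)` that occur in the norm.
theorem isSquare_of_ringHom {L : Type*} [Field L] [CharZero L] (hp2 : p ≠ 2) (f ι : L →+* ℂ)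
    {ζ : L} (hζ : ι ζ = lam t₀) {k : ℕ} (hk : ¬ p ∣ k) (hf : f ζ = ι ζ ^ k)
    (hfix : ∀ x : L, ι x ∈ sqrtField p → f x = ι x) : ∃ w : ℤ, (p : ℤ) ∣ w ^ 2 - k := by
  have hp := Fact.mk (prime_residueChar F p)
  have hζ' : IsPrimitiveRoot ζ p := by
    refine IsPrimitiveRoot.of_map_of_injective (f := ι) ?_ ι.injective
    rw [hζ]; exact isPrimitiveRoot_lam ht htp
  have := isSquare_of_fixes_sqrt hp2 hζ' f ι k hk hf fun x hx => hfix x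
    (mem_sqrtField_of_sq p (by rw [← map_pow]; rcases hx with h | h <;> simp [h]))
  obtain ⟨w, hw⟩ := this
  obtain ⟨w, rfl⟩ := ZMod.intCast_surjective w
  refine ⟨w, ?_⟩
  rw [← ZMod.intCast_zmod_eq_zero_iff_dvd]
  push_cast
  rw [hw]; ring

variable {ε : F} (hε : ε ∈ primeClosure F) (hε' : IsPrimitiveRoot ε (p - 1))

include ht htp hε hε' in
theorem exists_root_pow_of_ringHom {L : Type*} [Field L] [CharZero L] (hp2 : p ≠ 2) (f ι : L →+* ℂ)
    {ζ : L} (hζ : ι ζ = lam t₀) {k : ℕ} (hk : ¬ p ∣ k) (hf : f ζ = ι ζ ^ k)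
    (hfix : ∀ x : L, ι x ∈ sqrtField p → f x = ι x) :
    ∃ j : ℕ, 1 ≤ j ∧ j ≤ (p - 1) / 2 ∧ (p : primeSubring F) ∣ ⟨ε, hε⟩ ^ (2 * j) - k := by
  have hp := Fact.mk (prime_residueChar F p)
  obtain ⟨w, hw⟩ := isSquare_of_ringHom ht htp hp2 f ι hζ hk hf hfix
  have hwp : ¬ (p : ℤ) ∣ w := by
    intro h
    have h1 : (p : ℤ) ∣ k := by
      have := dvd_sub (h.trans (dvd_pow_self w two_ne_zero)) hw
      simpa using this
    exact hk (by exact_mod_cast h1)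
  obtain ⟨j, hj⟩ := exists_pow_congr (p := p) hε hε' hwp
  have h2 := two_mul_half_residueChar F hp2
  have hN := half_residueChar_pos F hp2
  have hj2 : (p : primeSubring F) ∣ ⟨ε, hε⟩ ^ (2 * j) - k := by
    have h3 := hj.trans (sub_dvd_pow_sub_pow _ _ 2)
    have h4 := (intCast_dvd_iff F _).mpr hw
    push_cast at h4
    have := dvd_add h3 h4
    rwa [sub_add_sub_cancel, ← pow_mul, mul_comm j] at this
  set N := (p - 1) / 2
  have hper : ∀ m, (⟨ε, hε⟩ : primeSubring F) ^ (2 * m) = ⟨ε, hε⟩ ^ (2 * (m % N)) := by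
    intro m
    have h1 : (⟨ε, hε⟩ : primeSubring F) ^ (2 * N) = 1 :=
      Subtype.ext (by rw [h2]; exact hε'.pow_eq_one)
    conv_lhs => rw [← Nat.mod_add_div m N, mul_add, pow_add, ← mul_assoc, pow_mul _ (2 * N), h1,
      one_pow, mul_one]
  -- The range is `1, …, N`, so the residue class of zero is represented by `N`.
  by_cases h0 : j % N = 0
  · refine ⟨N, hN, le_rfl, ?_⟩
    rw [hper, Nat.mod_self, ← h0, ← hper]; exact hj2
  · refine ⟨j % N, Nat.pos_of_ne_zero h0, (Nat.mod_lt _ hN).le, ?_⟩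
    rw [← hper]; exact hj2

include hε hε' in
/-- The parameters `(i, s)` of an element of `Gal(E / ℚ(√p, √-p))`. -/
theorem exists_parameters (hlam : Continuous lam) (hlam' : lam ≠ 1) (hp2 : p ≠ 2)
    {σ : charField lam ≃ₐ[ℚ] charField lam} (hσ : σ ∈ galH p lam) :
    ∃ (i : ℕ) (s : F), 1 ≤ i ∧ i ≤ (p - 1) / 2 ∧ s ∈ higherUnits F p 1 ∧
      Acts lam σ (ε ^ (2 * i) * s ^ 2) := by
  have hp := Fact.mk (prime_residueChar F p)
  obtain ⟨t₀, ht, htp⟩ := exists_lam_pow_char_eq_one p hlam hlam'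
  obtain ⟨a, ha, hσa⟩ := exists_acts p hlam σ
  obtain ⟨r, hr⟩ := exists_int_congr (p := p) (⟨a, ha⟩ : primeSubring F)
  obtain ⟨k, hk⟩ : ∃ k : ℕ, (p : primeSubring F) ∣ ⟨a, ha⟩ - k := by
    have hpz : (p : ℤ) ≠ 0 := by exact_mod_cast hp.out.ne_zero
    refine ⟨(r % p).toNat, ?_⟩
    have h1 : (((r % p).toNat : ℤ)) = r % p := Int.toNat_of_nonneg (Int.emod_nonneg _ hpz)
    have h2 : (p : ℤ) ∣ r - (r % p) := Int.dvd_self_sub_emod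
    rw [← h1] at h2
    have := dvd_add hr ((intCast_dvd_iff F _).mpr h2)
    push_cast at this
    rwa [sub_add_sub_cancel] at this
  have h1 : lam (a * t₀) = lam t₀ ^ k := by
    have := lam_mul_congr htp hlam hk
    rw [← AddChar.map_nsmul_eq_pow, nsmul_eq_mul]
    simpa using this
  have hkp : ¬ p ∣ k := by
    rintro ⟨c, rfl⟩
    have h2 : σ (lamE lam t₀) = lamE lam 0 := by
      rw [hσa, lamE_inj, h1, pow_mul, htp, one_pow, AddChar.map_zero_eq_one]
    have h3 : lamE lam 0 = 1 := Subtype.ext (by simp)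
    rw [h3, map_eq_one_iff σ σ.injective, ← h3, lamE_inj, AddChar.map_zero_eq_one] at h2
    exact ht h2
  obtain ⟨j, hj1, hjN, hj⟩ := exists_root_pow_of_ringHom ht htp hε hε' hp2
    ((charField lam).val.toRingHom.comp σ.toAlgHom.toRingHom) (charField lam).val.toRingHom
    (ζ := lamE lam t₀) rfl hkp
    (by
      change ((σ (lamE lam t₀) : charField lam) : ℂ) = (lam t₀ : ℂ) ^ k
      rw [hσa, coe_lamE, h1, Circle.coe_pow])
    (fun x hx => congrArg Subtype.val (mem_galH.mp hσ x hx))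
  have h0 := root_ne_zero hp2 hε'
  have h2 := two_mul_half_residueChar F hp2
  -- This is `a ε^(-2j)`, the inverse being written as a natural power through `ε^(p-1) = 1`. It is
  -- a principal unit, and its square root is the parameter `s`.
  let b : primeSubring F := ⟨a, ha⟩ * ⟨ε, hε⟩ ^ ((p - 1) * j - 2 * j)
  have hle : 2 * j ≤ (p - 1) * j :=
    Nat.mul_le_mul_right _ (by have := half_residueChar_pos F hp2; omega)
  have hinv : (⟨ε, hε⟩ : primeSubring F) ^ (2 * j) * ⟨ε, hε⟩ ^ ((p - 1) * j - 2 * j) = 1 := by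
    rw [← pow_add, Nat.add_sub_cancel' hle, pow_mul]
    exact Subtype.ext (by push_cast; rw [hε'.pow_eq_one, one_pow])
  have hb : (b : F) ∈ higherUnits F p 1 := by
    rw [mem_higherUnits_one_iff]
    have h3 : (p : primeSubring F) ∣ ⟨a, ha⟩ - ⟨ε, hε⟩ ^ (2 * j) := by
      have := dvd_sub hk hj
      rwa [sub_sub_sub_cancel_right] at this
    have := h3.mul_right (⟨ε, hε⟩ ^ ((p - 1) * j - 2 * j))
    rwa [sub_mul, hinv] at this
  obtain ⟨s, hs, hsb⟩ := exists_sq_eq_of_mem_higherUnits hp2 hb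
  refine ⟨j, s, hj1, hjN, hs, ?_⟩
  have : ε ^ (2 * j) * s ^ 2 = a := by
    rw [hsb]
    have := congrArg Subtype.val hinv
    simp only [Subring.coe_mul, SubmonoidClass.coe_pow, OneMemClass.coe_one] at this
    simp only [b, Subring.coe_mul, SubmonoidClass.coe_pow]
    rw [mul_left_comm, this, mul_one]
  rwa [this]

end GaloisH
end WeilDescent

/-! ### The norm of `u` as a product of conjugates under `η` -/

namespace WeilDescent

open Filter Topology

section Norm

variable {F : Type*} [Field F] [ValuativeRel F] [TopologicalSpace F] [IsNonarchimedeanLocalField F]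
  {p : ℕ} [CharP 𝓀[F] p] {lam : AddChar F Circle}

theorem I_mem_charField {F : Type*} [Field F] (lam : AddChar F Circle) :
    Complex.I ∈ charField lam :=
  IntermediateField.subset_adjoin _ _ (Or.inr rfl)

/-- The quadratic Gauss sum lies in `E` and is a square root of `p` or `-p`; multiplying by `√-1` if
necessary gives `√p`. -/
theorem sqrtField_le_charField (hlam : Continuous lam) (hlam' : lam ≠ 1) (hp2 : p ≠ 2) :
    sqrtField p ≤ charField lam := by
  have hp := Fact.mk (prime_residueChar F p)
  obtain ⟨t₀, ht, htp⟩ := exists_lam_pow_char_eq_one p hlam hlam'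
  have hI := I_mem_charField lam
  have hs : ((Real.sqrt p : ℝ) : ℂ) ∈ charField lam := by
    have hg := quadraticGaussSum_sq hp2 (isPrimitiveRoot_lamE ht htp)
    set g := quadraticGaussSum (isPrimitiveRoot_lamE ht htp)
    rcases hg with h | h
    · have : ((Real.sqrt p : ℝ) : ℂ) ^ 2 = (g : ℂ) ^ 2 := by
        rw [sqrt_sq_complex]; simpa using (congrArg Subtype.val h).symm
      rcases sq_eq_sq_iff_eq_or_eq_neg.mp this with h | h <;> rw [h]
      · exact g.2
      · exact neg_mem g.2
    · have : ((Real.sqrt p : ℝ) : ℂ) ^ 2 = (Complex.I * (g : ℂ)) ^ 2 := by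
        have : (g : ℂ) ^ 2 = -p := by simpa using congrArg Subtype.val h
        rw [sqrt_sq_complex, mul_pow, this, Complex.I_sq]; ring
      rcases sq_eq_sq_iff_eq_or_eq_neg.mp this with h | h <;> rw [h]
      · exact mul_mem hI g.2
      · exact neg_mem (mul_mem hI g.2)
  refine IntermediateField.adjoin_le_iff.mpr ?_
  rintro x (rfl | rfl)
  · exact hs
  · exact mul_mem hI hs

theorem rootField_le_charField (hlam : Continuous lam) (hlam' : lam ≠ 1) (hp2 : p ≠ 2) {x : ℂ}
    (hx : x ∈ rootField p) : x ∈ charField lam := by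
  have hp := Fact.mk (prime_residueChar F p)
  obtain ⟨t₀, ht, htp⟩ := exists_lam_pow_char_eq_one p hlam hlam'
  have h : rootField p ≤
      IntermediateField.extendScalars (sqrtField_le_charField hlam hlam' hp2) := by
    refine IntermediateField.adjoin_le_iff.mpr ?_
    rintro x (hx | rfl)
    · obtain ⟨i, -, rfl⟩ := (isPrimitiveRoot_lam ht htp).eq_pow_of_pow_eq_one hx
      exact pow_mem (lamE lam t₀).2 i
    · exact I_mem_charField lam
  exact h hx

/-- The embedding of `ℚ(ν_p, √-1)` into `ℂ` induced by an element of `Gal(E / ℚ(√p, √-p))`. -/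
noncomputable def rootFieldEmbedding (hlam : Continuous lam) (hlam' : lam ≠ 1) (hp2 : p ≠ 2)
    {σ : charField lam ≃ₐ[ℚ] charField lam} (hσ : σ ∈ galH p lam) :
    rootField p →ₐ[sqrtField p] ℂ where
  toRingHom := (charField lam).val.toRingHom.comp (σ.toAlgHom.toRingHom.comp
    (Subring.inclusion (S := (rootField p).toSubfield.toSubring)
      (T := (charField lam).toSubfield.toSubring)
      fun _ hx => rootField_le_charField hlam hlam' hp2 hx))
  commutes' r := by
    exact congrArg Subtype.val
      (mem_galH.mp hσ ⟨(r : ℂ), sqrtField_le_charField hlam hlam' hp2 r.2⟩ r.2)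

theorem rootFieldEmbedding_apply (hlam : Continuous lam) (hlam' : lam ≠ 1) (hp2 : p ≠ 2)
    {σ : charField lam ≃ₐ[ℚ] charField lam} (hσ : σ ∈ galH p lam) (x : rootField p)
    (y : charField lam) (hxy : (x : ℂ) = y) :
    rootFieldEmbedding hlam hlam' hp2 hσ x = σ y := by
  have : y = ⟨x, rootField_le_charField hlam hlam' hp2 x.2⟩ := Subtype.ext hxy.symm
  rw [this]; rfl

variable {t₀ : F} (ht : lam t₀ ≠ 1) (htp : lam t₀ ^ p = 1)

include htp in
theorem lam_mem_rootField : (lam t₀ : ℂ) ∈ rootField p :=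
  IntermediateField.subset_adjoin _ _ (Or.inl (by
    change (lam t₀ : ℂ) ^ p = 1
    rw [← Circle.coe_pow, htp, Circle.coe_one]))

include ht in
-- One primitive `p`-th root of unity generates the field over `ℚ(√p, √-p)`, since `√-1 = √-p / √p`
-- is already in the base.
theorem rootField_algHom_ext {f g : rootField p →ₐ[sqrtField p] ℂ}
    (h : f ⟨lam t₀, lam_mem_rootField htp⟩ = g ⟨lam t₀, lam_mem_rootField htp⟩) : f = g := by
  have hp := Fact.mk (prime_residueChar F p)
  refine IntermediateField.algHom_ext_of_eq_adjoin (sqrtField p) rfl fun x hx => ?_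
  rcases hx with hx | rfl
  · obtain ⟨i, -, rfl⟩ := (isPrimitiveRoot_lam ht htp).eq_pow_of_pow_eq_one hx
    exact ((map_pow f ⟨lam t₀, lam_mem_rootField htp⟩ i).trans (by rw [h])).trans
      (map_pow g ⟨lam t₀, lam_mem_rootField htp⟩ i).symm
  · exact (f.commutes ⟨Complex.I, I_mem_sqrtField p⟩).trans
      (g.commutes ⟨Complex.I, I_mem_sqrtField p⟩).symm

include ht htp in
/-- Elements of `Gal(E / ℚ(√p, √-p))` that agree on the `p`-th roots of unity agree on
`ℚ(ν_p, √-1)`. -/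
theorem eqOn_rootField (hlam : Continuous lam) (hlam' : lam ≠ 1) (hp2 : p ≠ 2)
    {σ τ : charField lam ≃ₐ[ℚ] charField lam} (hσ : σ ∈ galH p lam) (hτ : τ ∈ galH p lam)
    (h : σ (lamE lam t₀) = τ (lamE lam t₀)) {u : charField lam} (hu : (u : ℂ) ∈ rootField p) :
    σ u = τ u := by
  apply Subtype.ext
  rw [← rootFieldEmbedding_apply hlam hlam' hp2 hσ ⟨u, hu⟩ u rfl,
    ← rootFieldEmbedding_apply hlam hlam' hp2 hτ ⟨u, hu⟩ u rfl]
  congr 1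
  apply rootField_algHom_ext ht htp
  rw [rootFieldEmbedding_apply hlam hlam' hp2 hσ _ (lamE lam t₀) rfl,
    rootFieldEmbedding_apply hlam hlam' hp2 hτ _ (lamE lam t₀) rfl, h]

theorem finiteDimensional_rootField (hp0 : 0 < p) :
    FiniteDimensional (sqrtField p) (rootField p) := by
  have hfin : Finite ({z : ℂ | z ^ p = 1} ∪ {Complex.I} : Set ℂ) := by
    refine Set.Finite.to_subtype (Set.Finite.union ?_ (Set.finite_singleton _))
    refine (Polynomial.nthRoots p (1 : ℂ)).toFinset.finite_toSet.subset fun z hz => ?_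
    simpa [Polynomial.mem_nthRoots hp0] using hz
  refine IntermediateField.finiteDimensional_adjoin fun x hx => ?_
  rcases hx with hx | rfl
  · exact IsIntegral.of_pow hp0 (by rw [show x ^ p = 1 from hx]; exact isIntegral_one)
  · exact IsIntegral.of_pow two_pos (by rw [Complex.I_sq]; exact isIntegral_one.neg)

variable {ε : F} (hε : ε ∈ primeClosure F) (hε' : IsPrimitiveRoot ε (p - 1))

include hε hε' in
theorem pow_eq_pow_of_dvd_sub (hp2 : p ≠ 2) {i j : ℕ}
    (h : (p : primeSubring F) ∣ ⟨ε, hε⟩ ^ i - ⟨ε, hε⟩ ^ j) : ε ^ i = ε ^ j := by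
  have h2 := two_mul_half_residueChar F hp2
  have hN := half_residueChar_pos F hp2
  let e : primeSubring F := ⟨ε, hε⟩
  have he : e ^ (p - 1) = 1 := Subtype.ext (by simpa [e] using hε'.pow_eq_one)
  have hinv : e ^ j * e ^ (j * (p - 2)) = 1 := by
    rw [← pow_add, show j + j * (p - 2) = (p - 1) * j by
      rw [show p - 1 = (p - 2) + 1 by omega]; ring, pow_mul, he, one_pow]
  have h1 : ((e ^ i * e ^ (j * (p - 2)) : primeSubring F) : F) ∈ higherUnits F p 1 := by
    rw [mem_higherUnits_one_iff, ← hinv, ← sub_mul]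
    exact h.mul_right _
  have h3 : e ^ i * e ^ (j * (p - 2)) = 1 := by
    refine Subtype.ext (eq_one_of_pow_eq_one h1 ?_)
    have : (e ^ i * e ^ (j * (p - 2))) ^ (p - 1) = 1 := by
      rw [mul_pow, ← pow_mul, ← pow_mul, mul_comm i, mul_comm _ (p - 1), pow_mul, pow_mul, he,
        one_pow, one_pow, one_mul]
    simpa using congrArg Subtype.val this
  have h4 : e ^ i = e ^ j := by
    have h5 : e ^ i * e ^ (j * (p - 2)) * e ^ j = e ^ j := by rw [h3, one_mul]
    rwa [mul_assoc, mul_comm (e ^ (j * (p - 2))), hinv, mul_one] at h5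
  simpa [e] using congrArg Subtype.val h4

include hε hε' in
-- The embeddings over `ℚ(√p, √-p)` are exactly the `η^l` with `0 ≤ l < (p-1)/2`. They differ
-- because the `ε^(2l)` are distinct modulo `p`; there are no others because an embedding raises
-- `ν_p` to a power that is a square modulo `p`, hence some `ε^(2j)`.
theorem prod_conjugates_eq_norm (hlam : Continuous lam) (hlam' : lam ≠ 1) (hp2 : p ≠ 2)
    {η : charField lam ≃ₐ[ℚ] charField lam} (hη : η ∈ galH p lam) (hη' : Acts lam η (ε ^ 2))
    {u : charField lam} (hu : (u : ℂ) ∈ rootField p) :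
    ((∏ l ∈ Finset.range ((p - 1) / 2), (η ^ l) u : charField lam) : ℂ) =
      Algebra.norm (sqrtField p) (⟨(u : ℂ), hu⟩ : rootField p) := by
  have hp := Fact.mk (prime_residueChar F p)
  obtain ⟨t₀, ht, htp⟩ := exists_lam_pow_char_eq_one p hlam hlam'
  have := finiteDimensional_rootField hp.out.pos
  have hnorm := Algebra.norm_eq_prod_embeddings (sqrtField p) ℂ (⟨(u : ℂ), hu⟩ : rootField p)
  refine Eq.trans ?_ hnorm.symm
  refine (map_prod (charField lam).val _ _).trans ?_
  have hact : ∀ l : ℕ, (η ^ l) (lamE lam t₀) = lamE lam (ε ^ (2 * l) * t₀) := fun l => by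
    rw [pow_mul]; exact hη'.pow l t₀
  refine Finset.prod_bij
    (fun l _ => rootFieldEmbedding hlam hlam' hp2 (Subgroup.pow_mem _ hη l)) ?_ ?_ ?_ ?_
  · intros; exact Finset.mem_univ _
  · intro l hl m hm h
    have h1 := congrArg (fun f : rootField p →ₐ[sqrtField p] ℂ =>
      f ⟨lam t₀, lam_mem_rootField htp⟩) h
    rw [rootFieldEmbedding_apply hlam hlam' hp2 _ _ (lamE lam t₀) rfl,
      rootFieldEmbedding_apply hlam hlam' hp2 _ _ (lamE lam t₀) rfl, hact, hact, coe_lamE,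
      coe_lamE, Circle.coe_inj] at h1
    have h2 := dvd_sub_of_lam_mul_eq ht htp hlam (a := ⟨ε, hε⟩ ^ (2 * l)) (b := ⟨ε, hε⟩ ^ (2 * m))
      (by simpa using h1)
    have h3 := pow_eq_pow_of_dvd_sub hε hε' hp2 h2
    have h5 := two_mul_half_residueChar F hp2
    rw [Finset.mem_range] at hl hm
    have h4 := hε'.pow_inj (by omega) (by omega) h3
    omega
  · intro f _
    let ζ : rootField p := ⟨lam t₀, lam_mem_rootField htp⟩
    have hζp : ζ ^ p = 1 := Subtype.ext (by
      change (lam t₀ : ℂ) ^ p = 1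
      rw [← Circle.coe_pow, htp, Circle.coe_one])
    obtain ⟨k, -, hk⟩ := (isPrimitiveRoot_lam ht htp).eq_pow_of_pow_eq_one (ξ := f ζ)
      (by rw [← map_pow, hζp, map_one])
    have hkp : ¬ p ∣ k := by
      rintro ⟨c, rfl⟩
      have h1 : f ζ = f 1 := by
        rw [← hk, pow_mul, ← Circle.coe_pow, htp, Circle.coe_one, one_pow, map_one]
      have h2 := congrArg Subtype.val (f.toRingHom.injective h1)
      exact ht (Circle.coe_inj.mp (h2.trans Circle.coe_one.symm))
    obtain ⟨j, hj1, hjN, hj⟩ := exists_root_pow_of_ringHom ht htp hε hε' hp2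
      f.toRingHom (rootField p).val.toRingHom (ζ := ζ) rfl hkp hk.symm
      (fun x hx => f.commutes ⟨(x : ℂ), hx⟩)
    have h2 := two_mul_half_residueChar F hp2
    have hN := half_residueChar_pos F hp2
    have hper : ∀ m, ε ^ (2 * m) = ε ^ (2 * (m % ((p - 1) / 2))) := by
      intro m
      conv_lhs => rw [← Nat.mod_add_div m ((p - 1) / 2), mul_add, pow_add, ← mul_assoc,
        pow_mul _ (2 * ((p - 1) / 2)), h2, hε'.pow_eq_one, one_pow, mul_one]
    -- The exponent `j` lies in `1, …, N`, whereas the product runs over `0, …, N - 1`.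
    refine ⟨j % ((p - 1) / 2), Finset.mem_range.mpr (Nat.mod_lt _ hN), ?_⟩
    apply rootField_algHom_ext ht htp
    rw [rootFieldEmbedding_apply hlam hlam' hp2 _ _ (lamE lam t₀) rfl, hact, ← hper]
    change _ = f ζ
    rw [← hk, coe_lamE, ← Circle.coe_pow, Circle.coe_inj, ← AddChar.map_nsmul_eq_pow,
      nsmul_eq_mul]
    have := lam_mul_congr htp hlam hj
    simpa using this
  · intro l _
    rw [rootFieldEmbedding_apply hlam hlam' hp2 _ _ u rfl]
    rfl

end Norm
end WeilDescent

/-! ### Dilations and the Weil operators of diagonal elements -/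

namespace WeilDescent

open Filter Topology

section Dilation

variable {F : Type*} [Field F] [TopologicalSpace F]
  {V : Type*} [AddCommGroup V] [Module F V] {n : ℕ} (S : PolarizedSpace F V n)
  {E : Type*} [Field E]

theorem comp_smul_mem_schwartzX (t : Fˣ) {φ : S.X → E} (hφ : φ ∈ S.schwartzX E) :
    (fun x => φ (t⁻¹ • x)) ∈ S.schwartzX E := by
  let := moduleTopology F S.X
  have : IsModuleTopology F S.X := ⟨rfl⟩
  have : ContinuousSMul F S.X := IsModuleTopology.toContinuousSMul F S.X
  exact ⟨hφ.1.comp_continuous (Homeomorph.smul (α := S.X) t⁻¹).continuous,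
    hφ.2.comp_homeomorph (Homeomorph.smul (α := S.X) t⁻¹)⟩

variable (E) in
/-- The operator `φ ↦ φ (t⁻¹ ·)`. -/
def dil (t : Fˣ) : Module.End E (S.schwartzX E) where
  toFun φ := ⟨fun x => φ.1 (t⁻¹ • x), comp_smul_mem_schwartzX S t φ.2⟩
  map_add' _ _ := rfl
  map_smul' _ _ := rfl

theorem dil_apply (t : Fˣ) (φ : S.schwartzX E) (x : S.X) : (dil S E t φ).1 x = φ.1 (t⁻¹ • x) := rfl

theorem dil_one : dil S E 1 = 1 := by
  ext φ x
  simp [dil_apply]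

theorem dil_mul (s t : Fˣ) : dil S E (s * t) = dil S E s * dil S E t := by
  ext φ x
  simp only [Module.End.mul_apply, dil_apply, mul_inv_rev, mul_smul]

theorem dil_comm (s t : Fˣ) : dil S E s * dil S E t = dil S E t * dil S E s := by
  rw [← dil_mul, ← dil_mul, mul_comm]

theorem galConj_dil [Algebra ℚ E] (σ : E ≃ₐ[ℚ] E) (t : Fˣ) :
    S.galConj σ (dil S E t) = dil S E t := by
  ext φ x
  exact σ.apply_symm_apply _

theorem galConj_apply [Algebra ℚ E] (σ : E ≃ₐ[ℚ] E) (T : Module.End E (S.schwartzX E))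
    (φ : S.schwartzX E) : S.galConj σ T φ = S.galAct σ (T (S.galAct σ⁻¹ φ)) := rfl

theorem galAct_galAct [Algebra ℚ E] (σ τ : E ≃ₐ[ℚ] E) (φ : S.schwartzX E) :
    S.galAct σ (S.galAct τ φ) = S.galAct (σ * τ) φ := rfl

theorem galAct_one [Algebra ℚ E] (φ : S.schwartzX E) : S.galAct (1 : E ≃ₐ[ℚ] E) φ = φ := rfl

theorem galAct_add [Algebra ℚ E] (σ : E ≃ₐ[ℚ] E) (φ ψ : S.schwartzX E) :
    S.galAct σ (φ + ψ) = S.galAct σ φ + S.galAct σ ψ := by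
  ext x; exact map_add σ _ _

theorem galAct_smul [Algebra ℚ E] (σ : E ≃ₐ[ℚ] E) (c : E) (φ : S.schwartzX E) :
    S.galAct σ (c • φ) = σ c • S.galAct σ φ := by
  ext x; exact map_mul σ _ _

theorem galConj_one [Algebra ℚ E] (σ : E ≃ₐ[ℚ] E) :
    S.galConj σ (1 : Module.End E (S.schwartzX E)) = 1 := by
  ext φ x
  exact σ.apply_symm_apply _

theorem galConj_mul [Algebra ℚ E] (σ : E ≃ₐ[ℚ] E) (T U : Module.End E (S.schwartzX E)) :
    S.galConj σ (T * U) = S.galConj σ T * S.galConj σ U := by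
  ext φ x
  simp only [Module.End.mul_apply, galConj_apply, galAct_galAct, inv_mul_cancel, galAct_one]

theorem galConj_add [Algebra ℚ E] (σ : E ≃ₐ[ℚ] E) (T U : Module.End E (S.schwartzX E)) :
    S.galConj σ (T + U) = S.galConj σ T + S.galConj σ U := by
  ext φ x
  simp only [LinearMap.add_apply, galConj_apply, galAct_add]

theorem galConj_smul [Algebra ℚ E] (σ : E ≃ₐ[ℚ] E) (c : E) (T : Module.End E (S.schwartzX E)) :
    S.galConj σ (c • T) = σ c • S.galConj σ T := by
  ext φ x
  simp only [LinearMap.smul_apply, galConj_apply, galAct_smul]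

end Dilation

section Diagonal

variable {F : Type*} [Field F]
  {V : Type*} [AddCommGroup V] [Module F V] {n : ℕ} (S : PolarizedSpace F V n)

theorem prX_coe_X (x : S.X) : S.prX (x : V) = x := Submodule.projectionOnto_apply_left _ x
theorem prY_coe_Y (y : S.Y) : S.prY (y : V) = y := Submodule.projectionOnto_apply_left _ y
theorem prX_coe_Y (y : S.Y) : S.prX (y : V) = 0 := Submodule.projectionOnto_apply_right _ y
theorem prY_coe_X (x : S.X) : S.prY (x : V) = 0 := Submodule.projectionOnto_apply_right _ x

theorem blockA_gMap (t : F) (x : S.X) : S.blockA (S.gMap t) x = t⁻¹ • x := by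
  simp [PolarizedSpace.blockA, PolarizedSpace.gMap, prX_coe_X, prY_coe_X]
theorem blockB_gMap (t : F) : S.blockB (S.gMap t) = 0 := by
  ext x; simp [PolarizedSpace.blockB, PolarizedSpace.gMap, prX_coe_X, prY_coe_X]
theorem blockC_gMap (t : F) : S.blockC (S.gMap t) = 0 := by
  ext x; simp [PolarizedSpace.blockC, PolarizedSpace.gMap, prX_coe_Y, prY_coe_Y]
theorem blockD_gMap (t : F) : S.blockD (S.gMap t) = t • LinearMap.id := by
  ext x; simp [PolarizedSpace.blockD, PolarizedSpace.gMap, prX_coe_Y, prY_coe_Y]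

theorem tau_zero : S.tau 0 = LinearMap.id := by
  refine S.basisV.ext fun j => ?_
  rw [PolarizedSpace.tau, Module.Basis.constr_basis]
  rcases j with j | j <;> simp [PolarizedSpace.basisV]

theorem prX_add_prY (v : V) : (S.prX v : V) + S.prY v = v :=
  Submodule.projection_add_projection_eq_self S.isCompl v

/-- `g_t` as an automorphism of `V`. -/
noncomputable def gEquiv (t : Fˣ) : V ≃ₗ[F] V :=
  LinearEquiv.ofLinearMap (S.gMap t) (S.gMap (t⁻¹ : Fˣ))
    (by ext v; simp [PolarizedSpace.gMap, prX_coe_X, prX_coe_Y, prY_coe_X, prY_coe_Y, prX_add_prY])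
    (by ext v; simp [PolarizedSpace.gMap, prX_coe_X, prX_coe_Y, prY_coe_X, prY_coe_Y, prX_add_prY])

theorem form_gMap (t : Fˣ) (v w : V) : S.form (S.gMap t v) (S.gMap t w) = S.form v w := by
  conv_rhs => rw [← prX_add_prY S v, ← prX_add_prY S w]
  simp only [PolarizedSpace.gMap, LinearMap.add_apply, LinearMap.smul_apply, LinearMap.comp_apply,
    Submodule.subtype_apply, map_add, map_smul, smul_eq_mul,
    S.isotropic_X _ (S.prX v).2 _ (S.prX w).2, S.isotropic_Y _ (S.prY v).2 _ (S.prY w).2]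
  have : (t : F) ≠ 0 := t.ne_zero
  field_simp
  ring

theorem isParabolic_gEquiv (t : Fˣ) : S.IsParabolic (gEquiv S t) := by
  refine ⟨form_gMap S t, ?_⟩
  apply le_antisymm
  · rintro _ ⟨y, hy, rfl⟩
    change S.gMap t y ∈ S.Y
    have := congrArg ((↑) : S.X → V) (prX_coe_Y S ⟨y, hy⟩)
    simp only at this
    simp [PolarizedSpace.gMap, this]
  · intro y hy
    refine ⟨S.gMap (t⁻¹ : Fˣ) y, ?_, (gEquiv S t).apply_symm_apply y⟩
    have := congrArg ((↑) : S.X → V) (prX_coe_Y S ⟨y, hy⟩)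
    simp only at this
    simp [PolarizedSpace.gMap, this]

theorem isParabolic_one : S.IsParabolic (LinearEquiv.refl F V) :=
  ⟨fun _ _ => rfl, by ext; simp⟩

end Diagonal

section DiagonalWeil

variable {F : Type*} [Field F] [ValuativeRel F] [TopologicalSpace F] [IsNonarchimedeanLocalField F]
  {V : Type*} [AddCommGroup V] [Module F V] {n : ℕ} (S : PolarizedSpace F V n)

theorem normAbs_eq_one {s : F}
    (hs : valuation F s = 1) : normAbs s = 1 := by
  have h0 : s ≠ 0 := by rintro rfl; simp at hs
  rw [normAbs, if_neg h0, hs, map_one, WithZero.log_one, zpow_zero]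

variable [MeasurableSpace F]

/-- The integral formula determines the operator, since `E` embeds in `ℂ`; so one explicit solution
identifies the chosen one. -/
theorem weil_eq_of_forall {lam : AddChar F Circle} {g : V →ₗ[F] V}
    {T : Module.End (charField lam) (S.schwartzX (charField lam))}
    (h : ∀ (φ : S.schwartzX (charField lam)) (x : S.X), (((T φ).1 x : charField lam) : ℂ) =
      S.weilIntegral lam g (fun x' => ((φ.1 x' : charField lam) : ℂ)) x) : S.weil lam g = T := by
  have hex : ∃ T : Module.End (charField lam) (S.schwartzX (charField lam)),
      ∀ (φ : S.schwartzX (charField lam)) (x : S.X), (((T φ).1 x : charField lam) : ℂ) =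
        S.weilIntegral lam g (fun x' => ((φ.1 x' : charField lam) : ℂ)) x := ⟨T, h⟩
  rw [PolarizedSpace.weil, dif_pos hex]
  ext φ x
  rw [hex.choose_spec, h]

/-- As `c = 0`, the quotient `Y_g` is a point and `τ_0 = 1`. Whatever factorization is chosen, its
two factors compose to `g_t`, so the determinant is `t^n`, of absolute value one. -/
theorem weilMeasure_gMap (lam : AddChar F Circle) (t : Fˣ) (ht : valuation F (t : F) = 1) :
    IsProbabilityMeasure (S.weilMeasure lam (S.gMap t)) := by
  have hker : LinearMap.ker (S.blockC (S.gMap t)) = ⊤ := by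
    rw [blockC_gMap]; exact LinearMap.ker_zero
  have hsub : Subsingleton (S.quotY (S.gMap t)) := 
    Submodule.Quotient.subsingleton_iff.mpr hker
  have hfr : Module.finrank F (S.quotY (S.gMap t)) = 0 := Module.finrank_zero_of_subsingleton
  have hex : ∃ q : (V ≃ₗ[F] V) × (V ≃ₗ[F] V), S.IsParabolic q.1 ∧ S.IsParabolic q.2 ∧
      S.gMap t = (q.2 : V →ₗ[F] V) ∘ₗ S.tau (Module.finrank F (S.quotY (S.gMap t))) ∘ₗ
        (q.1 : V →ₗ[F] V) :=
    ⟨(gEquiv S t, LinearEquiv.refl F V), isParabolic_gEquiv S t, isParabolic_one S, by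
      rw [hfr, tau_zero]; rfl⟩
  rw [PolarizedSpace.weilMeasure, dif_pos hex]
  have hcomp : ((hex.choose.1 ≪≫ₗ hex.choose.2 : V ≃ₗ[F] V) : V →ₗ[F] V) = S.gMap t := by
    have := hex.choose_spec.2.2
    have h0 : S.tau (Module.finrank F (S.quotY (S.gMap t))) = LinearMap.id := by
      rw [hfr, tau_zero]
    refine (this.trans ?_).symm
    generalize hex.choose = q
    rw [h0, LinearMap.id_comp]
    rfl
  have hdet : normAbs (LinearMap.det (S.blockD (S.gMap t))) = 1 := by
    apply normAbs_eq_one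
    rw [blockD_gMap, LinearMap.det_smul, LinearMap.det_id, mul_one, map_pow, ht, one_pow]
  rw [hcomp, hdet, Real.one_rpow, ENNReal.ofReal_one, one_smul]
  have hempty : IsEmpty {j : Fin n // (j : ℕ) < Module.finrank F (S.quotY (S.gMap t))} :=
    ⟨fun j => by have := j.2; omega⟩
  have : IsProbabilityMeasure (Measure.pi
      (fun _ : {j : Fin n // (j : ℕ) < Module.finrank F (S.quotY (S.gMap t))} =>
        selfDualMeasure lam)) := by
    rw [Measure.pi_of_empty]; infer_instance
  exact Measure.isProbabilityMeasure_map (Measurable.of_discrete.aemeasurable)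

theorem weil_gMap (lam : AddChar F Circle) (t : Fˣ) (ht : valuation F (t : F) = 1) :
    S.weil lam (S.gMap t) = dil S (charField lam) t := by
  refine weil_eq_of_forall S fun φ x => ?_
  have := weilMeasure_gMap S lam t ht
  have h : ∀ y, S.weilIntegrand lam (S.gMap t) (fun x' => ((φ.1 x' : charField lam) : ℂ)) x y =
      ((φ.1 (t⁻¹ • x) : charField lam) : ℂ) := by
    intro y
    simp [PolarizedSpace.weilIntegrand, blockB_gMap, blockC_gMap, blockA_gMap, Units.smul_def]
  rw [PolarizedSpace.weilIntegral]
  simp only [h, integral_const, probReal_univ, one_smul]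
  rfl

end DiagonalWeil
end WeilDescent

/-! ### The corrected dilations and their cocycle relation -/

namespace WeilDescent

open Filter Topology PolarizedSpace

section EvenOdd

variable {E M : Type*} [Field E] [CharZero E] [AddCommGroup M] [Module E M] {w : Module.End E M}

theorem evenOdd_one : evenOdd w (1 : E) = 1 := by
  rw [evenOdd, one_smul, ← smul_add]
  have : (1 + w + (1 - w) : Module.End E M) = (2 : E) • 1 := by
    rw [two_smul]; abel
  rw [this, smul_smul]; norm_num

theorem evenOdd_mul_self_of_involution (hw : w * w = 1) (c : E) :
    evenOdd w c * w = evenOdd w (-c) := by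
  simp only [evenOdd, add_mul, smul_mul_assoc, one_mul, hw, sub_mul]
  rw [neg_smul, ← smul_neg, ← smul_neg, neg_sub, add_comm w]

theorem evenOdd_mul (hw : w * w = 1) (c d : E) :
    evenOdd w c * evenOdd w d = evenOdd w (c * d) := by
  have h : ∀ v : Module.End E M, evenOdd w c * v = (1 / 2 : E) • (v + w * v) +
      c • ((1 / 2 : E) • (v - w * v)) := fun v => by
    simp only [evenOdd, add_mul, smul_mul_assoc, one_mul, sub_mul]
  rw [h]
  simp only [evenOdd, mul_add, mul_sub, mul_smul_comm, mul_one, hw]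
  match_scalars <;> ring

theorem commute_evenOdd {v : Module.End E M} (h : Commute w v) (c : E) :
    Commute (evenOdd w c) v := by
  refine Commute.add_left (Commute.smul_left ?_ _) (Commute.smul_left (Commute.smul_left ?_ _) _)
  · exact (Commute.one_left v).add_left h
  · exact (Commute.one_left v).sub_left h

theorem isUnit_evenOdd (hw : w * w = 1) {c : E} (hc : c ≠ 0) : IsUnit (evenOdd w c) :=
  ⟨⟨evenOdd w c, evenOdd w c⁻¹, by rw [evenOdd_mul hw, mul_inv_cancel₀ hc, evenOdd_one],
    by rw [evenOdd_mul hw, inv_mul_cancel₀ hc, evenOdd_one]⟩, rfl⟩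

omit [CharZero E] in
-- Only sums and scalar multiples appear on the right, so Galois conjugation can be applied term by
-- term.
theorem evenOdd_eq (c : E) :
    evenOdd w c = (1 / 2 : E) • (1 + w) + c • ((1 / 2 : E) • (1 + (-1 : E) • w)) := by
  rw [evenOdd, sub_eq_add_neg, neg_one_smul]

end EvenOdd

section Cocycle

variable {F : Type*} [Field F] [ValuativeRel F] [TopologicalSpace F] [IsNonarchimedeanLocalField F]
  {V : Type*} [AddCommGroup V] [Module F V] {n : ℕ} (S : PolarizedSpace F V n)

theorem dil_neg_one_mul_self {E : Type*} [Field E] : dil S E (-1) * dil S E (-1) = 1 := by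
  rw [← dil_mul, neg_one_mul, neg_neg, dil_one]

theorem commute_dil {E : Type*} [Field E] (s t : Fˣ) : Commute (dil S E s) (dil S E t) :=
  dil_comm S s t

theorem isUnit_dil {E : Type*} [Field E] (t : Fˣ) : IsUnit (dil S E t) :=
  ⟨⟨dil S E t, dil S E t⁻¹, by rw [← dil_mul, mul_inv_cancel, dil_one],
    by rw [← dil_mul, inv_mul_cancel, dil_one]⟩, rfl⟩

theorem galConj_evenOdd {E : Type*} [Field E] [Algebra ℚ E] (σ : E ≃ₐ[ℚ] E) {t : Fˣ} (c : E) :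
    S.galConj σ (evenOdd (dil S E t) c) = evenOdd (dil S E t) (σ c) := by
  rw [evenOdd_eq, evenOdd_eq]
  simp only [galConj_add, galConj_smul, galConj_one, galConj_dil, map_neg, map_div₀, map_one,
    map_ofNat]

/-- The operator `(ρ_e + (∏_{l < m} η^l(u)) ρ_o) W(g_t)`. -/
noncomputable def cocycleOperator {E : Type*} [Field E] [Algebra ℚ E] (η : E ≃ₐ[ℚ] E) (u : E)
    (m : ℕ) (t : Fˣ) : Module.End E (S.schwartzX E) :=
  evenOdd (dil S E (-1)) (∏ l ∈ Finset.range m, (η ^ l) u) * dil S E t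

variable {E : Type*} [Field E] [Algebra ℚ E] {η : E ≃ₐ[ℚ] E} {u : E}

theorem prod_range_add_conjugates (m k : ℕ) :
    ∏ l ∈ Finset.range (m + k), (η ^ l) u =
      (∏ l ∈ Finset.range m, (η ^ l) u) * (η ^ m) (∏ l ∈ Finset.range k, (η ^ l) u) := by
  rw [Finset.prod_range_add, map_prod]
  simp only [pow_add]
  rfl

/-- Two signs on the odd part cancel: lengthening the product by a full period contributes `η^m(-1)
= -1`, and the dilation by `-1` acts on odd functions as `-1`. -/
theorem cocycleOperator_add [CharZero E] {N : ℕ} (hN : ∏ l ∈ Finset.range N, (η ^ l) u = -1)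
    (m : ℕ) (t : Fˣ) : cocycleOperator S η u (m + N) (-t) = cocycleOperator S η u m t := by
  rw [cocycleOperator, prod_range_add_conjugates, hN, map_neg, map_one, mul_neg_one,
    ← evenOdd_mul_self_of_involution (dil_neg_one_mul_self S), mul_assoc, ← dil_mul,
    neg_one_mul, neg_neg]
  rfl

theorem cocycleOperator_congr [CharZero E] {N : ℕ} (hN : ∏ l ∈ Finset.range N, (η ^ l) u = -1)
    {ε : Fˣ} (hε : ε ^ N = -1) {m m' : ℕ} (h : m ≡ m' [MOD N]) (t : Fˣ) :
    cocycleOperator S η u m (ε ^ m * t) = cocycleOperator S η u m' (ε ^ m' * t) := by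
  have key : ∀ m k, cocycleOperator S η u (m + N * k) (ε ^ (m + N * k) * t) =
      cocycleOperator S η u m (ε ^ m * t) := by
    intro m k
    induction k with
    | zero => simp
    | succ k ih =>
      rw [← ih, ← cocycleOperator_add S hN (m + N * k)]
      rw [mul_add, ← add_assoc, mul_one, pow_add _ (m + N * k), hε]
      simp
  rw [← Nat.mod_add_div m N, ← Nat.mod_add_div m' N, key, key, h]

theorem isUnit_cocycleOperator [CharZero E] (hu : u ≠ 0) (m : ℕ) (t : Fˣ) :
    IsUnit (cocycleOperator S η u m t) := by
  refine (isUnit_evenOdd (dil_neg_one_mul_self S) ?_).mul (isUnit_dil S t)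
  exact Finset.prod_ne_zero_iff.mpr fun l _ => (map_ne_zero _).mpr hu

/-- Since `σ` acts on the conjugates of `u` as `η^m`, it moves the product over `l < k` to the
product over `m ≤ l < m + k`, which continues the one over `l < m`. Dilations are fixed by Galois
conjugation and commute with the parity projections. -/
theorem cocycleOperator_mul [CharZero E] (σ : E ≃ₐ[ℚ] E) (m k : ℕ) (s t : Fˣ)
    (h : ∀ l, σ ((η ^ l) u) = (η ^ m) ((η ^ l) u)) :
    cocycleOperator S η u (m + k) (s * t) =
      cocycleOperator S η u m s * S.galConj σ (cocycleOperator S η u k t) := by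
  have h1 : σ (∏ l ∈ Finset.range k, (η ^ l) u) = (η ^ m) (∏ l ∈ Finset.range k, (η ^ l) u) := by
    rw [map_prod, map_prod]; exact Finset.prod_congr rfl fun l _ => h l
  simp only [cocycleOperator]
  rw [galConj_mul, galConj_dil, galConj_evenOdd, h1, prod_range_add_conjugates,
    ← evenOdd_mul (dil_neg_one_mul_self S), dil_mul, mul_assoc, mul_assoc]
  congr 1
  rw [← mul_assoc, ← mul_assoc, (commute_evenOdd (commute_dil S (-1) s) _).eq]

end Cocycle

section Delta

variable {F : Type*} [Field F] [ValuativeRel F] [TopologicalSpace F] [IsNonarchimedeanLocalField F]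
  [MeasurableSpace F] {V : Type*} [AddCommGroup V] [Module F V] {n : ℕ}
  (S : PolarizedSpace F V n) {p : ℕ} [CharP 𝓀[F] p] {lam : AddChar F Circle}
  {ε : Fˣ} {η : charField lam ≃ₐ[ℚ] charField lam} {u : charField lam}

theorem valuation_root_eq_one (hp2 : p ≠ 2) {ε : F} (hε' : IsPrimitiveRoot ε (p - 1)) :
    valuation F ε = 1 := by
  have h2 := two_mul_half_residueChar F hp2
  have hN := half_residueChar_pos F hp2
  have := congrArg (valuation F) hε'.pow_eq_one
  rw [map_pow, map_one] at this
  rcases pow_eq_one_iff.mp this with h | h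
  · exact h
  · omega

theorem root_mul_sq_mem (hε : (ε : F) ∈ primeClosure F) {s : F} (hs : s ∈ higherUnits F p 1)
    (i : ℕ) : (ε : F) ^ (2 * i) * s ^ 2 ∈ primeSubring F :=
  mul_mem (pow_mem (mem_primeSubring.mpr hε) _) (pow_mem (higherUnits_subset hs) _)

/-- Removes the normalization `1 ≤ i ≤ (p-1)/2`: any exponent `m` with the right action may be used,
because the chosen pair has the same `s` and an exponent congruent to `m`. The cocycle relation
needs this for sums of exponents. -/
theorem delta_eq_cocycleOperator (hlam : Continuous lam) (hlam' : lam ≠ 1) (hp2 : p ≠ 2)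
    (hε : (ε : F) ∈ primeClosure F) (hε' : IsPrimitiveRoot (ε : F) (p - 1))
    (hN : ∏ l ∈ Finset.range ((p - 1) / 2), (η ^ l) u = -1)
    {σ : charField lam ≃ₐ[ℚ] charField lam} {m : ℕ} {s : Fˣ}
    (hs : (s : F) ∈ higherUnits F p 1) (hσ : Acts lam σ ((ε : F) ^ (2 * m) * (s : F) ^ 2)) :
    S.delta p (ε : F) η u σ = cocycleOperator S η u m (ε ^ m * s) := by
  have hNpos := half_residueChar_pos F hp2
  have h2 := two_mul_half_residueChar F hp2
  have hεN : ε ^ ((p - 1) / 2) = -1 := Units.ext (by simpa using root_pow_half hp2 hε')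
  have hεu : ε ^ (p - 1) = 1 := Units.ext (by simpa using hε'.pow_eq_one)
  have hex : ∃ k : ℕ × F, 1 ≤ k.1 ∧ k.1 ≤ (p - 1) / 2 ∧ k.2 ∈ principalUnits F p ∧
      RestrictsTo p lam σ ((ε : F) ^ (2 * k.1) * k.2 ^ 2) := by
    obtain ⟨k, hk1, hk2, hk⟩ : ∃ k, 1 ≤ k ∧ k ≤ (p - 1) / 2 ∧ k ≡ m [MOD (p - 1) / 2] := by
      by_cases h0 : m % ((p - 1) / 2) = 0
      · exact ⟨_, hNpos, le_rfl, by rw [Nat.ModEq, h0, Nat.mod_self]⟩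
      · exact ⟨_, Nat.pos_of_ne_zero h0, (Nat.mod_lt _ hNpos).le, Nat.mod_modEq _ _⟩
    refine ⟨(k, s), hk1, hk2, mem_principalUnits_iff.mpr hs, ?_⟩
    rw [← acts_iff_restrictsTo p hlam (root_mul_sq_mem hε hs k)]
    have h3 : ε ^ (2 * k) = ε ^ (2 * m) := by
      have : 2 * k ≡ 2 * m [MOD (p - 1)] := by rw [← h2]; exact hk.mul_left' 2
      rw [pow_eq_pow_iff_modEq]
      exact this.of_dvd (orderOf_dvd_of_pow_eq_one hεu)
    have h4 : (ε : F) ^ (2 * k) = (ε : F) ^ (2 * m) := by exact_mod_cast h3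
    change Acts lam σ ((ε : F) ^ (2 * k) * (s : F) ^ 2)
    rwa [h4]
  rw [delta, dif_pos hex]
  obtain ⟨-, -, hc1, hc2⟩ := hex.choose_spec
  generalize hex.choose = k at hc1 hc2
  rw [mem_principalUnits_iff] at hc1
  rw [← acts_iff_restrictsTo p hlam (root_mul_sq_mem hε hc1 k.1)] at hc2
  obtain ⟨hks, hkm⟩ := pow_eq_of_mul_sq_eq hp2 hε' hc1 hs (hc2.unique hlam' hσ)
  rw [← cocycleOperator_congr S hN hεN hkm, cocycleOperator, correction, hks]
  have h1 := weil_gMap S lam (-1) (by simp)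
  have h3 := weil_gMap S lam (ε ^ k.1 * s) (by
    simp [valuation_root_eq_one hp2 hε', valuation_eq_one_of_mem_higherUnits hs])
  simp only [Units.val_neg, Units.val_one, Units.val_mul, Units.val_pow_eq_pow_val] at h1 h3
  rw [h1, h3]

/-- An element of `Gal(E / ℚ(√p, √-p))` with parameters `(m, s)` agrees with `η ^ m` on the
conjugates of elements of `ℚ(ν_p, √-1)`. -/
theorem apply_conjugate_eq (hlam : Continuous lam) (hlam' : lam ≠ 1) (hp2 : p ≠ 2)
    (hε : (ε : F) ∈ primeClosure F) (hη : η ∈ galH p lam) (hη' : Acts lam η ((ε : F) ^ 2))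
    {σ : charField lam ≃ₐ[ℚ] charField lam} (hσH : σ ∈ galH p lam) {m : ℕ} {s : F}
    (hs : s ∈ higherUnits F p 1) (hσ : Acts lam σ ((ε : F) ^ (2 * m) * s ^ 2))
    (hu : (u : ℂ) ∈ rootField p) (l : ℕ) : σ ((η ^ l) u) = (η ^ m) ((η ^ l) u) := by
  obtain ⟨t₀, ht, htp⟩ := exists_lam_pow_char_eq_one p hlam hlam'
  refine eqOn_rootField ht htp hlam hlam' hp2 (σ := σ * η ^ l) (τ := η ^ m * η ^ l)
    (mul_mem hσH (pow_mem hη l)) (mul_mem (pow_mem hη m) (pow_mem hη l)) ?_ hu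
  rw [hσ.mul (hη'.pow l), (hη'.pow m).mul (hη'.pow l), lamE_inj]
  -- The factor `s²` is congruent to `1` modulo `p`, so it does not affect `p`-th roots of unity.
  have hs2 := mul_mem_higherUnits hs hs
  have hs3 := mem_higherUnits_one_iff (p := p) (s := ⟨s * s, higherUnits_subset hs2⟩) |>.mp hs2
  have := lam_mul_congr htp hlam (hs3.mul_left (⟨ε, hε⟩ ^ (2 * m) * ⟨ε, hε⟩ ^ (2 * l)) |> (by
    rwa [mul_sub, mul_one] at ·))
  simp only [Subring.coe_mul, SubmonoidClass.coe_pow] at this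
  rw [← pow_mul, ← pow_mul, ← this]
  congr 2
  ring

end Delta
end WeilDescent

/-! ### Volumes for the self-dual measure -/

namespace WeilDescent

open Filter Topology

section Commensurable

variable {G : Type*} [AddCommGroup G] [TopologicalSpace G] [IsTopologicalAddGroup G]
  [MeasurableSpace G] [BorelSpace G] (ν : Measure G) [ν.IsAddLeftInvariant]
  {K : AddSubgroup G}

theorem finite_image_mk (hK : IsOpen (K : Set G)) {C : Set G} (hC : IsCompact C) :
    ((QuotientAddGroup.mk : G → G ⧸ K) '' C).Finite := by
  have := QuotientAddGroup.discreteTopology hK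
  exact isCompact_iff_finite.mp (hC.image QuotientAddGroup.continuous_mk)

theorem measure_eq_ncard_mul (hK : IsOpen (K : Set G)) {C : Set G} (hC : IsCompact C)
    (h : ∀ c ∈ C, ∀ k ∈ K, c + k ∈ C) :
    ν C = ((QuotientAddGroup.mk : G → G ⧸ K) '' C).ncard * ν K := by
  have hfin := finite_image_mk hK hC
  have hmk : ∀ a : G, (QuotientAddGroup.mk : G → G ⧸ K) ⁻¹' {(a : G ⧸ K)} =
      (fun x => -a + x) ⁻¹' (K : Set G) := by
    intro a; ext x
    rw [Set.mem_preimage, Set.mem_singleton_iff, eq_comm, QuotientAddGroup.eq]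
    rfl
  have hfib : ∀ q : G ⧸ K, MeasurableSet ((QuotientAddGroup.mk : G → G ⧸ K) ⁻¹' {q}) ∧
      ν ((QuotientAddGroup.mk : G → G ⧸ K) ⁻¹' {q}) = ν K := by
    intro q
    obtain ⟨a, rfl⟩ := QuotientAddGroup.mk_surjective q
    rw [hmk]
    exact ⟨(hK.preimage (continuous_const.add continuous_id)).measurableSet,
      measure_preimage_add ν (-a) K⟩
  have hun : C = ⋃ q ∈ hfin.toFinset, (QuotientAddGroup.mk : G → G ⧸ K) ⁻¹' {q} := by
    ext x
    simp only [Set.Finite.mem_toFinset, Set.mem_iUnion, Set.mem_preimage, Set.mem_singleton_iff,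
      exists_prop]
    constructor
    · exact fun hx => ⟨x, Set.mem_image_of_mem _ hx, rfl⟩
    · rintro ⟨_, ⟨c, hc, rfl⟩, hq⟩
      rw [eq_comm, QuotientAddGroup.eq] at hq
      have := h c hc _ hq
      simpa using this
  have hsum := measure_biUnion_finset (μ := ν) (s := hfin.toFinset)
    (f := fun q => (QuotientAddGroup.mk : G → G ⧸ K) ⁻¹' {q})
    (fun q _ r _ hqr => Disjoint.preimage _ (Set.disjoint_singleton.mpr hqr))
    (fun q _ => (hfib q).1)
  conv_lhs => rw [hun]
  rw [hsum, Finset.sum_congr rfl fun q _ => (hfib q).2, Finset.sum_const, nsmul_eq_mul,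
    Set.ncard_eq_toFinset_card _ hfin]

/-- In a compact open subgroup on which multiplication by `p ^ m` tends to zero, the indices of
open subgroups are powers of `p`. -/
theorem exists_measure_eq_pow_mul {p : ℕ} [Fact p.Prime] {U : AddSubgroup G}
    (hU : IsCompact (U : Set G)) (hK : IsOpen (K : Set G)) (hKU : K ≤ U)
    (h : ∃ m : ℕ, ∀ x ∈ U, p ^ m • x ∈ K) : ∃ a : ℕ, ν U = (p ^ a : ℕ) * ν K := by
  rw [measure_eq_ncard_mul ν hK hU fun c hc k hk => U.add_mem hc (hKU hk)]
  let T : AddSubgroup (G ⧸ K) := U.map (QuotientAddGroup.mk' K)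
  have hT : (T : Set (G ⧸ K)) = (QuotientAddGroup.mk : G → G ⧸ K) '' U := rfl
  have : Finite T := by
    have := finite_image_mk hK hU
    rw [← hT] at this
    exact this.to_subtype
  obtain ⟨m, hm⟩ := h
  have hp : IsPGroup p (Multiplicative T) := by
    intro g
    refine ⟨m, ?_⟩
    obtain ⟨⟨_, x, hx, rfl⟩, rfl⟩ := Multiplicative.ofAdd.surjective g
    rw [← ofAdd_nsmul]
    refine congrArg Multiplicative.ofAdd (Subtype.ext ?_)
    change p ^ m • (QuotientAddGroup.mk x : G ⧸ K) = 0
    rw [← QuotientAddGroup.mk_nsmul, QuotientAddGroup.eq_zero_iff]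
    exact hm x hx
  obtain ⟨a, ha⟩ := IsPGroup.iff_card.mp hp
  refine ⟨a, ?_⟩
  rw [← hT, ← ha]
  congr 2

end Commensurable

section SelfDual

variable {F : Type*} [Field F] [ValuativeRel F] [TopologicalSpace F] [IsNonarchimedeanLocalField F]
  {lam : AddChar F Circle}

variable (lam) in
/-- The annihilator of the ring of integers. -/
def integerAnnihilator : AddSubgroup F where
  carrier := {s | ∀ r ∈ integerAddSubgroup F, lam (s * r) = 1}
  add_mem' ha hb r hr := by rw [add_mul, AddChar.map_add_eq_mul, ha r hr, hb r hr, one_mul]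
  zero_mem' r _ := by simp
  neg_mem' ha r hr := by rw [neg_mul, AddChar.map_neg_eq_inv, ha r hr, inv_one]

theorem mem_integerAnnihilator {s : F} :
    s ∈ integerAnnihilator lam ↔ ∀ r ∈ integerAddSubgroup F, lam (s * r) = 1 := Iff.rfl

/-- If `|s| > |c|`, then `s⁻¹c` is an integer and `λ(c) = λ(s · s⁻¹c) = 1`. This bound gives
compactness of the annihilator. -/
theorem valuation_le_of_mem_integerAnnihilator {c : F} (hc : lam c ≠ 1) {s : F}
    (hs : s ∈ integerAnnihilator lam) : valuation F s ≤ valuation F c := by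
  by_contra! hlt
  have hs0 : s ≠ 0 := by rintro rfl; simp at hlt
  refine hc ?_
  have := hs (s⁻¹ * c) (by
    rw [mem_integerAddSubgroup, map_mul, map_inv₀]
    have h0 : 0 < valuation F s := by simpa [zero_lt_iff] using hs0
    rw [inv_mul_le_iff₀ h0, mul_one]
    exact hlt.le)
  rwa [mul_inv_cancel_left₀ hs0] at this

theorem isOpen_integerAnnihilator (hlam : Continuous lam) :
    IsOpen (integerAnnihilator lam : Set F) := by
  obtain ⟨K, hK, h1, hO⟩ := exists_openAddSubgroup_trivial hlam
  refine AddSubgroup.isOpen_of_mem_nhds _ (g := 0) ?_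
  refine mem_of_superset (hK.mem_nhds K.zero_mem) fun s hs r hr => ?_
  rw [mul_comm]
  exact h1 _ (hO s hs r hr)

theorem isCompact_integerAnnihilator (hlam : Continuous lam) (hlam' : lam ≠ 1) :
    IsCompact (integerAnnihilator lam : Set F) := by
  obtain ⟨c, hc⟩ := exists_lam_ne_one hlam'
  have hcl : IsClosed (integerAnnihilator lam : Set F) :=
    AddSubgroup.isClosed_of_isOpen _ (isOpen_integerAnnihilator hlam)
  refine (IsNonarchimedeanLocalField.isCompact_closedBall F (valuation F c)).of_isClosed_subset
    hcl fun s hs => ?_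
  exact valuation_le_of_mem_integerAnnihilator hc hs

variable [MeasurableSpace F] [BorelSpace F]

/-- Orthogonality of characters: off the annihilator, translation by an integer `r₀` with `λ(s r₀) ≠
1` multiplies the integral by that value. -/
theorem integral_lam_mul_indicator (μ : Measure F) [μ.IsAddLeftInvariant] (s : F) :
    ∫ r, (lam (s * r) : ℂ) * (integerAddSubgroup F : Set F).indicator 1 r ∂μ =
      (integerAnnihilator lam : Set F).indicator
        (fun _ => (μ.real (integerAddSubgroup F : Set F) : ℂ)) s := by
  by_cases hs : s ∈ integerAnnihilator lam
  · rw [Set.indicator_of_mem (show s ∈ (integerAnnihilator lam : Set F) from hs)]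
    have : (fun r => (lam (s * r) : ℂ) * (integerAddSubgroup F : Set F).indicator 1 r) =
        (integerAddSubgroup F : Set F).indicator fun _ => (1 : ℂ) := by
      ext r
      by_cases hr : r ∈ (integerAddSubgroup F : Set F)
      · rw [Set.indicator_of_mem hr, Set.indicator_of_mem hr, hs r hr]; simp
      · rw [Set.indicator_of_notMem hr, Set.indicator_of_notMem hr, mul_zero]
    rw [this, integral_indicator_const _ (isOpen_integer F).measurableSet]
    simp
  · rw [Set.indicator_of_notMem (show s ∉ (integerAnnihilator lam : Set F) from hs)]
    rw [mem_integerAnnihilator] at hs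
    push Not at hs
    obtain ⟨r₀, hr₀, h1⟩ := hs
    set f : F → ℂ := fun r => (lam (s * r) : ℂ) * (integerAddSubgroup F : Set F).indicator 1 r
      with hf
    have h2 : ∀ r, f (r₀ + r) = (lam (s * r₀) : ℂ) * f r := by
      intro r
      have h3 : (integerAddSubgroup F : Set F).indicator (1 : F → ℂ) (r₀ + r) =
          (integerAddSubgroup F : Set F).indicator (1 : F → ℂ) r := by
        by_cases hr : r ∈ integerAddSubgroup F
        · rw [Set.indicator_of_mem (show r ∈ (integerAddSubgroup F : Set F) from hr),
            Set.indicator_of_mem (show r₀ + r ∈ (integerAddSubgroup F : Set F) from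
              AddSubgroup.add_mem _ hr₀ hr)]
          rfl
        · rw [Set.indicator_of_notMem (show r ∉ (integerAddSubgroup F : Set F) from hr),
            Set.indicator_of_notMem (show r₀ + r ∉ (integerAddSubgroup F : Set F) from
              fun h => hr ((AddSubgroup.add_mem_cancel_left _ hr₀).mp h))]
      simp only [hf]
      rw [h3, mul_add, AddChar.map_add_eq_mul, Circle.coe_mul]
      ring
    have h3 : ∫ r, f r ∂μ = (lam (s * r₀) : ℂ) * ∫ r, f r ∂μ := by
      rw [← integral_const_mul, ← integral_add_left_eq_self f r₀]
      simp only [h2]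
    have h4 : (1 - (lam (s * r₀) : ℂ)) * ∫ r, f r ∂μ = 0 := by rw [sub_mul, one_mul, ← h3, sub_self]
    refine (mul_eq_zero.mp h4).resolve_left (sub_ne_zero.mpr fun h => h1 ?_)
    rw [← Circle.coe_inj, ← h, Circle.coe_one]

theorem indicator_integer_mem_schwartz :
    (integerAddSubgroup F : Set F).indicator (1 : F → ℂ) ∈ schwartz F ℂ := by
  have := t2Space_of_localField F
  have hcl := (isCompact_integer F).isClosed
  constructor
  · refine (IsLocallyConstant.iff_exists_open _).mpr fun x => ?_
    by_cases hx : x ∈ (integerAddSubgroup F : Set F)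
    · refine ⟨_, isOpen_integer F, hx, fun y hy => ?_⟩
      rw [Set.indicator_of_mem hx, Set.indicator_of_mem hy]
      rfl
    · refine ⟨_, hcl.isOpen_compl, hx, fun y hy => ?_⟩
      rw [Set.indicator_of_notMem hx, Set.indicator_of_notMem hy]
  · exact HasCompactSupport.intro (isCompact_integer F) fun x hx => Set.indicator_of_notMem hx _

/-- Fourier inversion at `0` for the indicator function of the integers. -/
theorem measureReal_integer_mul_annihilator {μ : Measure F} (hμ : IsSelfDual lam μ) (hlam : Continuous lam) :
    μ.real (integerAddSubgroup F : Set F) * μ.real (integerAnnihilator lam : Set F) = 1 := by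
  have := hμ.1
  have h := hμ.2 _ indicator_integer_mem_schwartz 0
  simp only [zero_mul, AddChar.map_zero_eq_one, Circle.coe_one, one_mul, neg_zero,
    integral_lam_mul_indicator] at h
  rw [integral_indicator_const _ (isOpen_integerAnnihilator hlam).measurableSet,
    Set.indicator_of_mem (show (0 : F) ∈ (integerAddSubgroup F : Set F) from
      AddSubgroup.zero_mem _)] at h
  simp only [Complex.real_smul, Pi.one_apply] at h
  rw [mul_comm]
  exact_mod_cast h

/-- The integers and their annihilator both have `p`-power index over their intersection, say `p^a`
and `p^b`, and their volumes multiply to `1`. Hence the volume of the integers has square `p^(a-b)`.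
-/
theorem measureReal_integer_mem_sqrtField {μ : Measure F} (hμ : IsSelfDual lam μ)
    (hlam : Continuous lam) (hlam' : lam ≠ 1) (p : ℕ) [CharP 𝓀[F] p] :
    ((μ.real (integerAddSubgroup F : Set F) : ℝ) : ℂ) ∈ sqrtField p := by
  have hp := Fact.mk (prime_residueChar F p)
  have := hμ.1
  set O := integerAddSubgroup F
  set D := integerAnnihilator lam
  have hOopen := isOpen_integer F
  have hDopen := isOpen_integerAnnihilator hlam
  have hDcomp := isCompact_integerAnnihilator hlam hlam'
  have hKopen : IsOpen ((O ⊓ D : AddSubgroup F) : Set F) := hOopen.inter hDopen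
  have hkill : ∀ c : F, ∃ m : ℕ, ∀ x : F, valuation F x ≤ valuation F c →
      p ^ m • x ∈ O ⊓ D := by
    intro c
    have hU : (fun x => c * x) ⁻¹' ((O ⊓ D : AddSubgroup F) : Set F) ∈ 𝓝 (0 : F) :=
      (hKopen.preimage (continuous_const_mul c)).mem_nhds (by simp)
    obtain ⟨m, hm⟩ := exists_pow_mul_mem p hU
    refine ⟨m, fun x hx => ?_⟩
    by_cases hc : c = 0
    · have : x = 0 := by simpa [hc] using hx
      rw [this, smul_zero]; exact AddSubgroup.zero_mem _
    · have h1 := hm m le_rfl (c⁻¹ * x) (by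
        have h0 : 0 < valuation F c := by simpa [zero_lt_iff] using hc
        rw [map_mul, map_inv₀, inv_mul_le_iff₀ h0, mul_one]; exact hx)
      change c * _ ∈ O ⊓ D at h1
      have h2 : c * ((p : F) ^ m * (c⁻¹ * x)) = p ^ m • x := by
        rw [nsmul_eq_mul]; push_cast; field_simp
      rwa [h2] at h1
  obtain ⟨a, ha⟩ := exists_measure_eq_pow_mul (p := p) μ (isCompact_integer F) hKopen inf_le_left (by
    obtain ⟨m, hm⟩ := hkill 1
    exact ⟨m, fun x hx => hm x (by rw [map_one]; exact hx)⟩)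
  obtain ⟨b, hb⟩ := exists_measure_eq_pow_mul (p := p) μ hDcomp hKopen inf_le_right (by
    obtain ⟨c, hc⟩ := exists_lam_ne_one hlam'
    obtain ⟨m, hm⟩ := hkill c
    exact ⟨m, fun x hx => hm x (valuation_le_of_mem_integerAnnihilator hc hx)⟩)
  have ha' : μ.real O = p ^ a * μ.real (O ⊓ D : AddSubgroup F) := by
    rw [Measure.real, ha, ENNReal.toReal_mul, ENNReal.toReal_natCast, Nat.cast_pow]; rfl
  have hb' : μ.real D = p ^ b * μ.real (O ⊓ D : AddSubgroup F) := by
    rw [Measure.real, hb, ENNReal.toReal_mul, ENNReal.toReal_natCast, Nat.cast_pow]; rfl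
  have hmul := measureReal_integer_mul_annihilator hμ hlam
  have hpos : (0 : ℝ) < p := Nat.cast_pos.mpr hp.out.pos
  have hval : μ.real O = Real.sqrt p ^ (a + b) / p ^ b := by
    rw [eq_div_iff (by positivity)]
    refine (pow_left_inj₀ (by positivity) (by positivity) two_ne_zero).mp ?_
    rw [← pow_mul, mul_comm (a + b), pow_mul, Real.sq_sqrt hpos.le]
    calc (μ.real O * p ^ b) ^ 2 = (μ.real O * μ.real D) * p ^ (a + b) := by
          rw [ha', hb', pow_add]; ring
      _ = p ^ (a + b) := by rw [hmul, one_mul]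
  rw [hval]
  push_cast
  exact div_mem (pow_mem (sqrt_mem_sqrtField p) _) (pow_mem (natCast_mem _ _) _)

/-- Multiplication by a unit preserves invariant measures. -/
theorem measurePreserving_unit_mul (μ : Measure F) [μ.IsAddHaarMeasure] {t : F}
    (ht : valuation F t = 1) : MeasurePreserving (fun x => t * x) μ μ := by
  have := secondCountable_of_localField F
  have ht0 : t ≠ 0 := by rintro rfl; simp at ht
  let e : F ≃ₜ+ F :=
    { toFun := fun x => t * x
      invFun := fun x => t⁻¹ * x
      left_inv := inv_mul_cancel_left₀ ht0
      right_inv := mul_inv_cancel_left₀ ht0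
      map_add' := mul_add t
      continuous_toFun := continuous_const_mul t
      continuous_invFun := continuous_const_mul t⁻¹ }
  have hinv : (Measure.map e μ).IsAddHaarMeasure := e.isAddHaarMeasure_map μ
  -- The image measure is a multiple of `μ`; the factor is one because a unit preserves the
  -- integers, whose volume is finite and nonzero.
  have hs := Measure.isAddLeftInvariant_eq_smul (Measure.map e μ) μ
  have hem : Measurable e := (continuous_const_mul t).measurable
  have hpre : e ⁻¹' (integerAddSubgroup F : Set F) = integerAddSubgroup F := by
    ext x
    change valuation F (t * x) ≤ 1 ↔ valuation F x ≤ 1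
    rw [map_mul, ht, one_mul]
  have h1 : Measure.map e μ (integerAddSubgroup F : Set F) = μ (integerAddSubgroup F : Set F) := by
    rw [Measure.map_apply hem (isOpen_integer F).measurableSet, hpre]
  have hne : μ (integerAddSubgroup F : Set F) ≠ 0 :=
    (isOpen_integer F).measure_ne_zero μ ⟨0, AddSubgroup.zero_mem _⟩
  have hfin : μ (integerAddSubgroup F : Set F) ≠ ⊤ := (isCompact_integer F).measure_ne_top
  refine ⟨hem, ?_⟩
  change Measure.map e μ = μ
  rw [hs, Measure.smul_apply, ENNReal.smul_def, smul_eq_mul] at h1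
  have h2 := (ENNReal.mul_eq_right hne hfin).mp h1
  rw [hs, ENNReal.coe_eq_one.mp h2, one_smul]

end SelfDual
end WeilDescent

/-! ### Galois action on integrals of locally constant functions -/

namespace WeilDescent

open Filter Topology

section LocallyConstantIntegral

/-- Integrals of locally constant functions of compact support are finite sums. -/
theorem exists_integral_eq_sum {G L : Type*} [TopologicalSpace G] [T2Space G] [MeasurableSpace G]
    [BorelSpace G] (ν : Measure G) [IsFiniteMeasureOnCompacts ν] [Field L] {Φ : G → L}
    (hΦ : Φ ∈ schwartz G L) : ∃ T : Finset L, (∀ c ∈ T, IsCompact (Φ ⁻¹' {c}) ∧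
      IsOpen (Φ ⁻¹' {c})) ∧ ∀ f : L → ℂ, f 0 = 0 →
        ∫ x, f (Φ x) ∂ν = ∑ c ∈ T, (ν.real (Φ ⁻¹' {c}) : ℂ) * f c := by
  classical
  have hfin : (Φ '' tsupport Φ).Finite := by
    let : TopologicalSpace L := ⊥
    have : DiscreteTopology L := ⟨rfl⟩
    exact isCompact_iff_finite.mp (hΦ.2.isCompact.image hΦ.1.continuous)
  have hcomp : ∀ c ∈ hfin.toFinset.erase 0, IsCompact (Φ ⁻¹' {c}) ∧ IsOpen (Φ ⁻¹' {c}) := by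
    intro c hc
    refine ⟨hΦ.2.isCompact.of_isClosed_subset (hΦ.1.isClosed_fiber c) fun x hx => ?_,
      hΦ.1.isOpen_fiber c⟩
    refine subset_tsupport _ ?_
    rw [Function.mem_support, show Φ x = c from hx]
    exact Finset.ne_of_mem_erase hc
  -- The index set consists of nonzero values of `Φ`, not of `f ∘ Φ`: the same level sets then serve
  -- for `Φ` and for its Galois conjugates.
  refine ⟨hfin.toFinset.erase 0, hcomp, fun f hf => ?_⟩
  have hsum : (fun x => f (Φ x)) = fun x => ∑ c ∈ hfin.toFinset.erase 0,
      (Φ ⁻¹' {c}).indicator (fun _ => f c) x := by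
    ext x
    by_cases hx : Φ x = 0
    · rw [hx, hf]
      refine (Finset.sum_eq_zero fun c hc => Set.indicator_of_notMem ?_ _).symm
      intro h
      exact Finset.ne_of_mem_erase hc ((show Φ x = c from h).symm.trans hx)
    · rw [Finset.sum_eq_single (Φ x)]
      · rw [Set.indicator_of_mem (show x ∈ Φ ⁻¹' {Φ x} from rfl)]
      · intro c _ hc
        exact Set.indicator_of_notMem (fun h => hc (show Φ x = c from h).symm) _
      · intro h
        exact absurd (Finset.mem_erase.mpr ⟨hx, hfin.mem_toFinset.mpr
          ⟨x, subset_tsupport _ hx, rfl⟩⟩) h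
  rw [hsum, integral_finsetSum]
  · refine Finset.sum_congr rfl fun c hc => ?_
    rw [integral_indicator_const _ (hcomp c hc).2.measurableSet, Complex.real_smul]
  · intro c hc
    refine (integrable_indicator_iff (hcomp c hc).2.measurableSet).mpr ?_
    exact integrableOn_const (hcomp c hc).1.measure_ne_top

end LocallyConstantIntegral

section PiIntegral

variable {F : Type*} [Field F] [ValuativeRel F] [TopologicalSpace F] [IsNonarchimedeanLocalField F]
  [MeasurableSpace F] [BorelSpace F] {ι : Type*} [Fintype ι] (μ : Measure F)

theorem exists_pi_openAddSubgroup {W : Set (ι → F)} (hW : W ∈ 𝓝 0) :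
    ∃ K : AddSubgroup F, IsOpen (K : Set F) ∧ K ≤ integerAddSubgroup F ∧
      Set.univ.pi (fun _ : ι => (K : Set F)) ⊆ W := by
  rw [nhds_pi, Filter.mem_pi'] at hW
  obtain ⟨I, t, ht, hsub⟩ := hW
  have hU : (⋂ i, t i) ∩ (integerAddSubgroup F : Set F) ∈ 𝓝 (0 : F) :=
    inter_mem ((Filter.iInter_mem).mpr ht) ((isOpen_integer F).mem_nhds (AddSubgroup.zero_mem _))
  obtain ⟨K, hK, hKU, -⟩ := exists_openAddSubgroup hU
  exact ⟨K, hK, fun x hx => (hKU hx).2, fun x hx => hsub fun i _ =>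
    Set.mem_iInter.mp (hKU (hx i trivial)).1 i⟩

/-- A compact open set is a finite union of cosets of `K^ι` for a small open subgroup `K` of the
integers, and the volume of `K` is that of the integers divided by a finite index. -/
theorem measureReal_pi_mem [SecondCountableTopology F] [μ.IsAddLeftInvariant]
    [IsFiniteMeasureOnCompacts μ] {k : IntermediateField ℚ ℂ}
    (hμ : (μ.real (integerAddSubgroup F : Set F) : ℂ) ∈ k) {C : Set (ι → F)} (hC : IsCompact C)
    (hCo : IsOpen C) : ((Measure.pi fun _ : ι => μ).real C : ℂ) ∈ k := by
  obtain ⟨W, hW, hCW⟩ := compact_open_separated_add_right hC hCo subset_rfl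
  obtain ⟨K, hK, hKO, hKW⟩ := exists_pi_openAddSubgroup hW
  let P : AddSubgroup (ι → F) := AddSubgroup.pi Set.univ fun _ => K
  have hPcoe : (P : Set (ι → F)) = Set.univ.pi fun _ => (K : Set F) := rfl
  have hP : IsOpen (P : Set (ι → F)) := by
    rw [hPcoe]; exact isOpen_set_pi Set.finite_univ fun _ _ => hK
  have h1 := measure_eq_ncard_mul (Measure.pi fun _ : ι => μ) hP hC
    fun c hc x hx => hCW (Set.add_mem_add hc (hKW hx))
  have h2 := measure_eq_ncard_mul μ hK (isCompact_integer F)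
    fun c hc x hx => AddSubgroup.add_mem _ hc (hKO hx)
  set m := ((QuotientAddGroup.mk : F → F ⧸ K) '' (integerAddSubgroup F : Set F)).ncard with hm
  have hm0 : m ≠ 0 := by
    exact (Set.ncard_pos (finite_image_mk hK (isCompact_integer F))).mpr
      ⟨_, 0, AddSubgroup.zero_mem _, rfl⟩ |>.ne'
  have hKk : (μ.real (K : Set F) : ℂ) ∈ k := by
    have h3 : (μ.real (K : Set F) : ℂ) = μ.real (integerAddSubgroup F : Set F) / m := by
      rw [eq_div_iff (by exact_mod_cast hm0), Measure.real, Measure.real, h2, ENNReal.toReal_mul,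
        ENNReal.toReal_natCast]
      push_cast; ring
    rw [h3]
    exact div_mem hμ (natCast_mem _ _)
  rw [Measure.real, h1, ENNReal.toReal_mul, ENNReal.toReal_natCast, hPcoe, Measure.pi_pi,
    ENNReal.toReal_prod]
  push_cast
  exact mul_mem (natCast_mem _ _) (prod_mem fun _ _ => hKk)

/-- The integral is a finite sum of values weighted by volumes in `k`, which `σ` fixes; hence `σ`
passes under the integral sign. -/
theorem integral_galois_conj [SecondCountableTopology F] [μ.IsAddLeftInvariant]
    [IsFiniteMeasureOnCompacts μ] {k E : IntermediateField ℚ ℂ} (hkE : k ≤ E)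
    (hμ : (μ.real (integerAddSubgroup F : Set F) : ℂ) ∈ k) {σ : E ≃ₐ[ℚ] E}
    (hσ : ∀ x : E, (x : ℂ) ∈ k → σ x = x) {Φ : (ι → F) → E} (hΦ : Φ ∈ schwartz (ι → F) E) :
    ∃ e : E, (e : ℂ) = ∫ z, (Φ z : ℂ) ∂(Measure.pi fun _ : ι => μ) ∧
      ((σ e : E) : ℂ) = ∫ z, ((σ (Φ z) : E) : ℂ) ∂(Measure.pi fun _ : ι => μ) := by
  classical
  have := t2Space_of_localField F
  obtain ⟨T, hT, hsum⟩ := exists_integral_eq_sum (Measure.pi fun _ : ι => μ) hΦ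
  let v : E → E := fun c => if h : ((Measure.pi fun _ : ι => μ).real (Φ ⁻¹' {c}) : ℂ) ∈ k then
    ⟨_, hkE h⟩ else 0
  have hv : ∀ c ∈ T, (v c : ℂ) = (Measure.pi fun _ : ι => μ).real (Φ ⁻¹' {c}) ∧ σ (v c) = v c := by
    intro c hc
    have h := measureReal_pi_mem μ hμ (hT c hc).1 (hT c hc).2
    simp only [v, dif_pos h, true_and]
    exact hσ ⟨_, hkE h⟩ h
  refine ⟨∑ c ∈ T, v c * c, ?_, ?_⟩
  · rw [hsum (fun x => (x : ℂ)) (by simp)]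
    refine (map_sum E.val _ _).trans (Finset.sum_congr rfl fun c hc => ?_)
    rw [← (hv c hc).1]
    rfl
  · rw [hsum (fun x => ((σ x : E) : ℂ)) (by simp), map_sum]
    refine (map_sum E.val _ _).trans (Finset.sum_congr rfl fun c hc => ?_)
    rw [← (hv c hc).1, map_mul, (hv c hc).2]
    rfl

theorem integral_pi_unit_smul [SecondCountableTopology F] [IsFiniteMeasureOnCompacts μ] {t : F}
    (ht0 : t ≠ 0) (ht : MeasurePreserving (fun x => t * x) μ μ) (f : (ι → F) → ℂ) :
    ∫ z, f (t • z) ∂(Measure.pi fun _ : ι => μ) = ∫ z, f z ∂(Measure.pi fun _ : ι => μ) := by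
  have h := measurePreserving_pi (fun _ : ι => μ) (fun _ : ι => μ) fun _ => ht
  exact h.integral_comp (Homeomorph.smulOfNeZero t ht0).measurableEmbedding f

end PiIntegral

section SelfDualMeasure

variable {F : Type*} [Field F] [ValuativeRel F] [TopologicalSpace F] [IsNonarchimedeanLocalField F]
  [MeasurableSpace F] [BorelSpace F] {lam : AddChar F Circle}

/-- The default zero measure has all the properties used below, so existence of a self-dual measure
is not needed. -/
theorem isSelfDual_selfDualMeasure_or (lam : AddChar F Circle) :
    IsSelfDual lam (selfDualMeasure lam) ∨ selfDualMeasure lam = 0 := by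
  rw [selfDualMeasure]
  split_ifs with h
  · exact Or.inl h.choose_spec
  · exact Or.inr rfl

instance isAddLeftInvariant_selfDualMeasure : (selfDualMeasure lam).IsAddLeftInvariant := by
  rcases isSelfDual_selfDualMeasure_or lam with h | h
  · have := h.1; infer_instance
  · rw [h]; exact ⟨fun _ => Measure.map_zero _⟩

instance isFiniteMeasureOnCompacts_selfDualMeasure :
    IsFiniteMeasureOnCompacts (selfDualMeasure lam) := by
  rcases isSelfDual_selfDualMeasure_or lam with h | h
  · have := h.1; infer_instance
  · rw [h]; infer_instance

theorem selfDualMeasure_integer_mem (hlam : Continuous lam) (hlam' : lam ≠ 1) (p : ℕ)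
    [CharP 𝓀[F] p] :
    ((selfDualMeasure lam).real (integerAddSubgroup F : Set F) : ℂ) ∈ sqrtField p := by
  rcases isSelfDual_selfDualMeasure_or lam with h | h
  · exact measureReal_integer_mem_sqrtField h hlam hlam' p
  · rw [h]; simp

theorem measurePreserving_selfDualMeasure {t : F} (ht : valuation F t = 1) :
    MeasurePreserving (fun x => t * x) (selfDualMeasure lam) (selfDualMeasure lam) := by
  rcases isSelfDual_selfDualMeasure_or lam with h | h
  · have := h.1; exact measurePreserving_unit_mul _ ht
  · rw [h]; exact ⟨(continuous_const_mul t).measurable, Measure.map_zero _⟩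

end SelfDualMeasure
end WeilDescent

/-! ### The Weil integral in coordinates -/

namespace WeilDescent

open Filter Topology PolarizedSpace

section Blocks

variable {F : Type*} [Field F] {V : Type*} [AddCommGroup V] [Module F V] {n : ℕ}
  (S : PolarizedSpace F V n)

theorem blockC_add_blockD (g : V →ₗ[F] V) (y : S.Y) :
    (S.blockC g y : V) + S.blockD g y = g y := prX_add_prY S _

/-- The exponent in the kernel of the Weil operator. -/
noncomputable def weilPhase (g : V →ₗ[F] V) (x : S.X) (y : S.Y) : F :=
  (S.form (S.blockA g x : V) (S.blockB g x : V)
      - 2 * S.form (S.blockB g x : V) (S.blockC g y : V)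
      + S.form (S.blockC g y : V) (S.blockD g y : V)) / 2

/-- The phase is a quadratic form in `(x, y)`; this is why a dilation absorbs exactly a square
factor in the argument of `λ`. -/
theorem weilPhase_smul_smul (g : V →ₗ[F] V) (t : F) (x : S.X) (y : S.Y) :
    weilPhase S g (t • x) (t • y) = t ^ 2 * weilPhase S g x y := by
  simp only [weilPhase, map_smul, Submodule.coe_smul, LinearMap.smul_apply, smul_eq_mul]
  ring

variable {S}

/-- Expand `⟨yg, y'g⟩ = ⟨y, y'⟩ = 0`. The symmetry makes the phase depend on `y` only through `yc`,
so it is well defined on `Y_g`. -/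
theorem form_blockC_blockD_symm {g : V ≃ₗ[F] V} (hg : S.IsSymplectic g) (y y' : S.Y) :
    S.form (S.blockC g y : V) (S.blockD g y' : V) =
      S.form (S.blockC g y' : V) (S.blockD g y : V) := by
  have h := hg y y'
  rw [S.isotropic_Y _ y.2 _ y'.2] at h
  have h1 : g (y : V) = (S.blockC g y : V) + S.blockD g y := (blockC_add_blockD S g y).symm
  have h2 : g (y' : V) = (S.blockC g y' : V) + S.blockD g y' := (blockC_add_blockD S g y').symm
  rw [h1, h2] at h
  simp only [map_add, LinearMap.add_apply] at h
  rw [S.isotropic_X _ (S.blockC g y).2 _ (S.blockC g y').2,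
    S.isotropic_Y _ (S.blockD g y).2 _ (S.blockD g y').2] at h
  have h3 := S.isAlt.neg_eq (S.blockD g y : V) (S.blockC g y' : V)
  linear_combination h + h3

theorem weilPhase_congr {g : V ≃ₗ[F] V} (hg : S.IsSymplectic g) (x : S.X) {y y' : S.Y}
    (h : S.blockC g y = S.blockC g y') :
    weilPhase S (g : V →ₗ[F] V) x y = weilPhase S (g : V →ₗ[F] V) x y' := by
  have h1 : S.form (S.blockC g y : V) (S.blockD g y : V) =
      S.form (S.blockC g y' : V) (S.blockD g y' : V) := by
    rw [h, ← form_blockC_blockD_symm hg y y', h]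
  rw [weilPhase, weilPhase, h1, h]

variable (S)

theorem tau_partialY (i : ℕ) (z : {j : Fin n // (j : ℕ) < i} → F) :
    S.tau i (S.partialY i z : V) = ∑ j, z j • (S.basisX (j : Fin n) : V) := by
  have h1 : ∀ j : Fin n, (S.basisY j : V) = S.basisV (Sum.inr j) := by
    intro j; simp [PolarizedSpace.basisV]
  have h2 : ∀ j : {j : Fin n // (j : ℕ) < i}, S.tau i (S.basisY (j : Fin n) : V) =
      S.basisX (j : Fin n) := by
    intro j
    rw [h1, PolarizedSpace.tau, Module.Basis.constr_basis, Sum.elim_inr, if_pos j.2]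
  rw [PolarizedSpace.partialY]
  simp only [AddSubmonoidClass.coe_finsetSum, Submodule.coe_smul, map_sum, map_smul, h2]

/-- The map `z ↦ (∑ z_j y_j) p₁⁻¹`, with values in `Y` if `p₁` preserves `Y`. -/
noncomputable def coordinateMap (i : ℕ) (q : V ≃ₗ[F] V) :
    ({j : Fin n // (j : ℕ) < i} → F) →ₗ[F] S.Y :=
  S.prY ∘ₗ (q.symm : V →ₗ[F] V) ∘ₗ S.Y.subtype ∘ₗ
    (Fintype.linearCombination F fun j : {j : Fin n // (j : ℕ) < i} => S.basisY (j : Fin n))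

theorem coordinateMap_apply (i : ℕ) (q : V ≃ₗ[F] V) (z : {j : Fin n // (j : ℕ) < i} → F) :
    coordinateMap S i q z = S.prY (q.symm (S.partialY i z : V)) := rfl

/-- If `c` kills `y p₁⁻¹`, then `y τ_i p₂` lies in `Y`, hence so does `y τ_i`; but for `y` in the
span of the first `i` vectors `τ_i` lands in `X`, and `X ∩ Y = 0`. -/
theorem injective_blockC_comp_coordinateMap {i : ℕ} {q₁ q₂ : V ≃ₗ[F] V}
    (h₁ : S.IsParabolic q₁) (h₂ : S.IsParabolic q₂) {g : V →ₗ[F] V}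
    (hg : g = (q₂ : V →ₗ[F] V) ∘ₗ S.tau i ∘ₗ (q₁ : V →ₗ[F] V)) :
    Function.Injective (S.blockC g ∘ₗ coordinateMap S i q₁) := by
  rw [← LinearMap.ker_eq_bot, LinearMap.ker_eq_bot']
  intro z hz
  have hmem : q₁.symm (S.partialY i z : V) ∈ S.Y := by
    obtain ⟨y, hy, hyz⟩ := h₁.2.ge (S.partialY i z).2
    rw [← hyz]
    simpa using hy
  have h3 : (coordinateMap S i q₁ z : V) = q₁.symm (S.partialY i z : V) := by
    rw [coordinateMap_apply]
    exact congrArg Subtype.val (prY_coe_Y S ⟨_, hmem⟩)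
  have h4 : g (coordinateMap S i q₁ z : V) ∈ S.Y := by
    rw [← blockC_add_blockD S g, show S.blockC g (coordinateMap S i q₁ z) = 0 from hz]
    simp
  have h5 : g (coordinateMap S i q₁ z : V) = q₂ (S.tau i (S.partialY i z : V)) := by
    rw [h3, hg]; simp
  rw [h5] at h4
  have h6 : S.tau i (S.partialY i z : V) ∈ S.Y := by
    obtain ⟨y, hy, hyz⟩ := h₂.2.ge h4
    rwa [← q₂.injective hyz]
  have h7 : S.tau i (S.partialY i z : V) ∈ S.X := by
    rw [tau_partialY]
    exact Submodule.sum_mem _ fun j _ => Submodule.smul_mem _ _ (S.basisX j).2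
  have h8 : ∑ j, z j • (S.basisX (j : Fin n) : V) = 0 := by
    rw [← tau_partialY]
    exact Submodule.disjoint_def.mp S.isCompl.disjoint _ h7 h6
  have h9 : ∑ j, z j • S.basisX (j : Fin n) = 0 := by
    apply Subtype.ext
    refine Eq.trans ?_ h8
    simp
  have hli : LinearIndependent F fun j : {j : Fin n // (j : ℕ) < i} => S.basisX (j : Fin n) :=
    S.basisX.linearIndependent.comp _ Subtype.val_injective
  funext j
  exact Fintype.linearIndependent_iff.mp hli z h9 j

end Blocks

section KernelForm

variable {F : Type*} [Field F] [ValuativeRel F] [TopologicalSpace F] [IsNonarchimedeanLocalField F]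

/-- The residue field has `p^f` elements, so a nonzero absolute value is an even power of `√p` and
its inverse square root is again a power of `√p`. -/
theorem normAbs_rpow_mem_sqrtField (p : ℕ) [CharP 𝓀[F] p] (d : F) :
    ((normAbs d ^ (-(1 / 2) : ℝ) : ℝ) : ℂ) ∈ sqrtField p := by
  have hp := Fact.mk (prime_residueChar F p)
  rw [normAbs]
  split_ifs with h0
  · rw [Real.zero_rpow (by norm_num)]; simp
  · generalize WithZero.log
      (IsNonarchimedeanLocalField.valueGroupWithZeroIsoInt F (valuation F d)) = k
    have := Fintype.ofFinite 𝓀[F]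
    obtain ⟨f, -, hf⟩ := FiniteField.card 𝓀[F] p
    have hpos : (0 : ℝ) < p := Nat.cast_pos.mpr hp.out.pos
    have hs : 0 < Real.sqrt p := Real.sqrt_pos.mpr hpos
    have h1 : (Nat.card 𝓀[F] : ℝ) ^ k = ((Real.sqrt p ^ (f : ℕ)) ^ k) ^ (2 : ℝ) := by
      have h2 : (Nat.card 𝓀[F] : ℝ) = (Real.sqrt p ^ (f : ℕ)) ^ 2 := by
        rw [Nat.card_eq_fintype_card, hf, ← pow_mul, mul_comm, pow_mul, Real.sq_sqrt hpos.le,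
          Nat.cast_pow]
      rw [h2, Real.rpow_two, sq, sq, mul_zpow]
    rw [h1, ← Real.rpow_mul (by positivity)]
    norm_num
    rw [Real.rpow_neg_one]
    push_cast
    exact inv_mem (zpow_mem (pow_mem (sqrt_mem_sqrtField p) _) _)

variable [MeasurableSpace F] [BorelSpace F]
  {V : Type*} [AddCommGroup V] [Module F V] {n : ℕ} (S : PolarizedSpace F V n)

/-- By dimension count the map is a linear isomorphism, hence a homeomorphism for the module
topologies. An embedding permits the change of variables without measurability of the integrand. -/
theorem measurableEmbedding_mk_comp [SecondCountableTopology F] {ι : Type*} [Fintype ι]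
    {g : V →ₗ[F] V} {ℓ : (ι → F) →ₗ[F] S.Y} (hinj : Function.Injective (S.blockC g ∘ₗ ℓ))
    (hcard : Fintype.card ι = Module.finrank F (S.quotY g)) :
    MeasurableEmbedding fun z => (Submodule.Quotient.mk (ℓ z) : S.quotY g) := by
  let : TopologicalSpace (S.quotY g) := moduleTopology F _
  have : IsModuleTopology F (S.quotY g) := ⟨rfl⟩
  have : BorelSpace (S.quotY g) := ⟨rfl⟩
  have : ContinuousAdd (S.quotY g) := IsModuleTopology.toContinuousAdd F _
  have : Module.Finite F S.Y := Module.Finite.of_basis S.basisY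
  let m : (ι → F) →ₗ[F] S.quotY g := Submodule.mkQ _ ∘ₗ ℓ
  have hm : Function.Injective m := by
    rw [← LinearMap.ker_eq_bot, LinearMap.ker_eq_bot']
    intro z hz
    have : ℓ z ∈ LinearMap.ker (S.blockC g) := (Submodule.Quotient.mk_eq_zero _).mp hz
    exact hinj (by rw [map_zero]; exact this)
  let e : (ι → F) ≃ₗ[F] S.quotY g := LinearEquiv.ofInjectiveOfFinrankEq m hm (by
    rw [Module.finrank_fintype_fun_eq_card, hcard])
  have h1 : Continuous e := IsModuleTopology.continuous_of_linearMap (e : (ι → F) →ₗ[F] S.quotY g)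
  have h2 : Continuous e.symm :=
    IsModuleTopology.continuous_of_linearMap (e.symm : S.quotY g →ₗ[F] (ι → F))
  exact (Homeomorph.mk e.toEquiv h1 h2).measurableEmbedding

/-- The Weil integral of a symplectic map as an integral over a coordinate space. -/
theorem exists_weilIntegral_eq {lam : AddChar F Circle} (p : ℕ) [CharP 𝓀[F] p] {g : V ≃ₗ[F] V}
    (hg : S.IsSymplectic g) : ∃ (i : ℕ) (ℓ : ({j : Fin n // (j : ℕ) < i} → F) →ₗ[F] S.Y) (c : ℝ),
      (c : ℂ) ∈ sqrtField p ∧ Function.Injective (S.blockC g ∘ₗ ℓ) ∧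
      ∀ (φ : S.X → ℂ) (x : S.X), S.weilIntegral lam g φ x =
        c * ∫ z, (lam (weilPhase S g x (ℓ z)) : ℂ) * φ (S.blockA g x + S.blockC g (ℓ z))
          ∂(Measure.pi fun _ => selfDualMeasure lam) := by
  have := secondCountable_of_localField F
  by_cases hex : ∃ q : (V ≃ₗ[F] V) × (V ≃ₗ[F] V), S.IsParabolic q.1 ∧ S.IsParabolic q.2 ∧
      (g : V →ₗ[F] V) = (q.2 : V →ₗ[F] V) ∘ₗ
        S.tau (Module.finrank F (S.quotY (g : V →ₗ[F] V))) ∘ₗ (q.1 : V →ₗ[F] V)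
  · obtain ⟨h₁, h₂, hgq⟩ := hex.choose_spec
    set i := Module.finrank F (S.quotY (g : V →ₗ[F] V)) with hi
    set ℓ := coordinateMap S i hex.choose.1 with hℓ
    have hinj := injective_blockC_comp_coordinateMap S h₁ h₂ hgq
    have hfin : Module.Finite F S.Y := Module.Finite.of_basis S.basisY
    have hcard : Fintype.card {j : Fin n // (j : ℕ) < i} = i := by
      have hle : i ≤ n := by
        have := Submodule.finrank_quotient_le (LinearMap.ker (S.blockC (g : V →ₗ[F] V)))
        rwa [Module.finrank_eq_card_basis S.basisY, Fintype.card_fin] at this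
      rw [Fintype.card_subtype]
      have := Fin.card_filter_val_lt (n := n) (m := i)
      omega
    have hemb := measurableEmbedding_mk_comp S hinj hcard
    refine ⟨i, ℓ, _, normAbs_rpow_mem_sqrtField p (LinearMap.det (S.blockD
      ((hex.choose.1 ≪≫ₗ hex.choose.2 : V ≃ₗ[F] V) : V →ₗ[F] V))), hinj, fun φ x => ?_⟩
    rw [PolarizedSpace.weilIntegral, PolarizedSpace.weilMeasure, dif_pos hex, integral_smul_measure,
      ENNReal.toReal_ofReal (Real.rpow_nonneg (by
        rw [normAbs]; split_ifs <;> positivity) _), Complex.real_smul]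
    congr 1
    refine (hemb.integral_map _).trans (integral_congr_ae (Eventually.of_forall fun z => ?_))
    -- The chosen representative of the class of `ℓ z` differs from `ℓ z` by an element of `ker c`,
    -- which the integrand does not see.
    have h3 : S.blockC g (Quotient.out (Submodule.Quotient.mk (ℓ z) : S.quotY g)) =
        S.blockC g (ℓ z) := by
      have h4 : (Submodule.Quotient.mk (Quotient.out (Submodule.Quotient.mk (ℓ z) : S.quotY g)) :
        S.quotY g) = Submodule.Quotient.mk (ℓ z) := Quotient.out_eq _
      rw [Submodule.Quotient.eq, LinearMap.mem_ker, map_sub, sub_eq_zero] at h4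
      exact h4
    change (lam (weilPhase S g x (Quotient.out (Submodule.Quotient.mk (ℓ z) : S.quotY g))) : ℂ) *
      φ (S.blockA g x + S.blockC g (Quotient.out (Submodule.Quotient.mk (ℓ z) : S.quotY g))) = _
    rw [weilPhase_congr hg x h3, h3]
  -- Without a factorization the measure is zero by default, so the constant `c = 0` gives the
  -- formula.
  · have hempty : IsEmpty {j : Fin n // (j : ℕ) < 0} := ⟨fun j => absurd j.2 (Nat.not_lt_zero _)⟩
    refine ⟨0, 0, 0, by simp, fun _ _ _ => Subsingleton.elim _ _, fun φ x => ?_⟩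
    rw [PolarizedSpace.weilIntegral, PolarizedSpace.weilMeasure, dif_neg hex]
    simp

end KernelForm
end WeilDescent

/-! ### Galois conjugates of Weil operators -/

namespace WeilDescent

open Filter Topology PolarizedSpace

section Intertwining

variable {F : Type*} [Field F] [ValuativeRel F] [TopologicalSpace F] [IsNonarchimedeanLocalField F]
  {lam : AddChar F Circle}

theorem isLocallyConstant_lamE (hlam : Continuous lam) : IsLocallyConstant (lamE lam) := by
  obtain ⟨K, hK, h1, -⟩ := exists_openAddSubgroup_trivial hlam
  refine (IsLocallyConstant.iff_exists_open _).mpr fun x => ?_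
  refine ⟨(fun y => y - x) ⁻¹' (K : Set F), hK.preimage (continuous_sub_right x), ?_,
    fun y hy => ?_⟩
  · change x - x ∈ K
    rw [sub_self]; exact K.zero_mem
  · have h2 : y = (y - x) + x := by ring
    rw [lamE_inj, h2, AddChar.map_add_eq_mul, h1 _ hy, one_mul]

variable {V : Type*} [AddCommGroup V] [Module F V] {n : ℕ} (S : PolarizedSpace F V n)
  {ι : Type*} [Fintype ι]

theorem continuous_weilPhase_comp (g : V →ₗ[F] V) (x : S.X) (ℓ : (ι → F) →ₗ[F] S.Y) :
    Continuous fun z => weilPhase S g x (ℓ z) := by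
  have h1 : Continuous fun z => S.form (S.blockB g x : V) (S.blockC g (ℓ z) : V) :=
    IsModuleTopology.continuous_of_linearMap
      (S.form (S.blockB g x : V) ∘ₗ S.X.subtype ∘ₗ S.blockC g ∘ₗ ℓ)
  have h2 : Continuous fun z => S.form (S.blockC g (ℓ z) : V) (S.blockD g (ℓ z) : V) :=
    (IsModuleTopology.continuous_bilinear_of_finite_left
      (S.form.compl₁₂ (S.X.subtype ∘ₗ S.blockC g ∘ₗ ℓ) (S.Y.subtype ∘ₗ S.blockD g ∘ₗ ℓ))).comp
      (continuous_id.prodMk continuous_id)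
  simp only [weilPhase]
  fun_prop

/-- Compact support comes from injectivity of `c ∘ ℓ`: a linear left inverse carries the translated
support of `φ` onto a compact set containing the support in `z`. -/
theorem weilKernel_mem_schwartz (hlam : Continuous lam) (g : V →ₗ[F] V) (x : S.X)
    {ℓ : (ι → F) →ₗ[F] S.Y} (hinj : Function.Injective (S.blockC g ∘ₗ ℓ))
    (φ : S.schwartzX (charField lam)) :
    (fun z => lamE lam (weilPhase S g x (ℓ z)) * φ.1 (S.blockA g x + S.blockC g (ℓ z))) ∈
      schwartz (ι → F) (charField lam) := by
  have := t2Space_of_localField F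
  let : TopologicalSpace S.X := moduleTopology F S.X
  have : IsModuleTopology F S.X := ⟨rfl⟩
  have : IsTopologicalAddGroup S.X := IsModuleTopology.topologicalAddGroup F S.X
  have hc : Continuous fun z => S.blockC g (ℓ z) :=
    IsModuleTopology.continuous_of_linearMap (S.blockC g ∘ₗ ℓ)
  constructor
  · refine ((isLocallyConstant_lamE hlam).comp_continuous
      (continuous_weilPhase_comp S g x ℓ)).mul ?_
    exact IsLocallyConstant.comp_continuous φ.2.1 (continuous_const.add hc)
  · obtain ⟨R, hR⟩ := LinearMap.exists_leftInverse_of_injective (S.blockC g ∘ₗ ℓ)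
      (LinearMap.ker_eq_bot.mpr hinj)
    have hRc : Continuous R := IsModuleTopology.continuous_of_linearMap R
    refine HasCompactSupport.intro (K := (fun v => R (v - S.blockA g x)) '' tsupport φ.1)
      (IsCompact.image φ.2.2 (hRc.comp (continuous_sub_right _))) fun z hz => ?_
    have : φ.1 (S.blockA g x + S.blockC g (ℓ z)) = 0 := by
      by_contra h
      refine hz ⟨_, subset_tsupport _ h, ?_⟩
      simp only [add_sub_cancel_left]
      exact LinearMap.congr_fun hR z
    rw [this, mul_zero]

variable [MeasurableSpace F] [BorelSpace F]

theorem weil_eq_zero_or (lam : AddChar F Circle) (g : V →ₗ[F] V) :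
    (∀ (φ : S.schwartzX (charField lam)) (x : S.X), (((S.weil lam g φ).1 x : charField lam) : ℂ) =
      S.weilIntegral lam g (fun x' => ((φ.1 x' : charField lam) : ℂ)) x) ∨ S.weil lam g = 0 := by
  rw [PolarizedSpace.weil]
  split_ifs with h
  · exact Or.inl h.choose_spec
  · exact Or.inr rfl

/-- Conjugating the Weil operator by a Galois automorphism that acts on `lam` through `t ^ 2` is
conjugating it by the dilation `t`. -/
theorem dil_mul_galConj_weil {p : ℕ} [CharP 𝓀[F] p] (hp2 : p ≠ 2) (hlam : Continuous lam)
    (hlam' : lam ≠ 1) {σ : charField lam ≃ₐ[ℚ] charField lam} (hσ : σ ∈ galH p lam) {t : Fˣ}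
    (ht : valuation F (t : F) = 1) (hσt : Acts lam σ ((t : F) ^ 2)) {g : V ≃ₗ[F] V}
    (hg : S.IsSymplectic g) :
    dil S (charField lam) t * S.galConj σ (S.weil lam g) =
      S.weil lam g * dil S (charField lam) t := by
  rcases weil_eq_zero_or S lam (g : V →ₗ[F] V) with hW | hW
  swap
  · rw [hW, zero_mul]
    refine LinearMap.ext fun φ => Subtype.ext (funext fun x => ?_)
    exact map_zero σ
  have := secondCountable_of_localField F
  obtain ⟨i, ℓ, c, hc, hinj, hformula⟩ := exists_weilIntegral_eq S p (lam := lam) hg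
  have hle := sqrtField_le_charField (p := p) hlam hlam' hp2
  let cE : charField lam := ⟨c, hle hc⟩
  have hcE : σ cE = cE := mem_galH.mp hσ cE hc
  ext φ x
  set ψ := S.galAct σ⁻¹ φ with hψ
  change ((σ ((S.weil lam g ψ).1 (t⁻¹ • x)) : charField lam) : ℂ) = _
  obtain ⟨x', rfl⟩ : ∃ x' : S.X, (t : F) • x' = x :=
    ⟨t⁻¹ • x, by rw [← Units.smul_def, smul_inv_smul]⟩
  rw [← Units.smul_def, inv_smul_smul, Units.smul_def]
  obtain ⟨e, he1, he2⟩ := integral_galois_conj (selfDualMeasure lam) hle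
    (selfDualMeasure_integer_mem hlam hlam' p) (mem_galH.mp hσ)
    (weilKernel_mem_schwartz S hlam g x' hinj ψ)
  have h1 : (S.weil lam g ψ).1 x' = cE * e := by
    apply Subtype.ext
    rw [hW, hformula]
    change _ = (c : ℂ) * (e : ℂ)
    rw [he1]
    rfl
  rw [h1, map_mul, hcE, Module.End.mul_apply, hW, hformula]
  change (c : ℂ) * ((σ e : charField lam) : ℂ) = _
  rw [he2]
  congr 1
  -- Substitute `z ↦ tz`, which preserves the measure as `|t| = 1`. With `x = t x'` the phase
  -- acquires the factor `t²` that `σ` produces on the values of `λ`.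
  refine Eq.trans ?_ (integral_pi_unit_smul (selfDualMeasure lam) t.ne_zero
    (measurePreserving_selfDualMeasure ht) _)
  refine integral_congr_ae (Eventually.of_forall fun z => ?_)
  have h2 : t⁻¹ • (S.blockA g ((t : F) • x') + S.blockC g (ℓ ((t : F) • z))) =
      S.blockA g x' + S.blockC g (ℓ z) := by
    rw [map_smul, map_smul, map_smul, ← smul_add, ← Units.smul_def, inv_smul_smul]
  have h3 : weilPhase S g ((t : F) • x') (ℓ ((t : F) • z)) = (t : F) ^ 2 * weilPhase S g x' (ℓ z) := by
    rw [map_smul, weilPhase_smul_smul]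
  have h4 : σ (ψ.1 (S.blockA g x' + S.blockC g (ℓ z))) =
      φ.1 (S.blockA g x' + S.blockC g (ℓ z)) := σ.apply_symm_apply _
  simp only [dil_apply]
  rw [map_mul, h4, hσt, h2, h3]
  rfl

end Intertwining
end WeilDescent

/-! ### Descent for smooth semilinear actions -/

namespace WeilDescent

open Filter Topology PolarizedSpace

section Descent

variable {k E M : Type*} [Field k] [Field E] [Algebra k E] [AddCommGroup M] [Module E M]
  {G : Subgroup (E ≃ₐ[k] E)}

/-- A semilinear action of a group of automorphisms of a field `E` on an `E`-vector space, each
vector being fixed by the automorphisms that fix a suitable finite subset of `E`. -/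
structure IsSmoothSemilinear (ρ : G → M → M) : Prop where
  map_add : ∀ σ x y, ρ σ (x + y) = ρ σ x + ρ σ y
  map_smul : ∀ σ (c : E) x, ρ σ (c • x) = σ.1 c • ρ σ x
  map_mul : ∀ σ τ x, ρ (σ * τ) x = ρ σ (ρ τ x)
  smooth : ∀ x, ∃ s : Set E, s.Finite ∧ ∀ σ : G, (∀ a ∈ s, σ.1 a = a) → ρ σ x = x

namespace IsSmoothSemilinear

variable {ρ : G → M → M}

theorem map_zero (hρ : IsSmoothSemilinear ρ) (σ : G) : ρ σ 0 = 0 := by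
  simpa using hρ.map_add σ 0 0

theorem map_sum (hρ : IsSmoothSemilinear ρ) (σ : G) {κ : Type*} (s : Finset κ) (f : κ → M) :
    ρ σ (∑ i ∈ s, f i) = ∑ i ∈ s, ρ σ (f i) :=
  _root_.map_sum (AddMonoidHom.mk' (ρ σ) (hρ.map_add σ)) f s

/-- The fixed vectors span. -/
theorem span_fixed (hρ : IsSmoothSemilinear ρ) [Algebra.IsAlgebraic k E] :
    ⊤ ≤ Submodule.span E {x : M | ∀ σ, ρ σ x = x} := by
  intro x _
  by_contra hx
  -- A linear form that kills every fixed vector but not `x`; the traces built below force it to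
  -- kill `x`.
  obtain ⟨ℓ, hℓx, hℓ⟩ := Submodule.exists_dual_map_eq_bot_of_notMem hx inferInstance
  have hfix : ∀ y : M, (∀ σ, ρ σ y = y) → ℓ y = 0 := fun y hy => by
    have : ℓ y ∈ (Submodule.span E {x : M | ∀ σ, ρ σ x = x}).map ℓ :=
      Submodule.mem_map_of_mem (Submodule.subset_span hy)
    rwa [hℓ, Submodule.mem_bot] at this
  obtain ⟨s, hs, hsx⟩ := hρ.smooth x
  let L := IntermediateField.adjoin k s
  have := hs.to_subtype
  have : FiniteDimensional k L :=
    IntermediateField.finiteDimensional_adjoin fun a _ => Algebra.IsIntegral.isIntegral a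
  let r : G → (L →ₐ[k] E) := fun σ => (σ.1 : E →ₐ[k] E).comp L.val
  have hr : ∀ σ τ, r σ = r τ → ρ σ x = ρ τ x := by
    intro σ τ h
    have h1 : ρ (τ⁻¹ * σ) x = x := hsx _ fun a ha => by
      have h2 : σ.1 a = τ.1 a := DFunLike.congr_fun h ⟨a, IntermediateField.subset_adjoin k s ha⟩
      change τ.1.symm (σ.1 a) = a
      rw [h2, AlgEquiv.symm_apply_apply]
    conv_rhs => rw [← h1, ← hρ.map_mul, mul_inv_cancel_left]
  have : Finite (Set.range r) := Subtype.finite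
  have := Fintype.ofFinite (Set.range r)
  choose ν hν using fun f : Set.range r => f.2
  have hmul : ∀ (τ : G) f, r (τ * ν f) = (τ.1 : E →ₐ[k] E).comp f.1 := fun τ f => by
    rw [← hν f]; rfl
  -- These are the traces of `a x` over the finitely many restrictions of `G` to `L`. They are fixed
  -- because composition with `τ` permutes the restrictions, and `ρ σ x` depends only on that of
  -- `σ`.
  have hv : ∀ (a : L) (τ : G), ρ τ (∑ f : Set.range r, f.1 a • ρ (ν f) x) =
      ∑ f : Set.range r, f.1 a • ρ (ν f) x := by
    intro a τ
    let P : Set.range r → Set.range r := fun f => ⟨r (τ * ν f), _, rfl⟩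
    have hP : Function.Bijective P := by
      rw [← Finite.injective_iff_bijective]
      intro f g h
      have h1 : r (τ * ν f) = r (τ * ν g) := congrArg Subtype.val h
      rw [hmul, hmul] at h1
      exact Subtype.ext (AlgHom.ext fun b => τ.1.injective (DFunLike.congr_fun h1 b))
    rw [hρ.map_sum]
    refine Fintype.sum_bijective P hP _ _ fun f => ?_
    rw [hρ.map_smul, ← hρ.map_mul]
    congr 1
    · exact (DFunLike.congr_fun (hmul τ f) a).symm
    · exact hr _ _ (hν (P f)).symm
  -- Applying `ℓ` to the traces gives a linear relation, valid for all `a`, between distinct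
  -- embeddings of `L`. By independence every coefficient `ℓ(ρ(ν f) x)` vanishes, in particular the
  -- one of the identity, which is `ℓ x`.
  have hind : LinearIndependent E fun f : Set.range r => (f.1 : L →ₗ[k] E) :=
    (linearIndependent_toLinearMap k L E).comp _ Subtype.val_injective
  have h0 := Fintype.linearIndependent_iff.mp hind (fun f => ℓ (ρ (ν f) x)) (by
    ext a
    have := hfix _ (hv a)
    rw [_root_.map_sum] at this
    simp only [_root_.map_smul, smul_eq_mul] at this
    simpa [mul_comm] using this) ⟨r 1, 1, rfl⟩
  refine hℓx ?_
  rw [← h0, hr _ 1 (hν ⟨r 1, 1, rfl⟩), hsx 1 fun _ _ => rfl]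

/-- Any two smooth semilinear actions on a vector space are isomorphic. -/
theorem exists_intertwining [Algebra.IsAlgebraic k E] (hρ : IsSmoothSemilinear ρ) {ρ' : G → M → M}
    (hρ' : IsSmoothSemilinear ρ') :
    ∃ α : M ≃ₗ[E] M, ∀ σ x, α (ρ σ x) = ρ' σ (α x) := by
  let b := Module.Basis.ofSpan hρ.span_fixed
  let b' := Module.Basis.ofSpan hρ'.span_fixed
  have hb : ∀ i σ, ρ σ (b i) = b i := fun i =>
    Module.Basis.ofSpan_subset hρ.span_fixed ⟨i, rfl⟩
  have hb' : ∀ i σ, ρ' σ (b' i) = b' i := fun i =>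
    Module.Basis.ofSpan_subset hρ'.span_fixed ⟨i, rfl⟩
  -- Both are bases of the same space, so their index sets are in bijection; as both consist of
  -- fixed vectors, the resulting isomorphism intertwines.
  refine ⟨b.equiv b' (b.indexEquiv b'), fun σ x => ?_⟩
  induction b.mem_span x using Submodule.span_induction with
  | mem x hx =>
    obtain ⟨i, rfl⟩ := hx
    rw [hb, Module.Basis.equiv_apply, hb']
  | zero => rw [hρ.map_zero, _root_.map_zero, hρ'.map_zero]
  | add x y _ _ hx hy => rw [hρ.map_add, _root_.map_add, hx, hy, _root_.map_add, hρ'.map_add]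
  | smul c x _ hx => rw [hρ.map_smul, _root_.map_smul, hx, _root_.map_smul, hρ'.map_smul]

end IsSmoothSemilinear

end Descent
end WeilDescent

/-! ### Smoothness of the twisted action -/

namespace WeilDescent

open Filter Topology PolarizedSpace

section Smoothness

variable {F : Type*} [Field F] [ValuativeRel F] [TopologicalSpace F] [IsNonarchimedeanLocalField F]
  {V : Type*} [AddCommGroup V] [Module F V] {n : ℕ} (S : PolarizedSpace F V n)
  {E : Type*} [Field E]

theorem finite_range_of_mem_schwartzX (φ : S.schwartzX E) : (Set.range φ.1).Finite := by
  let : TopologicalSpace S.X := moduleTopology F S.X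
  have h : (φ.1 '' tsupport φ.1).Finite := by
    let : TopologicalSpace E := ⊥
    have : DiscreteTopology E := ⟨rfl⟩
    exact isCompact_iff_finite.mp (IsCompact.image φ.2.2 (IsLocallyConstant.continuous φ.2.1))
  refine (h.insert 0).subset ?_
  rintro _ ⟨x, rfl⟩
  by_cases hx : x ∈ tsupport φ.1
  · exact Or.inr ⟨x, hx, rfl⟩
  · exact Or.inl (image_eq_zero_of_notMem_tsupport hx)

/-- A locally constant function of compact support is invariant under dilations near `1`. -/
theorem eventually_dil_eq (φ : S.schwartzX E) :
    ∀ᶠ s in 𝓝 (1 : F), ∀ t : Fˣ, (t : F) = s → dil S E t φ = φ := by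
  let : TopologicalSpace S.X := moduleTopology F S.X
  have : IsModuleTopology F S.X := ⟨rfl⟩
  have : ContinuousSMul F S.X := IsModuleTopology.toContinuousSMul F S.X
  have h1 : ∀ᶠ s in 𝓝 (1 : F), ∀ x ∈ tsupport φ.1, φ.1 (s • x) = φ.1 x := by
    refine IsCompact.eventually_forall_of_forall_eventually φ.2.2 fun x _ => ?_
    have h2 : IsLocallyConstant fun z : F × S.X => φ.1 (z.1 • z.2) :=
      IsLocallyConstant.comp_continuous φ.2.1 continuous_smul
    have h3 : IsLocallyConstant fun z : F × S.X => φ.1 z.2 :=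
      IsLocallyConstant.comp_continuous φ.2.1 continuous_snd
    filter_upwards [h2.eventually_eq (1, x), h3.eventually_eq (1, x)] with z hz hz'
    rw [hz, hz', one_smul]
  -- Both `s` and `s⁻¹` are needed: a point outside the support might be moved into it.
  have h2 : ∀ᶠ s in 𝓝 (1 : F), ∀ x ∈ tsupport φ.1, φ.1 (s⁻¹ • x) = φ.1 x := by
    have : Tendsto (fun s : F => s⁻¹) (𝓝 1) (𝓝 1) := by
      simpa using tendsto_inv₀ (one_ne_zero (α := F))
    exact this.eventually h1
  filter_upwards [h1, h2] with s hs hs' t hts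
  subst hts
  refine Subtype.ext (funext fun x => ?_)
  rw [dil_apply]
  by_cases hx : x ∈ tsupport φ.1
  · rw [← hs' x hx, Units.smul_def, Units.val_inv_eq_inv_val]
  · by_cases hx' : t⁻¹ • x ∈ tsupport φ.1
    · rw [← hs _ hx', ← Units.smul_def, smul_inv_smul]
    · rw [image_eq_zero_of_notMem_tsupport hx, image_eq_zero_of_notMem_tsupport hx']

end Smoothness

section Parameters

variable {F : Type*} [Field F] [ValuativeRel F] [TopologicalSpace F] [IsNonarchimedeanLocalField F]
  {p : ℕ} [CharP 𝓀[F] p] {lam : AddChar F Circle} {ε : F}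

/-- An automorphism that fixes enough values of `lam` has its parameters near `(0, 1)`. -/
theorem exists_finset_parameters (hlam : Continuous lam) (hlam' : lam ≠ 1) (hp2 : p ≠ 2)
    (hε' : IsPrimitiveRoot ε (p - 1)) {U : Set F} (hU : U ∈ 𝓝 (1 : F)) :
    ∃ T : Finset F, ∀ (i : ℕ) (s : F), i ≤ (p - 1) / 2 → s ∈ higherUnits F p 1 →
      (∀ t ∈ T, lam (ε ^ (2 * i) * s ^ 2 * t) = lam t) → i ≡ 0 [MOD (p - 1) / 2] ∧ s ∈ U := by
  have h1 := one_mem_higherUnits (F := F) (p := p) 1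
  let Z : Set (ℕ × F) := {z | z.1 ≡ 0 [MOD (p - 1) / 2] ∧ z.2 ∈ interior U}
  have hZ : IsOpen Z := (isOpen_discrete {i : ℕ | i ≡ 0 [MOD (p - 1) / 2]}).prod isOpen_interior
  have hK : IsCompact ((Set.Iic ((p - 1) / 2) ×ˢ higherUnits F p 1) \ Z) :=
    (((Set.finite_Iic _).isCompact).prod (isCompact_higherUnits F p 1)).diff hZ
  -- The parameters away from `(0, 1)` form a compact set. Uniqueness of parameters shows that each
  -- of them moves some value `λ(t)`, so these open sets cover it and finitely many `t` suffice.
  let O : F → Set (ℕ × F) := fun t => {z | lam (ε ^ (2 * z.1) * z.2 ^ 2 * t) ≠ lam t}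
  have hO : ∀ t, IsOpen (O t) := fun t => by
    have hc : Continuous fun i : ℕ => ε ^ (2 * i) := continuous_of_discreteTopology
    have : Continuous fun z : ℕ × F => lam (ε ^ (2 * z.1) * z.2 ^ 2 * t) :=
      hlam.comp (((hc.comp continuous_fst).mul (continuous_snd.pow 2)).mul continuous_const)
    exact isOpen_ne.preimage this
  obtain ⟨T, hT⟩ := hK.elim_finite_subcover O hO fun z hz => by
    by_contra hcon
    simp only [O, Set.mem_iUnion, Set.mem_ofPred_eq, not_exists, not_not] at hcon
    have h2 : ε ^ (2 * z.1) * z.2 ^ 2 = ε ^ (2 * 0) * 1 ^ 2 :=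
      eq_of_forall_lam_eq hlam' fun x => by rw [hcon]; simp
    obtain ⟨hs, hi⟩ := pow_eq_of_mul_sq_eq hp2 hε' hz.1.2 h1 h2
    refine hz.2 ⟨hi, ?_⟩
    rw [hs]
    exact mem_interior_iff_mem_nhds.mpr hU
  refine ⟨T, fun i s hi hs h => ?_⟩
  by_contra hcon
  have hz : (i, s) ∈ (Set.Iic ((p - 1) / 2) ×ˢ higherUnits F p 1) \ Z :=
    ⟨⟨hi, hs⟩, fun hz => hcon ⟨hz.1, interior_subset hz.2⟩⟩
  obtain ⟨t, ht, hz'⟩ := Set.mem_iUnion₂.mp (hT hz)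
  exact hz' (h t ht)

theorem isAlgebraic_charField {p : ℕ} [CharP 𝓀[F] p] (hlam : Continuous lam) :
    Algebra.IsAlgebraic ℚ (charField lam) := by
  refine IntermediateField.isAlgebraic_adjoin fun z hz => ?_
  have hp := prime_residueChar F p
  rcases hz with ⟨t, rfl⟩ | rfl
  · obtain ⟨n, hn⟩ := exists_pow_eq_one p hlam t
    rw [← Circle.coe_inj, Circle.coe_pow, Circle.coe_one] at hn
    exact IsIntegral.of_pow (pow_pos hp.pos n) (by rw [hn]; exact isIntegral_one)
  · exact IsIntegral.of_pow (n := 2) two_pos (by rw [Complex.I_sq]; exact isIntegral_one.neg)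

end Parameters
end WeilDescent

/-! ### Triviality of the cocycle and the main theorem -/

namespace WeilDescent

open Filter Topology PolarizedSpace

section Triviality

variable {F : Type*} [Field F] [ValuativeRel F] [TopologicalSpace F] [IsNonarchimedeanLocalField F]
  {V : Type*} [AddCommGroup V] [Module F V] {n : ℕ} (S : PolarizedSpace F V n)
  {E : Type*} [Field E] [Algebra ℚ E] {G : Subgroup (E ≃ₐ[ℚ] E)}

theorem galAct_eq_self {σ : E ≃ₐ[ℚ] E} {φ : S.schwartzX E} (h : ∀ a ∈ Set.range φ.1, σ a = a) :
    S.galAct σ φ = φ :=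
  Subtype.ext (funext fun x => h _ ⟨x, rfl⟩)

theorem isSmoothSemilinear_galAct :
    IsSmoothSemilinear (fun (σ : G) (φ : S.schwartzX E) => S.galAct σ.1 φ) where
  map_add σ := galAct_add S σ.1
  map_smul σ := galAct_smul S σ.1
  map_mul _ _ _ := rfl
  smooth φ := ⟨_, finite_range_of_mem_schwartzX S φ, fun _ h => galAct_eq_self S h⟩

/-- A cocycle in `GL(𝒮(X, E))` that is trivial on each vector for all automorphisms fixing a
suitable finite set is a coboundary. -/
theorem exists_coboundary [Algebra.IsAlgebraic ℚ E]
    (δ : G → LinearMap.GeneralLinearGroup E (S.schwartzX E))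
    (hmul : ∀ σ τ, (δ (σ * τ)).1 = (δ σ).1 * S.galConj σ.1 (δ τ).1)
    (hsmooth : ∀ φ, ∃ s : Set E, s.Finite ∧ ∀ σ : G, (∀ a ∈ s, σ.1 a = a) → (δ σ).1 φ = φ) :
    ∃ α : LinearMap.GeneralLinearGroup E (S.schwartzX E),
      ∀ σ : G, (δ σ).1 = (α⁻¹).1 * S.galConj σ.1 α.1 := by
  -- The action twisted by `δ`; the cocycle relation is exactly its multiplicativity. An isomorphism
  -- with the untwisted action is the required `α`.
  have hδ : IsSmoothSemilinear
      (fun (σ : G) (φ : S.schwartzX E) => (δ σ).1 (S.galAct σ.1 φ)) := by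
    refine ⟨fun σ x y => ?_, fun σ c x => ?_, fun σ τ x => ?_, fun φ => ?_⟩
    · rw [galAct_add, map_add]
    · rw [galAct_smul, map_smul]
    · rw [hmul, Module.End.mul_apply, galConj_apply, galAct_galAct]
      congr 3
      rw [Subgroup.coe_mul, inv_mul_cancel_left]
    · obtain ⟨s, hs, h⟩ := hsmooth φ
      refine ⟨s ∪ Set.range φ.1, hs.union (finite_range_of_mem_schwartzX S φ), fun σ hσ => ?_⟩
      rw [galAct_eq_self S fun a ha => hσ a (Or.inr ha), h σ fun a ha => hσ a (Or.inl ha)]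
  obtain ⟨α, hα⟩ := hδ.exists_intertwining (isSmoothSemilinear_galAct S)
  refine ⟨LinearMap.GeneralLinearGroup.ofLinearEquiv α, fun σ => ?_⟩
  rw [← Units.inv_mul_eq_iff_eq_mul, inv_inv]
  ext1 φ
  have := hα σ (S.galAct σ.1⁻¹ φ)
  rw [galAct_galAct, mul_inv_cancel, galAct_one] at this
  exact this

end Triviality

section Main

variable {F : Type*} [Field F] [ValuativeRel F] [TopologicalSpace F] [IsNonarchimedeanLocalField F]
  [MeasurableSpace F] [BorelSpace F]
  {V : Type*} [AddCommGroup V] [Module F V] {n : ℕ} (S : PolarizedSpace F V n)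
  {p : ℕ} [CharP 𝓀[F] p] {lam : AddChar F Circle}

theorem galConj_one_left {E : Type*} [Field E] [Algebra ℚ E] (T : Module.End E (S.schwartzX E)) :
    S.galConj 1 T = T := rfl

/-- The intertwining relation for the trivial automorphism, which acts on `λ` through `(-1)² = 1`.
-/
theorem commute_dil_neg_one_weil (hp2 : p ≠ 2) (hlam : Continuous lam) (hlam' : lam ≠ 1)
    {g : V ≃ₗ[F] V} (hg : S.IsSymplectic g) :
    Commute (dil S (charField lam) (-1)) (S.weil lam g) := by
  have := dil_mul_galConj_weil S hp2 hlam hlam' (one_mem (galH p lam)) (t := -1) (by simp)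
    (by simpa using acts_one (lam := lam)) hg
  rwa [galConj_one_left] at this

variable {ε : Fˣ} {η : charField lam ≃ₐ[ℚ] charField lam} {u : charField lam}

/-- Conjugating the Weil operator by a Galois automorphism is conjugating it by the value of the
cocycle. -/
theorem cocycleOperator_mul_galConj_weil (hp2 : p ≠ 2) (hlam : Continuous lam) (hlam' : lam ≠ 1)
    (hε' : IsPrimitiveRoot (ε : F) (p - 1)) {σ : charField lam ≃ₐ[ℚ] charField lam}
    (hσ : σ ∈ galH p lam) {m : ℕ} {s : Fˣ} (hs : (s : F) ∈ higherUnits F p 1)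
    (hσs : Acts lam σ ((ε : F) ^ (2 * m) * (s : F) ^ 2)) {g : V ≃ₗ[F] V}
    (hg : S.IsSymplectic g) :
    cocycleOperator S η u m (ε ^ m * s) * S.galConj σ (S.weil lam g) =
      S.weil lam g * cocycleOperator S η u m (ε ^ m * s) := by
  have h1 := dil_mul_galConj_weil S hp2 hlam hlam' hσ (t := ε ^ m * s)
    (by simp [valuation_root_eq_one hp2 hε', valuation_eq_one_of_mem_higherUnits hs])
    (by
      have : ((ε ^ m * s : Fˣ) : F) ^ 2 = (ε : F) ^ (2 * m) * (s : F) ^ 2 := by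
        push_cast; ring
      rwa [this]) hg
  rw [cocycleOperator, mul_assoc, h1, ← mul_assoc,
    (commute_evenOdd (commute_dil_neg_one_weil S hp2 hlam hlam' hg) _).eq, mul_assoc]

/-- Fixing enough values of `λ` forces `m ≡ 0` and `s` close to `1`. Periodicity then permits `m =
0`, where the correction is an empty product, and the dilation by `s` fixes `φ`. -/
theorem exists_finite_cocycleOperator_apply_eq (hp2 : p ≠ 2) (hlam : Continuous lam)
    (hlam' : lam ≠ 1) (hε' : IsPrimitiveRoot (ε : F) (p - 1))
    (hN : ∏ l ∈ Finset.range ((p - 1) / 2), (η ^ l) u = -1) (φ : S.schwartzX (charField lam)) :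
    ∃ A : Set (charField lam), A.Finite ∧ ∀ (σ : charField lam ≃ₐ[ℚ] charField lam) (m : ℕ)
      (s : Fˣ), m ≤ (p - 1) / 2 → (s : F) ∈ higherUnits F p 1 →
      Acts lam σ ((ε : F) ^ (2 * m) * (s : F) ^ 2) → (∀ a ∈ A, σ a = a) →
      cocycleOperator S η u m (ε ^ m * s) φ = φ := by
  obtain ⟨T, hT⟩ := exists_finset_parameters hlam hlam' hp2 hε' (eventually_dil_eq S φ)
  refine ⟨lamE lam '' T, T.finite_toSet.image _, fun σ m s hm hs hσ h => ?_⟩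
  obtain ⟨h1, h2⟩ := hT m s hm hs fun t ht => by
    rw [← lamE_inj, ← hσ t]
    exact h _ ⟨t, ht, rfl⟩
  have hεN : ε ^ ((p - 1) / 2) = -1 := Units.ext (by simpa using root_pow_half hp2 hε')
  rw [cocycleOperator_congr S hN hεN h1, cocycleOperator, Finset.prod_range_zero, evenOdd_one,
    one_mul, pow_zero, one_mul]
  exact h2 s rfl

end Main
end WeilDescent

open WeilDescent in
theorem proposition18 {F : Type*} [Field F] [ValuativeRel F] [TopologicalSpace F]
    [IsNonarchimedeanLocalField F] [MeasurableSpace F] [BorelSpace F]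
    (p : ℕ) [CharP 𝓀[F] p] (hp : p ≠ 2)
    (lam : AddChar F Circle) (hlam : Continuous lam) (hlam' : lam ≠ 1)
    {V : Type*} [AddCommGroup V] [Module F V] {n : ℕ} (S : PolarizedSpace F V n)
    (ε : F) (hε : ε ∈ primeClosure F) (hε' : IsPrimitiveRoot ε (p - 1))
    (η : charField lam ≃ₐ[ℚ] charField lam) (hη : η ∈ galH p lam)
    (hη' : RestrictsTo p lam η (ε ^ 2))
    (u : charField lam) (hu : (u : ℂ) ∈ rootField p)
    (hu' : Algebra.norm (sqrtField p) (⟨(u : ℂ), hu⟩ : rootField p) = -1) :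
    ∃ δ : galH p lam →
        LinearMap.GeneralLinearGroup (charField lam) (S.schwartzX (charField lam)),
      (∀ σ : galH p lam, (δ σ).1 = S.delta p ε η u σ.1) ∧
      (∀ σ τ : galH p lam, (δ (σ * τ)).1 = (δ σ).1 * S.galConj σ.1 (δ τ).1) ∧
      (∀ (σ : galH p lam) (g : V ≃ₗ[F] V), S.IsSymplectic g →
        S.galConj σ.1 (S.weil lam g) = ((δ σ)⁻¹).1 * S.weil lam g * (δ σ).1) ∧
      ∃ α : LinearMap.GeneralLinearGroup (charField lam) (S.schwartzX (charField lam)),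
        ∀ σ : galH p lam, (δ σ).1 = (α⁻¹).1 * S.galConj σ.1 α.1 := by
  have hη2 : Acts lam η (ε ^ 2) :=
    (acts_iff_restrictsTo p hlam (pow_mem (mem_primeSubring.mpr hε) 2)).mpr hη'
  have hN : ∏ l ∈ Finset.range ((p - 1) / 2), (η ^ l) u = -1 := by
    apply Subtype.ext
    rw [prod_conjugates_eq_norm hε hε' hlam hlam' hp hη hη2 hu, hu']
    simp
  have hpar := fun σ : galH p lam => exists_parameters hε hε' hlam hlam' hp σ.2
  lift ε to Fˣ using (root_ne_zero hp hε').isUnit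
  have hu0 : u ≠ 0 := by
    rintro rfl
    refine neg_ne_zero.mpr one_ne_zero (hN.symm.trans ?_)
    exact Finset.prod_eq_zero (Finset.mem_range.mpr (half_residueChar_pos F hp)) (map_zero _)
  have hpar' : ∀ σ : galH p lam, ∃ (i : ℕ) (s : Fˣ), i ≤ (p - 1) / 2 ∧
      (s : F) ∈ higherUnits F p 1 ∧ Acts lam σ.1 ((ε : F) ^ (2 * i) * (s : F) ^ 2) := fun σ => by
    obtain ⟨i, s, -, hi, hs, h⟩ := hpar σ
    exact ⟨i, Units.mk0 s (ne_zero_of_mem_higherUnits hs), hi, hs, h⟩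
  choose i s hi hs hact using hpar'
  have hδ : ∀ σ : galH p lam, S.delta p (ε : F) η u σ.1 =
      cocycleOperator S η u (i σ) (ε ^ i σ * s σ) := fun σ =>
    delta_eq_cocycleOperator S hlam hlam' hp hε hε' hN (hs σ) (hact σ)
  let δ : galH p lam → LinearMap.GeneralLinearGroup (charField lam) (S.schwartzX (charField lam)) :=
    fun σ => (isUnit_cocycleOperator S (η := η) hu0 (i σ) (ε ^ i σ * s σ)).unit
  have hmul : ∀ σ τ : galH p lam, (δ (σ * τ)).1 = (δ σ).1 * S.galConj σ.1 (δ τ).1 := by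
    intro σ τ
    change cocycleOperator S η u _ _ =
      cocycleOperator S η u _ _ * S.galConj σ.1 (cocycleOperator S η u _ _)
    -- The parameters chosen for `σ τ` need not be the products of those of `σ` and `τ`. Both give
    -- the same value of `delta`, which accepts the exponent `i σ + i τ` unreduced.
    rw [← cocycleOperator_mul S σ.1 (i σ) (i τ) _ _
      (apply_conjugate_eq hlam hlam' hp hε hη hη2 σ.2 (hs σ) (hact σ) hu), ← hδ,
      delta_eq_cocycleOperator S hlam hlam' hp hε hε' hN (m := i σ + i τ) (s := s σ * s τ)]
    · congr 1
      rw [pow_add, mul_mul_mul_comm]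
    · exact mul_mem_higherUnits (hs σ) (hs τ)
    · have := (hact σ).mul (hact τ)
      rw [Units.val_mul, mul_pow, mul_add, pow_add, mul_mul_mul_comm]
      exact this
  have := isAlgebraic_charField (p := p) hlam
  refine ⟨δ, fun σ => (hδ σ).symm, hmul, fun σ g hg => ?_, exists_coboundary S δ hmul fun φ => ?_⟩
  · rw [mul_assoc, Units.eq_inv_mul_iff_mul_eq]
    exact cocycleOperator_mul_galConj_weil S hp hlam hlam' hε' σ.2 (hs σ) (hact σ) hg
  · obtain ⟨A, hA, h⟩ := exists_finite_cocycleOperator_apply_eq S hp hlam hlam' hε' hN φ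
    exact ⟨A, hA, fun σ hσ => h σ.1 (i σ) (s σ) (hi σ) (hs σ) (hact σ) hσ⟩
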